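/- Let $G=G(\mathbb R)\subset GL(n,\mathbb R)$ be a closed, connected subgroup with semisimple Lie algebra $\mathfrak g$, and let $Q=iq\in i\,\mathfrak g$ (with $q\in\mathfrak g$) be a grading element, i.e. $\operatorname{ad}Q$ is diagonalizable with real eigenvalues on $\mathfrak g\otimes\mathbb C$ (for instance, the grading element of a graded $tt^*$ geometry). For $r\in\mathbb R$ put $\mathfrak g^{r,-r}=\{X\in\mathfrak g\otimes\mathbb C : [Q,X]=rX\}$. Let $H=\{g\in G : gQ=Qg\}$ be the centralizer of $Q$ in $G$ and $\mathfrak h=\{X\in\mathfrak g : [Q,X]=0\}$. Then $G/H$, with its quotient topology (Hausdorff and second countable), carries a structure of complex manifold with the following properties. 1. $G/H$ is a homogeneous complex manifold: the projection $G\to G/H$ is a smooth submersion, and each $g\in G$ acts on $G/H$ by a holomorphic map. 2. For every $g\in G$, the differential at $g$ of $G\to G/H$, with $T_gG$ identified with $\mathfrak g$ by left translation, is a surjection $\mathfrak g\to T_{gH}(G/H)$ with kernel $\mathfrak h$. Its complexification maps $\bigoplus_{r>0}\mathfrak g^{-r,r}$ (the eigenspaces of $\operatorname{ad}Q$ with negative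 eigenvalue) onto $T^{1,0}_{gH}(G/H)$, and $\bigoplus_{r<0}\mathfrak g^{-r,r}$ (those with positive eigenvalue) onto $T^{0,1}_{gH}(G/H)$. 3. For every finite-dimensional complex vector space $W$ with a continuous linear action of $H$, the homogeneous vector bundle $$\mathcal O(W)=G\times W\big/\{(g,w)\sim(gh,h^{-1}w)\ \text{for } h\in H\}\longrightarrow G/H$$ (with the quotient topology) is a homogeneous holomorphic vector bundle: it has an atlas of local trivializations, complex linear on the fibres, with holomorphic coordinate changes, for which $G\times W\to\mathcal O(W)$ is smooth and every $g\in G$ acts on $\mathcal O(W)$ by the holomorphic map $[g',w]\mapsto[gg',w]$. -/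

import Mathlib

open scoped Manifold ContDiff TensorProduct Topology MatrixGroups
open Bundle

universe u

attribute [local instance 100] LieRing.ofAssociativeRing

noncomputable section

namespace HomogeneousComplex

variable {n : ℕ}

/-! ### Matrix groups and their Lie algebras -/

/-- The map `c : ℝ → G` into the matrix group `G` has derivative `X` at `0`, as a matrix-valued
map (entry by entry). -/
def HasVelocity {G : Subgroup (GL (Fin n) ℝ)} (c : ℝ → G) (X : Matrix (Fin n) (Fin n) ℝ) : Prop :=
  ∀ i j, HasDerivAt (fun t => ((c t : GL (Fin n) ℝ) : Matrix (Fin n) (Fin n) ℝ) i j) (X i j) 0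

theorem HasVelocity.mul {G : Subgroup (GL (Fin n) ℝ)} {c e : ℝ → G}
    {X Y : Matrix (Fin n) (Fin n) ℝ} (hc : HasVelocity c X) (he : HasVelocity e Y)
    (c0 : c 0 = 1) (e0 : e 0 = 1) : HasVelocity (fun t => c t * e t) (X + Y) := by
  intro i j
  have h := HasDerivAt.fun_sum (u := Finset.univ) (fun k _ => (hc i k).mul (he k j))
  refine (h.congr_deriv ?_).congr_of_eventuallyEq (Filter.Eventually.of_forall fun t => ?_)
  · simp [c0, e0, Finset.sum_add_distrib, Matrix.one_apply]
  · simp [Matrix.mul_apply]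

theorem HasVelocity.conj {G : Subgroup (GL (Fin n) ℝ)} {e : ℝ → G}
    {Y : Matrix (Fin n) (Fin n) ℝ} (he : HasVelocity e Y) (g : G) :
    HasVelocity (fun t => g * e t * g⁻¹)
      (((g : GL (Fin n) ℝ) : Matrix (Fin n) (Fin n) ℝ) * Y *
        (((g⁻¹ : G) : GL (Fin n) ℝ) : Matrix (Fin n) (Fin n) ℝ)) := by
  intro i j
  have h := HasDerivAt.fun_sum (u := Finset.univ) (fun l _ => (HasDerivAt.fun_sum
    (u := Finset.univ) (fun k _ => (he k l).const_mul
      (((g : GL (Fin n) ℝ) : Matrix (Fin n) (Fin n) ℝ) i k))).mul_const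
      ((((g⁻¹ : G) : GL (Fin n) ℝ) : Matrix (Fin n) (Fin n) ℝ) l j))
  refine (h.congr_deriv ?_).congr_of_eventuallyEq (Filter.Eventually.of_forall fun t => ?_)
  · simp only [Matrix.mul_apply]
  · simp only [Subgroup.coe_mul, Units.val_mul, Matrix.mul_apply]

/-- The tangent space at the identity of a matrix group: the velocities of curves through `1`. -/
def tangentAtOne (G : Subgroup (GL (Fin n) ℝ)) : Submodule ℝ (Matrix (Fin n) (Fin n) ℝ) where
  carrier := {X | ∃ c : ℝ → G, c 0 = 1 ∧ HasVelocity c X}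
  zero_mem' := ⟨fun _ => 1, rfl, fun i j => by simpa using hasDerivAt_const (0 : ℝ) _⟩
  add_mem' := by
    rintro X Y ⟨c, c0, hc⟩ ⟨e, e0, he⟩
    exact ⟨fun t => c t * e t, by simp [c0, e0], hc.mul he c0 e0⟩
  smul_mem' := by
    rintro a X ⟨c, c0, hc⟩
    refine ⟨fun t => c (a * t), by simp [c0], fun i j => ?_⟩
    have h1 : HasDerivAt (fun t : ℝ => a * t) a 0 := by
      simpa using (hasDerivAt_id (0 : ℝ)).const_mul a
    have h2 := (hc i j)
    rw [← mul_zero a] at h2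
    simpa [Function.comp_def, mul_comm] using h2.comp (0 : ℝ) h1

theorem bracket_mem_tangentAtOne {G : Subgroup (GL (Fin n) ℝ)}
    {X Y : Matrix (Fin n) (Fin n) ℝ} (hX : X ∈ tangentAtOne G) (hY : Y ∈ tangentAtOne G) :
    X * Y - Y * X ∈ tangentAtOne G := by
  obtain ⟨c, c0, hc⟩ := hX
  obtain ⟨e, e0, he⟩ := hY
  let M : ℝ → Matrix (Fin n) (Fin n) ℝ := fun t => ((c t : GL (Fin n) ℝ) : Matrix _ _ ℝ)
  let N : ℝ → Matrix (Fin n) (Fin n) ℝ := fun t => (((c t)⁻¹ : G) : GL (Fin n) ℝ)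
  have hM0 : M 0 = 1 := by simp [M, c0]
  have hMN : ∀ t, M t * N t = 1 := fun t => by simp [M, N]
  have hmem : ∀ t, t⁻¹ • (M t * Y * N t - Y) ∈ tangentAtOne G := by
    intro t
    refine Submodule.smul_mem _ _ (Submodule.sub_mem _ ?_ ⟨e, e0, he⟩)
    exact ⟨fun s => c t * e s * (c t)⁻¹, by simp [e0], he.conj (c t)⟩
  have hMc : ContinuousAt M 0 :=
    continuousAt_pi.2 fun i => continuousAt_pi.2 fun j => (hc i j).continuousAt
  have hN : Filter.Tendsto N (𝓝[≠] 0) (𝓝 1) := by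
    have h1 : N = fun t => (M t).det⁻¹ • (M t).adjugate := by
      funext t
      have : N t = (M t)⁻¹ := by
        simp only [M, N, Subgroup.coe_inv, Matrix.coe_units_inv]
      rw [this, Matrix.inv_def, Ring.inverse_eq_inv']
    have h2 : ContinuousAt N 0 := by
      rw [h1]
      refine ContinuousAt.smul (ContinuousAt.inv₀ (f := fun t => (M t).det) ?_
        (by simp [hM0])) ?_
      · exact (Continuous.matrix_det continuous_id).continuousAt.comp hMc
      · exact (Continuous.matrix_adjugate continuous_id).continuousAt.comp hMc
    have h3 : N 0 = 1 := by simp [N, c0]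
    exact h3 ▸ h2.tendsto.mono_left nhdsWithin_le_nhds
  have hS : Filter.Tendsto (fun t => t⁻¹ • (M t - 1)) (𝓝[≠] 0) (𝓝 X) := by
    refine tendsto_pi_nhds.2 fun i => tendsto_pi_nhds.2 fun j => ?_
    have := (hc i j).tendsto_slope_zero
    simpa [M, c0] using this
  have hlim : Filter.Tendsto (fun t => t⁻¹ • (M t * Y * N t - Y)) (𝓝[≠] 0)
      (𝓝 ((X * Y - Y * X) * 1)) := by
    refine (((hS.mul_const Y).sub (hS.const_mul Y)).mul hN).congr fun t => ?_
    have : M t * Y * N t - Y = ((M t - 1) * Y - Y * (M t - 1)) * N t := by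
      have h : Y * M t * N t = Y := by rw [mul_assoc, hMN, mul_one]
      simp only [sub_mul, mul_sub, one_mul, mul_one, h]
      abel
    simp only [this, ← smul_sub, smul_mul_assoc, mul_smul_comm]
  have hcl : IsClosed (tangentAtOne G : Set (Matrix (Fin n) (Fin n) ℝ)) :=
    Submodule.closed_of_finiteDimensional _
  have := hcl.mem_of_tendsto hlim (Filter.Eventually.of_forall hmem)
  simpa using this

/-- The Lie algebra `𝔤` of a matrix group `G`, with the commutator of matrices as bracket. -/
def lieAlg (G : Subgroup (GL (Fin n) ℝ)) : LieSubalgebra ℝ (Matrix (Fin n) (Fin n) ℝ) :=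
  { tangentAtOne G with
    lie_mem' := fun {X Y} hX hY => by
      rw [Ring.lie_def]
      exact bracket_mem_tangentAtOne hX hY }

variable {G : Subgroup (GL (Fin n) ℝ)}

/-! ### Grading elements and the centralizer -/

/-- The operator `ad Q` on `𝔤 ⊗ ℂ`, for `Q = i q` with `q ∈ 𝔤`. -/
def adQ (q : lieAlg G) : Module.End ℂ (ℂ ⊗[ℝ] lieAlg G) :=
  LieAlgebra.ad ℂ (ℂ ⊗[ℝ] lieAlg G) (Complex.I ⊗ₜ[ℝ] q)

/-- The eigenspace `{X ∈ 𝔤 ⊗ ℂ | [Q, X] = r X}`, where `Q = i q`. -/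
def gradedPiece (q : lieAlg G) (r : ℝ) : Submodule ℂ (ℂ ⊗[ℝ] lieAlg G) :=
  (adQ q).eigenspace (r : ℂ)

/-- `Q = i q` is a grading element: `ad Q` is diagonalizable with real eigenvalues
on `𝔤 ⊗ ℂ`, so that `𝔤 ⊗ ℂ` is graded by the real eigenvalues of `ad Q`. -/
def IsGradingElement (q : lieAlg G) : Prop :=
  ⨆ r : ℝ, gradedPiece q r = ⊤

/-- The centralizer `H ⊂ G` of `q`, equivalently of `Q = i q`. -/
def centralizer (q : lieAlg G) : Subgroup G where
  carrier := {g | ((g : GL (Fin n) ℝ) : Matrix (Fin n) (Fin n) ℝ) * (q : Matrix (Fin n) (Fin n) ℝ)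
    = (q : Matrix (Fin n) (Fin n) ℝ) * ((g : GL (Fin n) ℝ) : Matrix (Fin n) (Fin n) ℝ)}
  one_mem' := by simp
  mul_mem' := by
    intro a b ha hb
    simp only [Set.mem_ofPred_eq, Subgroup.coe_mul, Units.val_mul] at *
    rw [mul_assoc, hb, ← mul_assoc, ha, mul_assoc]
  inv_mem' := by
    intro a ha
    have h : Commute ((a : GL (Fin n) ℝ) : Matrix (Fin n) (Fin n) ℝ)
      (q : Matrix (Fin n) (Fin n) ℝ) := ha
    exact h.units_inv_left

/-! ### Complexified tangent spaces -/

/-- Multiplication by `i` on a complex vector space, as a real linear map. -/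
def complexStructure (T : Type*) [AddCommGroup T] [Module ℂ T] [Module ℝ T]
    [IsScalarTower ℝ ℂ T] : T →ₗ[ℝ] T :=
  (LinearMap.lsmul ℂ T Complex.I).restrictScalars ℝ

/-- The `(1,0)` vectors in `T ⊗ ℂ`: the `i`-eigenspace of the complexified complex structure. -/
def vectors10 (T : Type*) [AddCommGroup T] [Module ℂ T] [Module ℝ T]
    [IsScalarTower ℝ ℂ T] : Submodule ℂ (ℂ ⊗[ℝ] T) :=
  Module.End.eigenspace ((complexStructure T).baseChange ℂ) Complex.I

/-- The `(0,1)` vectors in `T ⊗ ℂ`: the `-i`-eigenspace. -/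
def vectors01 (T : Type*) [AddCommGroup T] [Module ℂ T] [Module ℝ T]
    [IsScalarTower ℝ ℂ T] : Submodule ℂ (ℂ ⊗[ℝ] T) :=
  Module.End.eigenspace ((complexStructure T).baseChange ℂ) (-Complex.I)

/-- The model space `ℂ^d`. -/
abbrev Model (d : ℕ) : Type := EuclideanSpace ℂ (Fin d)

/-! ### The homogeneous space `G/H` -/

/-- A map from an open set `s ⊂ ℝ^k` to the matrix group `G` is smooth
if its matrix entries are. -/
def SmoothOn {k : ℕ} (f : EuclideanSpace ℝ (Fin k) → G) (s : Set (EuclideanSpace ℝ (Fin k))) :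
    Prop :=
  ∀ i j, ContDiffOn ℝ ∞ (fun x => ((f x : GL (Fin n) ℝ) : Matrix (Fin n) (Fin n) ℝ) i j) s

section Base

variable (H : Subgroup G) {d : ℕ} [ChartedSpace (Model d) (G ⧸ H)]

/-- The projection `G → G/H` is smooth: it maps smooth families of group elements
to smooth families of points. -/
def SmoothProjection : Prop :=
  ∀ (k : ℕ) (s : Set (EuclideanSpace ℝ (Fin k))) (f : EuclideanSpace ℝ (Fin k) → G),
    IsOpen s → SmoothOn f s →
      ContMDiffOn 𝓘(ℝ, EuclideanSpace ℝ (Fin k)) 𝓘(ℝ, Model d) ∞ (fun x => (f x : G ⧸ H)) s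

variable {H} in
/-- `D : 𝔤 → T_{gH}(G/H)` is the differential of `G → G/H` at `g`, where `T_g G` is identified
with `𝔤` by left translation: `D X` is the velocity at `0` of `t ↦ g c(t) H` for all curves `c`
in `G` with `c(0) = 1` and `c'(0) = X`. -/
def IsDifferentialOfProjection (g : G)
    (D : lieAlg G →ₗ[ℝ] TangentSpace 𝓘(ℂ, Model d) (g : G ⧸ H)) : Prop :=
  ∀ (c : ℝ → G) (X : lieAlg G), c 0 = 1 → HasVelocity c (X : Matrix (Fin n) (Fin n) ℝ) →
    HasMFDerivAt 𝓘(ℝ, ℝ) 𝓘(ℝ, Model d) (fun t : ℝ => ((g * c t : G) : G ⧸ H)) 0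
      (ContinuousLinearMap.toSpanSingleton ℝ (D X : Model d))

/-- `G/H` (with the quotient topology and the given charts) is a homogeneous complex manifold:
a complex manifold whose underlying smooth manifold is the quotient of `G` by `H`
and on which every element of `G` acts by a holomorphic map. -/
structure IsHomogeneousComplexManifold : Prop where
  t2 : T2Space (G ⧸ H)
  secondCountable : SecondCountableTopology (G ⧸ H)
  isManifold : IsManifold 𝓘(ℂ, Model d) ω (G ⧸ H)
  smooth_projection : SmoothProjection H (d := d)
  submersion : ∀ g : G, ∃ D : lieAlg G →ₗ[ℝ] TangentSpace 𝓘(ℂ, Model d) (g : G ⧸ H),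
    IsDifferentialOfProjection g D ∧ Function.Surjective D
  holomorphic_smul : ∀ g : G,
    ContMDiff 𝓘(ℂ, Model d) 𝓘(ℂ, Model d) ω (fun x : G ⧸ H => g • x)

end Base

/-- At every point `gH`, the differential of `G → G/H` has kernel `𝔥 = {X ∈ 𝔤 | [q, X] = 0}`, and
its complexification `𝔤 ⊗ ℂ → T_{gH}(G/H) ⊗ ℂ` maps the sum of the eigenspaces of `ad Q` with
negative eigenvalue onto the `(1,0)` vectors and the sum of those with positive
eigenvalue onto the `(0,1)` vectors. -/
def TangentDecomposition (q : lieAlg G) {d : ℕ}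
    [ChartedSpace (Model d) (G ⧸ centralizer q)] : Prop :=
  ∀ (g : G) (D : lieAlg G →ₗ[ℝ] TangentSpace 𝓘(ℂ, Model d) (g : G ⧸ centralizer q)),
    IsDifferentialOfProjection g D →
      LinearMap.ker D = LinearMap.ker (LieAlgebra.ad ℝ (lieAlg G) q : Module.End ℝ (lieAlg G)) ∧
      (⨆ r : {r : ℝ // 0 < r}, gradedPiece q (-r)).map (D.baseChange ℂ) =
        vectors10 (TangentSpace 𝓘(ℂ, Model d) (g : G ⧸ centralizer q)) ∧
      (⨆ r : {r : ℝ // 0 < r}, gradedPiece q r).map (D.baseChange ℂ) =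
        vectors01 (TangentSpace 𝓘(ℂ, Model d) (g : G ⧸ centralizer q))

/-! ### The homogeneous bundle `O(W) = (G × W) / ((g, w) ∼ (g h, h⁻¹ w))` -/

section HomBundle

variable {H : Subgroup G} {W : Type u} [NormedAddCommGroup W] [NormedSpace ℂ W]

/-- The fibre of `O(W)` over the coset `x`. The equivalence class `{(g h, h⁻¹ w) | h ∈ H}` of
`(g, w)` is the graph of a function on the coset `gH`; the classes over `x` are thus the functions
`s : x → W` with `s (g h) = h⁻¹ s(g)`, which form a complex vector space. -/
def Fiber (ρ : Representation ℂ H W) (x : G ⧸ H) :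
    Submodule ℂ ({g : G // (g : G ⧸ H) = x} → W) where
  carrier := {s | ∀ (a b : {g : G // (g : G ⧸ H) = x}) (h : H),
    (b : G) = a * h → s b = ρ h⁻¹ (s a)}
  zero_mem' := by intro a b h _; simp
  add_mem' := by
    intro s t hs ht a b h hab
    simp [hs a b h hab, ht a b h hab]
  smul_mem' := by
    intro c s hs a b h hab
    simp [hs a b h hab]

/-- The total space of `O(W)`. -/
abbrev HomBundle (ρ : Representation ℂ H W) : Type u :=
  TotalSpace W (fun x : G ⧸ H => Fiber ρ x)

/-- The class `[g, w]` of `(g, w) ∈ G × W` in `O(W)`: the function `g h ↦ h⁻¹ w` on `gH`. -/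
def HomBundle.mk (ρ : Representation ℂ H W) (p : G × W) : HomBundle ρ :=
  ⟨(p.1 : G ⧸ H), ⟨fun a => ρ ⟨(a : G)⁻¹ * p.1, QuotientGroup.eq.1 a.2⟩ p.2, by
    intro a b h hab
    rw [← Module.End.mul_apply, ← map_mul]
    refine congrArg (fun k => ρ k p.2) (Subtype.ext ?_)
    simp [hab, mul_assoc]⟩⟩

/-- The total space carries the quotient topology of `G × W`. -/
instance HomBundle.instTopologicalSpace (ρ : Representation ℂ H W) :
    TopologicalSpace (HomBundle ρ) :=
  TopologicalSpace.coinduced (HomBundle.mk ρ) inferInstance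

/-- Left translation by `g` on `O(W)`, `g • [g', w] = [g g', w]`. -/
def HomBundle.translate (ρ : Representation ℂ H W) (g : G) (p : HomBundle ρ) : HomBundle ρ :=
  ⟨g • p.proj, ⟨fun a => (p.snd : {g : G // (g : G ⧸ H) = p.proj} → W)
      ⟨g⁻¹ * a, by
        have := a.2
        rw [← smul_eq_mul, ← MulAction.Quotient.smul_mk, inv_smul_eq_iff]
        exact this⟩, by
    intro a b h hab
    exact p.snd.2 _ _ h (by simp [hab, mul_assoc])⟩⟩

theorem HomBundle.mk_surjective (ρ : Representation ℂ H W) :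
    Function.Surjective (HomBundle.mk ρ) := by
  rintro ⟨x, s, hs⟩
  obtain ⟨g, rfl⟩ := QuotientGroup.mk_surjective x
  refine ⟨(g, s ⟨g, rfl⟩), ?_⟩
  unfold HomBundle.mk
  congr 1
  apply Subtype.ext
  funext a
  have := hs ⟨g, rfl⟩ a ⟨g⁻¹ * a, QuotientGroup.eq.1 a.2.symm⟩ (by simp)
  refine Eq.trans (congrArg (fun k => ρ k (s ⟨g, rfl⟩)) (Subtype.ext ?_)) this.symm
  simp

theorem HomBundle.mk_eq_mk_iff (ρ : Representation ℂ H W) (p p' : G × W) :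
    HomBundle.mk ρ p = HomBundle.mk ρ p' ↔ ∃ h : H, p' = (p.1 * h, ρ h⁻¹ p.2) := by
  have ev : ∀ b b' : HomBundle ρ, b = b' → ∀ a ha ha',
      b.snd.1 ⟨a, ha⟩ = b'.snd.1 ⟨a, ha'⟩ := by
    rintro b _ rfl a ha ha'
    rfl
  constructor
  · intro h
    have hb : (p.1 : G ⧸ H) = p'.1 := congrArg TotalSpace.proj h
    refine ⟨⟨p.1⁻¹ * p'.1, QuotientGroup.eq.1 hb⟩, Prod.ext (by simp) ?_⟩
    have h1 : ρ ⟨p'.1⁻¹ * p.1, _⟩ p.2 = ρ ⟨p'.1⁻¹ * p'.1, _⟩ p'.2 := ev _ _ h p'.1 hb.symm rfl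
    have h2 : (⟨p'.1⁻¹ * p'.1, QuotientGroup.eq.1 rfl⟩ : H) = 1 := Subtype.ext (by simp)
    rw [h2, map_one] at h1
    refine h1.symm.trans (congrArg (fun k => ρ k p.2) (Subtype.ext ?_))
    simp
  · rintro ⟨h, rfl⟩
    obtain ⟨g, w⟩ := p
    have key : ∀ (x : G ⧸ H) (hx : (g : G ⧸ H) = x) (s : Fiber ρ x), s.1 ⟨g, hx⟩ = w →
        HomBundle.mk ρ (g, w) = ⟨x, s⟩ := by
      rintro _ rfl s hs
      unfold HomBundle.mk
      congr 1
      apply Subtype.ext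
      funext a
      have := s.2 ⟨g, rfl⟩ a ⟨g⁻¹ * a, QuotientGroup.eq.1 a.2.symm⟩ (by simp)
      rw [hs] at this
      exact Eq.trans (congrArg (fun k => ρ k w) (Subtype.ext (by simp))) this.symm
    refine key _ (QuotientGroup.eq.2 (by simp)) _ ?_
    change ρ _ (ρ h⁻¹ w) = w
    rw [← Module.End.mul_apply, ← map_mul]
    refine Eq.trans (congrArg (fun k => ρ k w) (?_ : _ = (1 : H))) (by simp)
    ext1
    simp

theorem HomBundle.translate_mk (ρ : Representation ℂ H W) (g : G) (p : G × W) :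
    HomBundle.translate ρ g (HomBundle.mk ρ p) = HomBundle.mk ρ (g * p.1, p.2) := by
  unfold HomBundle.translate HomBundle.mk
  refine congrArg (TotalSpace.mk ((g * p.1 : G) : G ⧸ H)) (Subtype.ext (funext fun a => ?_))
  exact congrArg (fun k => ρ k p.2) (Subtype.ext (by simp [mul_assoc]))

variable (W) in
/-- `O(W) → G/H` is a homogeneous holomorphic vector bundle: for a suitable atlas of local
trivializations (homeomorphisms onto `U × W` that are complex linear on the fibres)
the coordinate changes are holomorphic, the map `G × W → O(W)` is smooth, and every element of `G`
acts on the complex manifold `O(W)` by a holomorphic map. -/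
def IsHolomorphicHomBundle (ρ : Representation ℂ H W) {d : ℕ}
    [ChartedSpace (Model d) (G ⧸ H)] : Prop :=
  ∃ (_ : FiberBundle W (fun x : G ⧸ H => Fiber ρ x))
    (_ : VectorBundle ℂ W (fun x : G ⧸ H => Fiber ρ x)),
    ContMDiffVectorBundle ω W (fun x : G ⧸ H => Fiber ρ x) 𝓘(ℂ, Model d) ∧
    (∀ (k : ℕ) (s : Set (EuclideanSpace ℝ (Fin k))) (f : EuclideanSpace ℝ (Fin k) → G)
      (v : EuclideanSpace ℝ (Fin k) → W), IsOpen s → SmoothOn f s → ContDiffOn ℝ ∞ v s →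
        ContMDiffOn 𝓘(ℝ, EuclideanSpace ℝ (Fin k)) (𝓘(ℝ, Model d).prod 𝓘(ℝ, W)) ∞
          (fun x => HomBundle.mk ρ (f x, v x)) s) ∧
    ∀ g : G, ContMDiff (𝓘(ℂ, Model d).prod 𝓘(ℂ, W)) (𝓘(ℂ, Model d).prod 𝓘(ℂ, W)) ω
      (HomBundle.translate ρ g)

end HomBundle

end HomogeneousComplex

end

set_option autoImplicit false
set_option linter.unusedSectionVars false
set_option linter.style.haveILetI false

open scoped Manifold ContDiff TensorProduct Topology MatrixGroups
open Bundle

noncomputable section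

namespace HomogeneousComplex

open NormedSpace Set Filter

/-! ### The exponential map of a Banach algebra -/

section Exp

/-! Heuristically, `G/H` is an open orbit of `G` in a complex quotient `G_ℂ/P`, where the Lie
algebra `p` of `P` is the sum of the eigenspaces of `ad Q` with eigenvalue `≥ 0`, and `O(W)` is
restricted from a bundle induced by a representation of `P`. Instead of constructing `G_ℂ` and `P`,
the argument stays local, inside the complex matrices.

Since `Q = iq` with `q` real, conjugation of `𝔤 ⊗ ℂ` exchanges the eigenvalues `r` and `-r`. Hence
`𝔤 ∩ p = 𝔥`, and `𝔤 → (𝔤 ⊗ ℂ)/p` is onto: a negative vector `x` is congruent to the real vector `x +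
conj x` modulo `p`.

Near `1` a complex matrix is uniquely `exp (a z) exp y (1 + w)`, with `a z` in the negative part, `y
∈ p` and `w` in a complement of `𝔤 ⊗ ℂ`. Paths tangent to `𝔤 ⊗ ℂ` stay on the leaf `w = 0`
(`Splitting.mem_leaf_of_isPathIn`), and paths on it tangent to `p` do not change `z`
(`Splitting.dec_symm_fst_eq_of_isPathIn`). Both facts rest on the left logarithmic derivative of
`exp` preserving Lie subalgebras (`exp_neg_mul_fderiv_exp_mem`). By the closed subgroup theorem
(`ExpClosed.exists_local_product`) an element of `G` near `1` is `exp c exp Y` with `c ∈ m`, `Y ∈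
𝔥`, where `𝔤 = m ⊕ 𝔥`. Its coordinate `z` depends only on `c`, with bijective derivative at `0`, so
`z` is a chart of `G/H` at the base point (`CosetData.exists_localChart`). Its translates form the
atlas.

The section `sec z` over this chart is only real analytic. But a function of matrices which is
constant along paths tangent to `p` has the same value at `sec z` as at `exp (a z) exp y₀`, which is
holomorphic in `z` (`LocalChart.eventually_eq_hol`). The coordinate changes come from the
holomorphic functions `u ↦ z(g u k⁻¹)` with `k ∈ H` fixed, which are constant along such paths
because `Ad k` preserves `p`. So they are holomorphic.

For the bundle, the differential of `ρ` is extended complex linearly to `𝔥 ⊗ ℂ` and by zero to the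
positive part, an ideal of `p`; this gives a Lie algebra homomorphism `lam` on `p`
(`exists_repData`). The function `θ = exp (lam y)` integrates it on the leaf and extends to an
`H`-equivariant `θ̂` over the chart. The trivializations are `[x, w] ↦ (xH, θ̂(g⁻¹x) w)`. Their
coordinate changes, and the left translations, are given by `θ̂(g sec z) θ̂(sec z)⁻¹`, to which the
same principle applies (`RepData.contDiffAt_coordChange`). -/

theorem contDiff_exp (𝕜 : Type*) [RCLike 𝕜] {𝔸 : Type*} [NormedRing 𝔸] [NormedAlgebra 𝕜 𝔸]
    [CompleteSpace 𝔸] {n : WithTop ℕ∞} : ContDiff 𝕜 n (exp : 𝔸 → 𝔸) := by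
  have : AnalyticOnNhd 𝕜 (exp : 𝔸 → 𝔸) univ := fun x _ => exp_analytic (𝕂 := 𝕜) x
  exact this.contDiff

/-- The projection to a complement detects `s` as the zero set of a continuous linear map, so that
staying in `s` becomes the vanishing of a solution of a differential inequality. -/
theorem exists_continuousLinearMap_ker_eq {𝕜 E : Type*} [RCLike 𝕜] [NormedAddCommGroup E]
    [NormedSpace 𝕜 E] [FiniteDimensional 𝕜 E] (s : Submodule 𝕜 E) :
    ∃ pr : E →L[𝕜] E, (∀ x ∈ s, pr x = 0) ∧ ∀ x, x - pr x ∈ s := by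
  obtain ⟨t, ht⟩ := s.exists_isCompl
  refine ⟨LinearMap.toContinuousLinearMap (t.subtype ∘ₗ t.projectionOnto s ht.symm),
    fun x hx => ?_, fun x => ?_⟩
  · simpa using hx
  · have h := Submodule.projection_add_projection_eq_self ht x
    have h2 : x - ((t.projectionOnto s ht.symm x : t) : E) = (s.projectionOnto t ht x : s) := by
      rw [sub_eq_iff_eq_add]; exact h.symm
    change x - ((t.projectionOnto s ht.symm x : t) : E) ∈ s
    rw [h2]
    exact (s.projectionOnto t ht x).2

variable {𝔸 : Type*} [NormedRing 𝔸] [NormedAlgebra ℝ 𝔸] [CompleteSpace 𝔸]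

theorem exp_add_of_commute' {x y : 𝔸} (h : Commute x y) : exp (x + y) = exp x * exp y :=
  letI : NormedAlgebra ℚ 𝔸 := .restrictScalars ℚ ℝ 𝔸
  exp_add_of_commute h

@[simp] theorem exp_mul_exp_neg (x : 𝔸) : exp x * exp (-x) = 1 := by
  rw [← exp_add_of_commute' (Commute.refl x).neg_right]; simp

@[simp] theorem exp_neg_mul_exp (x : 𝔸) : exp (-x) * exp x = 1 := by
  rw [← exp_add_of_commute' (Commute.refl x).neg_left]; simp

theorem map_exp' {𝔹 : Type*} [NormedRing 𝔹] [NormedAlgebra ℝ 𝔹] {F : Type*}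
    [FunLike F 𝔸 𝔹] [RingHomClass F 𝔸 𝔹] (f : F) (hf : Continuous f) (x : 𝔸) :
    f (exp x) = exp (f x) :=
  letI : NormedAlgebra ℚ 𝔸 := .restrictScalars ℚ ℝ 𝔸
  letI : NormedAlgebra ℚ 𝔹 := .restrictScalars ℚ ℝ 𝔹
  map_exp f hf x

theorem exp_conj_of_mul_eq_one {u v : 𝔸} (huv : u * v = 1) (hvu : v * u = 1) (x : 𝔸) :
    exp (u * x * v) = u * exp x * v :=
  letI : NormedAlgebra ℚ 𝔸 := .restrictScalars ℚ ℝ 𝔸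
  exp_units_conj (Units.mk u v huv hvu) x

theorem exp_smul_add (a b : ℝ) (x : 𝔸) : exp ((a + b) • x) = exp (a • x) * exp (b • x) := by
  rw [add_smul]
  exact exp_add_of_commute' (((Commute.refl x).smul_left a).smul_right b)

theorem hasDerivAt_exp_smul (x : 𝔸) (t : ℝ) :
    HasDerivAt (fun u : ℝ => exp (u • x)) (exp (t • x) * x) t :=
  hasDerivAt_exp_smul_const x t

theorem hasDerivAt_exp_smul' (x : 𝔸) (t : ℝ) :
    HasDerivAt (fun u : ℝ => exp (u • x)) (x * exp (t • x)) t :=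
  hasDerivAt_exp_smul_const' x t

theorem continuous_exp' : Continuous (exp : 𝔸 → 𝔸) :=
  (contDiff_exp ℝ (n := 0)).continuous

/-- If `[Y, s] ⊂ s`, then conjugation by `exp Y` preserves `s`. -/
theorem exp_conj_mem [FiniteDimensional ℝ 𝔸] {s : Submodule ℝ 𝔸} {Y : 𝔸}
    (hY : ∀ X ∈ s, Y * X - X * Y ∈ s) {X : 𝔸} (hX : X ∈ s) : exp Y * X * exp (-Y) ∈ s := by
  obtain ⟨pr, h0, h1⟩ := exists_continuousLinearMap_ker_eq s
  let u : ℝ → 𝔸 := fun t => exp (t • Y) * X * exp (t • -Y)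
  have hu : ∀ t, HasDerivAt u (Y * u t - u t * Y) t := fun t => by
    refine (((hasDerivAt_exp_smul' Y t).mul_const X).mul
      (hasDerivAt_exp_smul_const (𝕂 := ℝ) (-Y) t)).congr_deriv ?_
    simp only [u, mul_assoc]
    noncomm_ring
  have hw : ∀ t, HasDerivAt (fun t => pr (u t)) (pr (Y * u t - u t * Y)) t := fun t =>
    pr.hasFDerivAt.comp_hasDerivAt t (hu t)
  -- As `ad Y` preserves `s = ker pr`, the derivative of `pr (u t)` depends only on `pr (u t)`.
  -- Grönwall with initial value zero then gives `pr (u t) = 0`.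
  have hpr : ∀ t, pr (Y * u t - u t * Y) = pr (Y * pr (u t) - pr (u t) * Y) := fun t => by
    have := h0 _ (hY _ (h1 (u t)))
    rw [← sub_eq_zero, ← map_sub, ← this]
    congr 1
    noncomm_ring
  have h3 : ∀ v ∈ s, pr v = 0 := h0
  have key := eq_zero_of_abs_deriv_le_mul_abs_self_of_eq_zero_right (f := fun t => pr (u t))
    (K := ‖pr‖ * (‖Y‖ + ‖Y‖)) (a := 0) (b := 1)
    (fun t _ => (hw t).continuousAt.continuousWithinAt)
    (fun t _ => (hw t).hasDerivWithinAt) (by simpa [u] using h0 X hX)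
    (fun t _ => by
      rw [hpr]
      refine (pr.le_opNorm _).trans ?_
      rw [mul_assoc]
      gcongr
      refine (norm_sub_le _ _).trans ?_
      rw [add_mul]
      gcongr
      · exact norm_mul_le _ _
      · rw [mul_comm ‖Y‖]; exact norm_mul_le _ _) 1 (by simp)
  have := h1 (u 1)
  rw [key, sub_zero] at this
  simpa [u] using this

/-- The logarithmic derivative of `exp` takes values in `s`, for a Lie subalgebra `s`. -/
theorem exp_neg_mul_fderiv_exp_mem [FiniteDimensional ℝ 𝔸] {s : Submodule ℝ 𝔸}
    (hs : ∀ X ∈ s, ∀ Y ∈ s, X * Y - Y * X ∈ s) {Y ξ : 𝔸} (hY : Y ∈ s) (hξ : ξ ∈ s) :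
    exp (-Y) * fderiv ℝ exp Y ξ ∈ s := by
  obtain ⟨pr, h0, h1⟩ := exists_continuousLinearMap_ker_eq s
  -- Duhamel's formula: `exp (-Y) d exp_Y ξ = ∫₀¹ exp (-tY) ξ exp (tY) dt`, whose integrand lies in
  -- `s` by `exp_conj_mem`. The parameter `ε` gives the difference quotient exactly as an integral.
  let F : ℝ → ℝ → 𝔸 := fun ε t => exp (t • -Y) * ξ * exp (t • (Y + ε • ξ))
  have hFc : Continuous (Function.uncurry F) := by
    have h : Continuous (fun p : ℝ × ℝ => exp (p.2 • (Y + p.1 • ξ))) :=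
      continuous_exp'.comp (by fun_prop)
    have h' : Continuous (fun p : ℝ × ℝ => exp (p.2 • -Y)) :=
      continuous_exp'.comp (by fun_prop)
    exact (h'.mul continuous_const).mul h
  let Jf : ℝ → 𝔸 := fun ε => ∫ t in (0 : ℝ)..1, F ε t
  have hJ : Continuous Jf :=
    intervalIntegral.continuous_parametric_intervalIntegral_of_continuous' hFc 0 1
  have hFε : ∀ ε, Continuous (F ε) := fun ε => hFc.comp (by fun_prop : Continuous fun t => (ε, t))
  have hE : ∀ ε : ℝ, exp (-Y) * exp (Y + ε • ξ) - 1 = ε • Jf ε := by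
    intro ε
    have hd : ∀ t ∈ uIcc (0 : ℝ) 1, HasDerivAt
        (fun t : ℝ => exp (t • -Y) * exp (t • (Y + ε • ξ))) (ε • F ε t) t := by
      intro t _
      refine ((hasDerivAt_exp_smul_const (𝕂 := ℝ) (-Y) t).mul
        (hasDerivAt_exp_smul' (Y + ε • ξ) t)).congr_deriv ?_
      simp only [F, add_mul, mul_add, smul_mul_assoc, mul_smul_comm, mul_assoc, neg_mul, mul_neg]
      abel
    have := intervalIntegral.integral_eq_sub_of_hasDerivAt hd
      (((hFε ε).const_smul ε).intervalIntegrable _ _)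
    rw [intervalIntegral.integral_smul] at this
    simp only [one_smul, zero_smul, exp_zero, mul_one] at this
    exact this.symm
  have hd0 : HasDerivAt (fun ε : ℝ => exp (-Y) * exp (Y + ε • ξ)) (Jf 0) 0 := by
    rw [hasDerivAt_iff_tendsto_slope_zero]
    have : Tendsto Jf (𝓝[≠] 0) (𝓝 (Jf 0)) := hJ.continuousAt.tendsto.mono_left nhdsWithin_le_nhds
    refine this.congr' ?_
    filter_upwards [self_mem_nhdsWithin] with ε hε
    have h := hE ε
    simp only [zero_add, zero_smul, add_zero, exp_neg_mul_exp]
    rw [h, smul_smul, inv_mul_cancel₀ hε, one_smul]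
  have hd1 : HasDerivAt (fun ε : ℝ => exp (-Y) * exp (Y + ε • ξ))
      (exp (-Y) * fderiv ℝ exp Y ξ) 0 := by
    have hl : HasDerivAt (fun ε : ℝ => Y + ε • ξ) ξ 0 := by
      simpa using ((hasDerivAt_id (0 : ℝ)).smul_const ξ).const_add Y
    have he : HasFDerivAt (exp : 𝔸 → 𝔸) (fderiv ℝ exp Y) (Y + (0 : ℝ) • ξ) := by
      simpa using ((contDiff_exp ℝ (n := 1)).differentiable one_ne_zero Y).hasFDerivAt
    exact (he.comp_hasDerivAt (0 : ℝ) hl).const_mul _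
  rw [hd1.unique hd0]
  have hpr : pr (Jf 0) = 0 := by
    rw [← ContinuousLinearMap.intervalIntegral_comp_comm pr ((hFε 0).intervalIntegrable _ _)]
    have : ∀ t : ℝ, pr (F 0 t) = 0 := fun t => by
      refine h0 _ ?_
      have := exp_conj_mem (s := s) (Y := t • -Y) (fun X hX => ?_) hξ
      · simpa [F] using this
      · exact hs _ (s.smul_mem _ (s.neg_mem hY)) _ hX
    simp [this]
  have := h1 (Jf 0)
  rwa [hpr, sub_zero] at this

end Exp

/-! ### The inverse function theorem -/

/-- The analytic inverse function theorem, with an inverse that is analytic on its domain. -/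
theorem exists_openPartialHomeomorph {𝕜 E F : Type*} [RCLike 𝕜] [NormedAddCommGroup E]
    [NormedSpace 𝕜 E] [CompleteSpace E] [NormedAddCommGroup F] [NormedSpace 𝕜 F]
    {f : E → F} {x : E} (hf : ContDiffAt 𝕜 ω f x) {f' : E ≃L[𝕜] F}
    (hf' : HasFDerivAt f (f' : E →L[𝕜] F) x) :
    ∃ e : OpenPartialHomeomorph E F, x ∈ e.source ∧ (∀ y, e y = f y) ∧
      (∀ y ∈ e.source, ContDiffAt 𝕜 ω f y) ∧
      (∀ z ∈ e.target, ContDiffAt 𝕜 ω e.symm z) ∧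
      ∀ y ∈ e.source, ∃ L : E ≃L[𝕜] F, HasFDerivAt f (L : E →L[𝕜] F) y ∧
        HasFDerivAt e.symm (L.symm : F →L[𝕜] E) (f y) := by
  let e₀ := hf.toOpenPartialHomeomorph f hf' (by simp)
  have he₀ : ∀ y, e₀ y = f y := fun y => rfl
  have h1 : ∀ᶠ y in 𝓝 x, ContDiffAt 𝕜 ω f y := hf.eventually (by simp)
  have hc : ContinuousAt (fderiv 𝕜 f) x := (hf.fderiv_right (m := 0) (by simp)).continuousAt
  -- Invertible operators form an open set, so shrinking the source makes the derivative invertible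
  -- throughout it.
  have h2 : ∀ᶠ y in 𝓝 x, fderiv 𝕜 f y ∈
      range ((↑) : (E ≃L[𝕜] F) → E →L[𝕜] F) :=
    hc.eventually_mem (ContinuousLinearEquiv.isOpen.mem_nhds ⟨f', hf'.fderiv.symm⟩)
  obtain ⟨U, hU, hUo, hxU⟩ := eventually_nhds_iff.1 (h1.and h2)
  have hx0 : x ∈ e₀.source := hf.mem_toOpenPartialHomeomorph_source hf' (by simp)
  let e := e₀.restrOpen U hUo
  have hsrc : ∀ y ∈ e.source, y ∈ U := fun y hy => by
    simp only [e, OpenPartialHomeomorph.restrOpen_source] at hy; exact hy.2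
  have hd : ∀ y ∈ e.source, ∃ L : E ≃L[𝕜] F, HasFDerivAt f (L : E →L[𝕜] F) y := by
    intro y hy
    obtain ⟨hy1, L, hL⟩ := hU y (hsrc y hy)
    exact ⟨L, hL ▸ (hy1.differentiableAt (by simp)).hasFDerivAt⟩
  have he : ∀ y, e y = f y := fun y => rfl
  refine ⟨e, ?_, he, fun y hy => (hU y (hsrc y hy)).1, ?_, ?_⟩
  · simp only [e, OpenPartialHomeomorph.restrOpen_source]; exact ⟨hx0, hxU⟩
  · intro z hz
    obtain ⟨L, hL⟩ := hd _ (e.map_target hz)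
    exact e.contDiffAt_symm hz hL (hU _ (hsrc _ (e.map_target hz))).1
  · intro y hy
    obtain ⟨L, hL⟩ := hd y hy
    refine ⟨L, hL, ?_⟩
    have := e.hasFDerivAt_symm (f' := L) (a := f y) (e.map_source hy)
    rw [← he y, e.left_inv hy] at this
    exact he y ▸ this hL

end HomogeneousComplex

namespace HomogeneousComplex

open NormedSpace Set Filter

/-! ### Local decomposition of a complex Lie algebra `s = a ⊕ p` -/

/-- A path `c` on `[0, 1]` inside `T` whose left logarithmic derivative `X` is continuous with
values in `q`. -/
structure IsPathIn {𝔹 : Type*} [NormedRing 𝔹] [NormedAlgebra ℂ 𝔹] (q : Submodule ℂ 𝔹)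
    (T : Set 𝔹) (c X : ℝ → 𝔹) : Prop where
  deriv : ∀ t ∈ Icc (0 : ℝ) 1, HasDerivAt c (c t * X t) t
  mem : ∀ t ∈ Icc (0 : ℝ) 1, X t ∈ q
  cont : ContinuousOn X (Icc 0 1)
  maps : ∀ t ∈ Icc (0 : ℝ) 1, c t ∈ T

/-- A Lie subalgebra `s = range a ⊕ p` of an associative algebra, split into a subspace and a
subalgebra `p`. -/
structure Splitting (E 𝔹 : Type*) [NormedAddCommGroup E] [NormedSpace ℂ E]
    [NormedRing 𝔹] [NormedAlgebra ℂ 𝔹] where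
  a : E →L[ℂ] 𝔹
  p : Submodule ℂ 𝔹
  a_inj : Function.Injective a
  disj : Disjoint (LinearMap.range (a : E →ₗ[ℂ] 𝔹)) p
  p_lie : ∀ X ∈ p, ∀ Y ∈ p, X * Y - Y * X ∈ p
  s_lie : ∀ X ∈ LinearMap.range (a : E →ₗ[ℂ] 𝔹) ⊔ p, ∀ Y ∈ LinearMap.range (a : E →ₗ[ℂ] 𝔹) ⊔ p,
    X * Y - Y * X ∈ LinearMap.range (a : E →ₗ[ℂ] 𝔹) ⊔ p

variable {E 𝔹 : Type*} [NormedAddCommGroup E] [NormedSpace ℂ E] [FiniteDimensional ℂ E]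
  [NormedRing 𝔹] [NormedAlgebra ℂ 𝔹] [FiniteDimensional ℂ 𝔹]

/-- Cancelling `u v` on the left turns the product rule for `u v m` into an identity between
logarithmic derivatives. The bracket is that of `u v`, namely `Ad(v⁻¹)(u⁻¹ du) + v⁻¹ dv`. -/
theorem mul_add_eq_of_prod_rule {R : Type*} [Ring R] {u u' v v' du dv m w X : R}
    (hu : u' * u = 1) (hv : v' * v = 1)
    (h : du * v * m + u * dv * m + u * v * w = u * v * m * X) :
    (v' * (u' * du) * v + v' * dv) * m + w = m * X := by
  have hu' : ∀ r, u' * (u * r) = r := fun r => by rw [← mul_assoc, hu, one_mul]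
  have hv' : ∀ r, v' * (v * r) = r := fun r => by rw [← mul_assoc, hv, one_mul]
  have := congrArg (fun r => v' * (u' * r)) h
  simp only [mul_add, mul_assoc, hu', hv'] at this
  rw [← this]
  simp only [add_mul, mul_assoc]

theorem fderiv_exp_restrictScalars [CompleteSpace 𝔹] (Y ξ : 𝔹) :
    fderiv ℝ (exp : 𝔹 → 𝔹) Y ξ = fderiv ℂ exp Y ξ := by
  have h := ((contDiff_exp ℂ (𝔸 := 𝔹) (n := 1)).differentiable one_ne_zero Y).hasFDerivAt
  rw [(h.restrictScalars ℝ).fderiv]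
  rfl

theorem hasFDerivAt_exp_complex [CompleteSpace 𝔹] (Y : 𝔹) :
    HasFDerivAt (exp : 𝔹 → 𝔹) (fderiv ℂ exp Y) Y :=
  ((contDiff_exp ℂ (𝔸 := 𝔹) (n := 1)).differentiable one_ne_zero Y).hasFDerivAt

/-- `exp (-Y) * d exp_Y ξ ∈ s` for `Y`, `ξ` in a complex Lie subalgebra `s`. -/
theorem exp_neg_mul_fderiv_exp_mem_complex [CompleteSpace 𝔹] {s : Submodule ℂ 𝔹}
    (hs : ∀ X ∈ s, ∀ Y ∈ s, X * Y - Y * X ∈ s) {Y ξ : 𝔹} (hY : Y ∈ s) (hξ : ξ ∈ s) :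
    exp (-Y) * fderiv ℂ exp Y ξ ∈ s := by
  rw [← fderiv_exp_restrictScalars]
  haveI : FiniteDimensional ℝ 𝔹 := FiniteDimensional.complexToReal 𝔹
  exact exp_neg_mul_fderiv_exp_mem (s := s.restrictScalars ℝ) hs hY hξ

theorem exp_conj_mem_complex [CompleteSpace 𝔹] {s : Submodule ℂ 𝔹} {Y : 𝔹}
    (hY : ∀ X ∈ s, Y * X - X * Y ∈ s) {X : 𝔹} (hX : X ∈ s) : exp Y * X * exp (-Y) ∈ s := by
  haveI : FiniteDimensional ℝ 𝔹 := FiniteDimensional.complexToReal 𝔹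
  exact exp_conj_mem (s := s.restrictScalars ℝ) hY hX

namespace Splitting

variable (S : Splitting E 𝔹)

/-- The Lie algebra `s = range a ⊕ p`. -/
def s : Submodule ℂ 𝔹 := LinearMap.range (S.a : E →ₗ[ℂ] 𝔹) ⊔ S.p

/-- A linear complement of `s`. -/
def w : Submodule ℂ 𝔹 := Classical.choose S.s.exists_isCompl

theorem isCompl_w : IsCompl S.s S.w := Classical.choose_spec S.s.exists_isCompl

theorem a_mem (z : E) : S.a z ∈ S.s := Submodule.mem_sup_left ⟨z, rfl⟩

theorem p_le : S.p ≤ S.s := le_sup_right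

/-- The product map `(z, y, w) ↦ exp (a z) exp y (1 + w)`. -/
def prod (x : E × S.p × S.w) : 𝔹 := exp (S.a x.1) * exp (x.2.1 : 𝔹) * (1 + x.2.2)

/-- The sum map `(z, y, w) ↦ a z + y + w`. -/
def sumMap : (E × S.p × S.w) →L[ℂ] 𝔹 :=
  S.a.comp (ContinuousLinearMap.fst ℂ _ _) +
    (S.p.subtypeL.comp ((ContinuousLinearMap.fst ℂ _ _).comp (ContinuousLinearMap.snd ℂ _ _)) +
      S.w.subtypeL.comp ((ContinuousLinearMap.snd ℂ _ _).comp (ContinuousLinearMap.snd ℂ _ _)))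

theorem sumMap_apply (x : E × S.p × S.w) : S.sumMap x = S.a x.1 + (x.2.1 + x.2.2) := rfl

theorem sumMap_bijective : Function.Bijective S.sumMap := by
  constructor
  · refine (injective_iff_map_eq_zero _).2 fun x hx => ?_
    obtain ⟨z, y, w⟩ := x
    rw [sumMap_apply] at hx
    have hw : (w : 𝔹) = 0 := by
      refine (Submodule.disjoint_def.1 S.isCompl_w.disjoint) _ ?_ w.2
      have : (w : 𝔹) = -(S.a z + y) := by
        rw [← sub_eq_zero, sub_neg_eq_add, ← hx]; simp only; abel
      rw [this]
      exact S.s.neg_mem (S.s.add_mem (S.a_mem z) (S.p_le y.2))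
    have hy : (y : 𝔹) = 0 := by
      refine (Submodule.disjoint_def.1 S.disj) _ ?_ y.2
      have : (y : 𝔹) = S.a (-z) := by
        rw [map_neg, ← sub_eq_zero, sub_neg_eq_add, ← hx]; simp only [hw]; abel
      exact this ▸ ⟨-z, rfl⟩
    have hz : z = 0 := S.a_inj (by simpa [hw, hy] using hx)
    simp only [ZeroMemClass.coe_eq_zero] at hw hy
    simp [hw, hy, hz]
  · intro u
    have hu : u ∈ S.s ⊔ S.w := by rw [S.isCompl_w.sup_eq_top]; trivial
    obtain ⟨v, hv, w, hw, rfl⟩ := Submodule.mem_sup.1 hu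
    obtain ⟨_, ⟨z, rfl⟩, y, hy, rfl⟩ := Submodule.mem_sup.1 hv
    exact ⟨(z, ⟨y, hy⟩, ⟨w, hw⟩), by simp [sumMap_apply, add_assoc]⟩

/-- The sum map as an isomorphism. -/
def sumEquiv : (E × S.p × S.w) ≃L[ℂ] 𝔹 :=
  (LinearEquiv.ofBijective (S.sumMap : (E × S.p × S.w) →ₗ[ℂ] 𝔹)
    S.sumMap_bijective).toContinuousLinearEquiv

theorem coe_sumEquiv : (S.sumEquiv : (E × S.p × S.w) →L[ℂ] 𝔹) = S.sumMap :=
  ContinuousLinearMap.ext fun _ => rfl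

theorem sumEquiv_symm_a (z : E) : S.sumEquiv.symm (S.a z) = (z, 0, 0) := by
  rw [ContinuousLinearEquiv.symm_apply_eq]
  change _ = S.sumMap _
  simp [sumMap_apply]

theorem sumEquiv_symm_p (y : S.p) : S.sumEquiv.symm y = (0, y, 0) := by
  rw [ContinuousLinearEquiv.symm_apply_eq]
  change _ = S.sumMap _
  simp [sumMap_apply]

variable [CompleteSpace 𝔹]

theorem hasFDerivAt_prod (x : E × S.p × S.w) : ∃ D : (E × S.p × S.w) →L[ℂ] 𝔹,
    HasFDerivAt S.prod D x ∧ ∀ v, D v =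
      fderiv ℂ exp (S.a x.1) (S.a v.1) * exp (x.2.1 : 𝔹) * (1 + x.2.2) +
      exp (S.a x.1) * fderiv ℂ exp (x.2.1 : 𝔹) v.2.1 * (1 + x.2.2) +
      exp (S.a x.1) * exp (x.2.1 : 𝔹) * v.2.2 := by
  have h1 : HasFDerivAt (fun x : E × S.p × S.w => exp (S.a x.1)) _ x :=
    (hasFDerivAt_exp_complex (S.a x.1)).comp x (S.a.hasFDerivAt.comp x hasFDerivAt_fst)
  have h2 : HasFDerivAt (fun x : E × S.p × S.w => exp (x.2.1 : 𝔹)) _ x :=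
    (hasFDerivAt_exp_complex (x.2.1 : 𝔹)).comp x
      (S.p.subtypeL.hasFDerivAt.comp x (hasFDerivAt_fst.comp x hasFDerivAt_snd))
  have h3 : HasFDerivAt (fun x : E × S.p × S.w => 1 + (x.2.2 : 𝔹)) _ x :=
    (S.w.subtypeL.comp ((ContinuousLinearMap.snd ℂ S.p S.w).comp
      (ContinuousLinearMap.snd ℂ E (S.p × S.w)))).hasFDerivAt.const_add 1
  refine ⟨_, (h1.mul' h2).mul' h3, fun v => ?_⟩
  simp
  abel

theorem contDiff_prod : ContDiff ℂ ω S.prod := by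
  have h1 : ContDiff ℂ ω (fun x : E × S.p × S.w => exp (S.a x.1)) :=
    (contDiff_exp ℂ).comp (S.a.contDiff.comp contDiff_fst)
  have h2 : ContDiff ℂ ω (fun x : E × S.p × S.w => exp (x.2.1 : 𝔹)) :=
    (contDiff_exp ℂ).comp (S.p.subtypeL.contDiff.comp (contDiff_fst.comp contDiff_snd))
  have h3 : ContDiff ℂ ω (fun x : E × S.p × S.w => 1 + (x.2.2 : 𝔹)) :=
    contDiff_const.add (S.w.subtypeL.contDiff.comp (contDiff_snd.comp contDiff_snd))
  exact (h1.mul h2).mul h3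

theorem hasFDerivAt_prod_zero :
    HasFDerivAt S.prod (S.sumEquiv : (E × S.p × S.w) →L[ℂ] 𝔹) 0 := by
  obtain ⟨D, hD, h⟩ := S.hasFDerivAt_prod 0
  have h0 : fderiv ℂ (exp : 𝔹 → 𝔹) 0 = 1 := (hasFDerivAt_exp_zero (𝕂 := ℂ)).fderiv
  convert hD using 1
  refine ContinuousLinearMap.ext fun v => ?_
  rw [h, coe_sumEquiv, sumMap_apply]
  simp [h0, add_assoc]

theorem exists_chart : ∃ e : OpenPartialHomeomorph (E × S.p × S.w) 𝔹,
    0 ∈ e.source ∧ (∀ y, e y = S.prod y) ∧ (∀ y ∈ e.source, ContDiffAt ℂ ω S.prod y) ∧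
      (∀ z ∈ e.target, ContDiffAt ℂ ω e.symm z) ∧
      ∀ y ∈ e.source, ∃ L : (E × S.p × S.w) ≃L[ℂ] 𝔹,
        HasFDerivAt S.prod (L : (E × S.p × S.w) →L[ℂ] 𝔹) y ∧
          HasFDerivAt e.symm (L.symm : 𝔹 →L[ℂ] E × S.p × S.w) (S.prod y) :=
  exists_openPartialHomeomorph S.contDiff_prod.contDiffAt S.hasFDerivAt_prod_zero

/-- The chart `u = exp (a z) exp y (1 + w) ↦ (z, y, w)` near `1`, as the inverse of `prod`. -/
def dec : OpenPartialHomeomorph (E × S.p × S.w) 𝔹 := Classical.choose S.exists_chart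

theorem zero_mem_dec_source : 0 ∈ S.dec.source := (Classical.choose_spec S.exists_chart).1

theorem dec_apply (x) : S.dec x = S.prod x := (Classical.choose_spec S.exists_chart).2.1 x

theorem contDiffAt_dec_symm {u : 𝔹} (hu : u ∈ S.dec.target) : ContDiffAt ℂ ω S.dec.symm u :=
  (Classical.choose_spec S.exists_chart).2.2.2.1 u hu

theorem hasFDerivAt_dec_symm {u : 𝔹} (hu : u ∈ S.dec.target) :
    HasFDerivAt S.dec.symm (fderiv ℂ S.dec.symm u) u :=
  ((S.contDiffAt_dec_symm hu).differentiableAt (by simp)).hasFDerivAt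

theorem prod_dec_symm {u : 𝔹} (hu : u ∈ S.dec.target) : S.prod (S.dec.symm u) = u := by
  rw [← dec_apply]; exact S.dec.right_inv hu

theorem prod_zero : S.prod 0 = 1 := by simp [prod]

theorem one_mem_dec_target : (1 : 𝔹) ∈ S.dec.target := by
  rw [← S.prod_zero, ← dec_apply]; exact S.dec.map_source S.zero_mem_dec_source

theorem dec_symm_one : S.dec.symm 1 = 0 := by
  rw [← S.prod_zero, ← dec_apply]; exact S.dec.left_inv S.zero_mem_dec_source

theorem fderiv_dec_symm_one : fderiv ℂ S.dec.symm 1 = S.sumEquiv.symm := by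
  obtain ⟨L, hL, hL'⟩ := (Classical.choose_spec S.exists_chart).2.2.2.2 0 S.zero_mem_dec_source
  have : L = S.sumEquiv := ContinuousLinearEquiv.coe_injective
    (hL.unique S.hasFDerivAt_prod_zero)
  rw [S.prod_zero, this] at hL'
  exact hL'.fderiv

/-- If `D` is the derivative of `prod` at `x = dec⁻¹ u` and `D v = X`, then the derivative of
`dec⁻¹` at `u` maps `X` to `v`. -/
theorem fderiv_dec_symm_apply {x : E × S.p × S.w} (hx : x ∈ S.dec.source)
    {D : (E × S.p × S.w) →L[ℂ] 𝔹} (hD : HasFDerivAt S.prod D x) :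
    Function.Injective D ∧ ∀ v, fderiv ℂ S.dec.symm (S.prod x) (D v) = v := by
  obtain ⟨L, hL, hL'⟩ := (Classical.choose_spec S.exists_chart).2.2.2.2 x hx
  have : D = L := hD.unique hL
  subst this
  exact ⟨L.injective, fun v => by
    rw [show fderiv ℂ S.dec.symm (S.prod x) = L.symm from hL'.fderiv]
    exact L.symm_apply_apply v⟩

/-- The local leaf `exp (range a) exp p` through `1`. -/
def leaf : Set 𝔹 := {u | u ∈ S.dec.target ∧ (S.dec.symm u).2.2 = 0}

theorem one_mem_leaf : (1 : 𝔹) ∈ S.leaf := ⟨S.one_mem_dec_target, by simp [dec_symm_one]⟩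

theorem eq_of_mem_leaf {u : 𝔹} (hu : u ∈ S.leaf) :
    u = exp (S.a (S.dec.symm u).1) * exp ((S.dec.symm u).2.1 : 𝔹) := by
  have := S.prod_dec_symm hu.1
  rw [prod, hu.2] at this
  simpa using this.symm

theorem exists_projection_w : ∃ pr : 𝔹 →L[ℂ] 𝔹, (∀ x ∈ S.s, pr x = 0) ∧ ∀ x ∈ S.w, pr x = x := by
  refine ⟨LinearMap.toContinuousLinearMap
    (S.w.subtype ∘ₗ S.w.projectionOnto S.s S.isCompl_w.symm), fun x hx => ?_, fun x hx => ?_⟩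
  · simpa using hx
  · have := Submodule.projectionOnto_apply_left S.isCompl_w.symm ⟨x, hx⟩
    change ((S.w.projectionOnto S.s S.isCompl_w.symm x : S.w) : 𝔹) = x
    rw [this]

/-- A path tangent to `s` that starts on the leaf remains on the leaf. -/
theorem mem_leaf_of_isPathIn {c X : ℝ → 𝔹} (hc : IsPathIn S.s S.dec.target c X)
    (h0 : c 0 ∈ S.leaf) : ∀ t ∈ Icc (0 : ℝ) 1, c t ∈ S.leaf := by
  obtain ⟨pr, hpr0, hpr1⟩ := S.exists_projection_w
  let x : ℝ → E × S.p × S.w := fun t => S.dec.symm (c t)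
  let x' : ℝ → E × S.p × S.w := fun t => fderiv ℂ S.dec.symm (c t) (c t * X t)
  have hcc : ContinuousOn c (Icc 0 1) := fun t ht => (hc.deriv t ht).continuousAt.continuousWithinAt
  have hx : ∀ t ∈ Icc (0 : ℝ) 1, HasDerivAt x (x' t) t := fun t ht =>
    ((S.hasFDerivAt_dec_symm (hc.maps t ht)).restrictScalars ℝ).comp_hasDerivAt t (hc.deriv t ht)
  have hxc : ContinuousOn x (Icc 0 1) := fun t ht => (hx t ht).continuousAt.continuousWithinAt
  have hx'c : ContinuousOn x' (Icc 0 1) := by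
    have h1 : ContinuousOn (fderiv ℂ S.dec.symm) S.dec.target := fun u hu =>
      ((S.contDiffAt_dec_symm hu).fderiv_right (m := 0)
        (by simp)).continuousAt.continuousWithinAt
    exact (h1.comp hcc hc.maps).clm_apply (hcc.mul hc.cont)
  -- `A` and `B` are the left logarithmic derivatives of `exp (a z)` and `exp y`, and `T` is that of
  -- their product. It lies in `s` because `s` is a Lie algebra.
  let A : ℝ → 𝔹 := fun t => exp (-S.a (x t).1) * fderiv ℂ exp (S.a (x t).1) (S.a (x' t).1)
  let B : ℝ → 𝔹 := fun t => exp (-((x t).2.1 : 𝔹)) * fderiv ℂ exp ((x t).2.1 : 𝔹) (x' t).2.1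
  let T : ℝ → 𝔹 := fun t => exp (-((x t).2.1 : 𝔹)) * A t * exp ((x t).2.1 : 𝔹) + B t
  have hTs : ∀ t, T t ∈ S.s := by
    intro t
    have hA : A t ∈ S.s := exp_neg_mul_fderiv_exp_mem_complex S.s_lie (S.a_mem _) (S.a_mem _)
    have hB : B t ∈ S.s :=
      exp_neg_mul_fderiv_exp_mem_complex S.s_lie (S.p_le (x t).2.1.2) (S.p_le (x' t).2.1.2)
    refine S.s.add_mem ?_ hB
    have := exp_conj_mem_complex (Y := -((x t).2.1 : 𝔹)) (s := S.s) (fun Z hZ =>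
      S.s_lie _ (S.s.neg_mem (S.p_le (x t).2.1.2)) _ hZ) hA
    simpa using this
  have hexp : Continuous (exp : 𝔹 → 𝔹) := continuous_exp'
  have hdexp : Continuous (fderiv ℂ (exp : 𝔹 → 𝔹)) :=
    (contDiff_exp ℂ (n := 1)).continuous_fderiv one_ne_zero
  have hTc : ContinuousOn T (Icc 0 1) := by
    have h1 : ContinuousOn (fun t => S.a (x t).1) (Icc 0 1) :=
      S.a.continuous.comp_continuousOn hxc.fst
    have h1' : ContinuousOn (fun t => S.a (x' t).1) (Icc 0 1) :=
      S.a.continuous.comp_continuousOn hx'c.fst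
    have h2 : ContinuousOn (fun t => ((x t).2.1 : 𝔹)) (Icc 0 1) :=
      continuous_subtype_val.comp_continuousOn hxc.snd.fst
    have h2' : ContinuousOn (fun t => ((x' t).2.1 : 𝔹)) (Icc 0 1) :=
      continuous_subtype_val.comp_continuousOn hx'c.snd.fst
    have hA : ContinuousOn A (Icc 0 1) :=
      (hexp.comp_continuousOn h1.neg).mul ((hdexp.comp_continuousOn h1).clm_apply h1')
    have hB : ContinuousOn B (Icc 0 1) :=
      (hexp.comp_continuousOn h2.neg).mul ((hdexp.comp_continuousOn h2).clm_apply h2')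
    exact (((hexp.comp_continuousOn h2.neg).mul hA).mul (hexp.comp_continuousOn h2)).add hB
  -- Projecting along `s` kills `X` and `T`, which leaves a linear equation for the `w`-coordinate
  -- without constant term. Its initial value is zero, so Grönwall applies.
  have hM' : ∀ t ∈ Icc (0 : ℝ) 1, ((x' t).2.2 : 𝔹) = pr ((x t).2.2 * X t - T t * (x t).2.2) := by
    intro t ht
    obtain ⟨D, hD, hDv⟩ := S.hasFDerivAt_prod (x t)
    have hprod : ∀ᶠ τ in 𝓝 t, S.prod (x τ) = c τ := by
      filter_upwards [(hc.deriv t ht).continuousAt.eventually_mem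
        (S.dec.open_target.mem_nhds (hc.maps t ht))] with τ hτ
      exact S.prod_dec_symm hτ
    have h1 : D (x' t) = c t * X t :=
      (((hD.restrictScalars ℝ).comp_hasDerivAt t (hx t ht)).congr_of_eventuallyEq
        (hprod.mono fun _ h => h.symm)).unique (hc.deriv t ht)
    rw [← hprod.self_of_nhds, hDv, prod] at h1
    have h2 : T t * (1 + (x t).2.2) + (x' t).2.2 = (1 + (x t).2.2) * X t := by
      exact mul_add_eq_of_prod_rule (exp_neg_mul_exp _) (exp_neg_mul_exp _) h1
    have h3 : ((x' t).2.2 : 𝔹) = X t - T t + ((x t).2.2 * X t - T t * (x t).2.2) := by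
      rw [← sub_eq_zero, ← sub_eq_zero.2 h2]; noncomm_ring
    rw [← hpr1 _ (x' t).2.2.2, h3, map_add, hpr0 _ (S.s.sub_mem (hc.mem t ht) (hTs t)), zero_add]
  obtain ⟨KX, hKX⟩ := isCompact_Icc.exists_bound_of_continuousOn hc.cont
  obtain ⟨KT, hKT⟩ := isCompact_Icc.exists_bound_of_continuousOn hTc
  have hMd : ∀ t ∈ Icc (0 : ℝ) 1, HasDerivAt (fun t => ((x t).2.2 : 𝔹)) ((x' t).2.2 : 𝔹) t :=
    fun t ht => ((S.w.subtypeL.restrictScalars ℝ).comp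
      ((ContinuousLinearMap.snd ℝ S.p S.w).comp
        (ContinuousLinearMap.snd ℝ E (S.p × S.w)))).hasFDerivAt.comp_hasDerivAt t (hx t ht)
  have key := eq_zero_of_abs_deriv_le_mul_abs_self_of_eq_zero_right
    (f := fun t => ((x t).2.2 : 𝔹)) (f' := fun t => ((x' t).2.2 : 𝔹))
    (K := ‖pr‖ * (KX + KT)) (a := 0) (b := 1)
    (fun t ht => (hMd t ht).continuousAt.continuousWithinAt)
    (fun t ht => (hMd t (Ico_subset_Icc_self ht)).hasDerivWithinAt) (by simp [x, h0.2])
    (fun t ht => by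
      have ht' := Ico_subset_Icc_self ht
      rw [hM' t ht', mul_assoc]
      refine (pr.le_opNorm _).trans ?_
      gcongr
      refine (norm_sub_le _ _).trans ?_
      rw [add_mul KX]
      refine add_le_add ?_ ?_
      · rw [mul_comm KX]
        exact (norm_mul_le _ _).trans (by gcongr; exact hKX t ht')
      · exact (norm_mul_le _ _).trans (by gcongr; exact hKT t ht'))
  exact fun t ht => ⟨hc.maps t ht, Subtype.ext (key t ht)⟩

/-- On the leaf, moving in the direction `X ∈ p` changes only the `p`-coordinate. -/
theorem fderiv_dec_symm_of_mem_leaf {u X : 𝔹} (hu : u ∈ S.leaf) (hX : X ∈ S.p) :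
    ∃ ξ : S.p, fderiv ℂ S.dec.symm u (u * X) = (0, ξ, 0) ∧
      fderiv ℂ exp ((S.dec.symm u).2.1 : 𝔹) ξ = exp ((S.dec.symm u).2.1 : 𝔹) * X := by
  have hu' := S.eq_of_mem_leaf hu
  have hu2 := hu.2
  have hpu := S.prod_dec_symm hu.1
  have hxs := S.dec.map_target hu.1
  set x := S.dec.symm u with hx
  obtain ⟨D, hD, hDv⟩ := S.hasFDerivAt_prod x
  obtain ⟨hinj, hsymm⟩ := S.fderiv_dec_symm_apply hxs hD
  rw [hpu] at hsymm
  have hD' : ∀ ξ : S.p, D (0, ξ, 0) = exp (S.a x.1) * fderiv ℂ exp (x.2.1 : 𝔹) ξ := fun ξ => by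
    rw [hDv]; simp [hu2]
  -- The logarithmic derivative of `exp` at `y`, as an endomorphism of `p`. It is injective because
  -- the derivative of `prod` is, hence surjective by finite dimension: every direction `X ∈ p` is
  -- obtained by varying `y` alone.
  let T : S.p →ₗ[ℂ] S.p :=
    { toFun := fun ξ => ⟨exp (-(x.2.1 : 𝔹)) * fderiv ℂ exp (x.2.1 : 𝔹) ξ,
        exp_neg_mul_fderiv_exp_mem_complex S.p_lie x.2.1.2 ξ.2⟩
      map_add' := fun ξ η => by ext; simp [mul_add]
      map_smul' := fun r ξ => by ext; simp }
  have hT : ∀ ξ : S.p, exp (x.2.1 : 𝔹) * (T ξ : 𝔹) = fderiv ℂ exp (x.2.1 : 𝔹) ξ := fun ξ => by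
    simp [T, ← mul_assoc]
  have hTinj : Function.Injective T := by
    refine (injective_iff_map_eq_zero T).2 fun ξ hξ => ?_
    have h1 : D (0, ξ, 0) = D 0 := by rw [hD', ← hT, hξ]; simp
    have := hinj h1
    simp only [Prod.mk_eq_zero] at this
    exact this.2.1
  obtain ⟨ξ, hξ⟩ := (LinearMap.injective_iff_surjective.1 hTinj) ⟨X, hX⟩
  have h2 : fderiv ℂ exp (x.2.1 : 𝔹) ξ = exp (x.2.1 : 𝔹) * X := by rw [← hT, hξ]
  refine ⟨ξ, ?_, h2⟩
  rw [← hsymm (0, ξ, 0), hD', h2, ← mul_assoc, ← hu']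

/-- Along paths on the leaf tangent to `p`, the first coordinate is constant. -/
theorem dec_symm_fst_eq_of_isPathIn {c X : ℝ → 𝔹} (hc : IsPathIn S.p S.dec.target c X)
    (h0 : c 0 ∈ S.leaf) {t : ℝ} (ht : t ∈ Icc (0 : ℝ) 1) :
    (S.dec.symm (c t)).1 = (S.dec.symm (c 0)).1 := by
  have hl := S.mem_leaf_of_isPathIn ⟨hc.deriv, fun t ht => S.p_le (hc.mem t ht), hc.cont, hc.maps⟩ h0
  have hd : ∀ t ∈ Icc (0 : ℝ) 1, HasDerivAt (fun t => (S.dec.symm (c t)).1) 0 t := by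
    intro t ht
    obtain ⟨ξ, h1, -⟩ := S.fderiv_dec_symm_of_mem_leaf (hl t ht) (hc.mem t ht)
    have h2 := ((S.hasFDerivAt_dec_symm (hc.maps t ht)).restrictScalars ℝ).comp_hasDerivAt t
      (hc.deriv t ht)
    have h3 := (ContinuousLinearMap.fst ℝ E (S.p × S.w)).hasFDerivAt.comp_hasDerivAt t h2
    refine h3.congr_deriv ?_
    simp [h1]
  exact constant_of_has_deriv_right_zero
    (fun t ht => (hd t ht).continuousAt.continuousWithinAt)
    (fun t ht => (hd t (Ico_subset_Icc_self ht)).hasDerivWithinAt) t ht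

/-! ### Integrating a homomorphism of Lie algebras on `p`. -/

section Rep

variable {𝔻 : Type*} [NormedRing 𝔻] [NormedAlgebra ℂ 𝔻] [FiniteDimensional ℂ 𝔻] [CompleteSpace 𝔻]

/-- `d exp` commutes with homomorphisms of Lie algebras. -/
theorem fderiv_exp_map (lam : S.p →ₗ[ℂ] 𝔻) (hlam : ∀ X Y : S.p,
      lam ⟨X * Y - Y * X, S.p_lie X X.2 Y Y.2⟩ = lam X * lam Y - lam Y * lam X)
    {y ξ X : S.p} (h : fderiv ℂ exp (y : 𝔹) ξ = exp (y : 𝔹) * X) :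
    fderiv ℂ exp (lam y) (lam ξ) = exp (lam y) * lam X := by
  -- The graph of `lam` is a Lie subalgebra of the product algebra, so the logarithmic derivative of
  -- `exp` stays in it. Reading off the two components gives the claim.
  let Γ : Submodule ℂ (𝔹 × 𝔻) := LinearMap.range (S.p.subtype.prod lam)
  have hΓ : ∀ A ∈ Γ, ∀ B ∈ Γ, A * B - B * A ∈ Γ := by
    rintro _ ⟨A, rfl⟩ _ ⟨B, rfl⟩
    exact ⟨⟨A * B - B * A, S.p_lie A A.2 B B.2⟩, by simp [hlam]⟩
  have hmem := exp_neg_mul_fderiv_exp_mem_complex hΓ (Y := ((y : 𝔹), lam y))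
    (ξ := ((ξ : 𝔹), lam ξ)) ⟨y, rfl⟩ ⟨ξ, rfl⟩
  have hexp : ∀ v : 𝔹 × 𝔻, (exp v : 𝔹 × 𝔻) = (exp v.1, exp v.2) := fun v => Prod.ext
    (map_exp' (RingHom.fst 𝔹 𝔻) continuous_fst v) (map_exp' (RingHom.snd 𝔹 𝔻) continuous_snd v)
  have hd : fderiv ℂ (exp : 𝔹 × 𝔻 → 𝔹 × 𝔻) ((y : 𝔹), lam y) ((ξ : 𝔹), lam ξ) =
      (fderiv ℂ exp (y : 𝔹) (ξ : 𝔹), fderiv ℂ exp (lam y) (lam ξ)) := by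
    have h1 : HasFDerivAt (fun v : 𝔹 × 𝔻 => (exp v.1, exp v.2)) _ ((y : 𝔹), lam y) :=
      ((hasFDerivAt_exp_complex (y : 𝔹)).comp ((y : 𝔹), lam y) hasFDerivAt_fst).prodMk
        ((hasFDerivAt_exp_complex (lam y)).comp ((y : 𝔹), lam y) hasFDerivAt_snd)
    rw [show (exp : 𝔹 × 𝔻 → 𝔹 × 𝔻) = fun v => (exp v.1, exp v.2) from funext hexp, h1.fderiv]
    rfl
  rw [hd, h, hexp] at hmem
  obtain ⟨A, hA⟩ := hmem
  have hA1 : (A : 𝔹) = X := by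
    have := congrArg Prod.fst hA
    simpa [← mul_assoc] using this
  have hA2 : lam A = exp (-lam y) * fderiv ℂ exp (lam y) (lam ξ) := by
    simpa using congrArg Prod.snd hA
  rw [Subtype.ext hA1] at hA2
  rw [hA2, ← mul_assoc, exp_mul_exp_neg, one_mul]

/-- The local homomorphism `exp (a z) exp y ↦ exp (λ y)`. -/
def theta (lam : S.p →ₗ[ℂ] 𝔻) (u : 𝔹) : 𝔻 := exp (lam (S.dec.symm u).2.1)

theorem contDiffAt_theta (lam : S.p →ₗ[ℂ] 𝔻) {u : 𝔹} (hu : u ∈ S.dec.target) :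
    ContDiffAt ℂ ω (S.theta lam) u := by
  refine (contDiff_exp ℂ).contDiffAt.comp u ?_
  refine (LinearMap.toContinuousLinearMap lam).contDiff.contDiffAt.comp u ?_
  exact (contDiff_fst.contDiffAt.comp _ contDiff_snd.contDiffAt).comp u (S.contDiffAt_dec_symm hu)

theorem isUnit_theta (lam : S.p →ₗ[ℂ] 𝔻) (u : 𝔹) : IsUnit (S.theta lam u) :=
  ⟨⟨_, _, exp_mul_exp_neg _, exp_neg_mul_exp _⟩, rfl⟩

/-- On the leaf a motion tangent to `p` only changes `y`, and `d exp` is compatible with `lam`. So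
`θ` carries a path with logarithmic derivative `X` to one with logarithmic derivative `lam X`. -/
theorem hasDerivAt_theta (lam : S.p →ₗ[ℂ] 𝔻) (hlam : ∀ X Y : S.p,
      lam ⟨X * Y - Y * X, S.p_lie X X.2 Y Y.2⟩ = lam X * lam Y - lam Y * lam X)
    {c X : ℝ → 𝔹} (hc : IsPathIn S.p S.dec.target c X)
    (h0 : c 0 ∈ S.leaf) {t : ℝ} (ht : t ∈ Icc (0 : ℝ) 1) :
    HasDerivAt (fun t => S.theta lam (c t)) (S.theta lam (c t) * lam ⟨X t, hc.mem t ht⟩) t := by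
  have hl := S.mem_leaf_of_isPathIn ⟨hc.deriv, fun t ht => S.p_le (hc.mem t ht), hc.cont, hc.maps⟩ h0
  obtain ⟨ξ, h1, h1'⟩ := S.fderiv_dec_symm_of_mem_leaf (hl t ht) (hc.mem t ht)
  have h2 := ((S.hasFDerivAt_dec_symm (hc.maps t ht)).restrictScalars ℝ).comp_hasDerivAt t
    (hc.deriv t ht)
  have h3 := ((LinearMap.toContinuousLinearMap lam).restrictScalars ℝ |>.comp
    ((ContinuousLinearMap.fst ℝ S.p S.w).comp
      (ContinuousLinearMap.snd ℝ E (S.p × S.w)))).hasFDerivAt.comp_hasDerivAt t h2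
  have h4 := ((hasFDerivAt_exp_complex (lam (S.dec.symm (c t)).2.1)).restrictScalars
    ℝ).comp_hasDerivAt t h3
  refine h4.congr_deriv ?_
  have := S.fderiv_exp_map lam hlam (y := (S.dec.symm (c t)).2.1) (ξ := ξ) (X := ⟨X t, hc.mem t ht⟩) h1'
  simpa [h1, theta] using this

end Rep

end Splitting

end HomogeneousComplex

namespace HomogeneousComplex

open NormedSpace Set Filter

/-! ### Closed subgroups of finite-dimensional algebras -/

/-- A submonoid `S` of an algebra which is closed, and closed under inverses, as far as
exponentials are concerned. -/
structure ExpClosed {𝔸 : Type*} [NormedRing 𝔸] [NormedAlgebra ℝ 𝔸] (S : Submonoid 𝔸) : Prop where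
  closure_mem : ∀ X : 𝔸, exp X ∈ closure (S : Set 𝔸) → exp X ∈ S
  neg_mem : ∀ X : 𝔸, exp X ∈ S → exp (-X) ∈ S

variable {𝔸 : Type*} [NormedRing 𝔸] [NormedAlgebra ℝ 𝔸]

theorem exp_nsmul' [CompleteSpace 𝔸] (n : ℕ) (x : 𝔸) : exp ((n : ℝ) • x) = exp x ^ n := by
  letI : NormedAlgebra ℚ 𝔸 := .restrictScalars ℚ ℝ 𝔸
  rw [← exp_nsmul, Nat.cast_smul_eq_nsmul]

theorem exists_log [CompleteSpace 𝔸] : ∃ e : OpenPartialHomeomorph 𝔸 𝔸, 0 ∈ e.source ∧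
    (∀ x, e x = exp x) ∧ HasFDerivAt e.symm (ContinuousLinearMap.id ℝ 𝔸) 1 := by
  have h0 : HasFDerivAt (exp : 𝔸 → 𝔸) ((ContinuousLinearEquiv.refl ℝ 𝔸 : 𝔸 ≃L[ℝ] 𝔸) : 𝔸 →L[ℝ] 𝔸) 0 :=
    hasFDerivAt_exp_zero (𝕂 := ℝ)
  obtain ⟨e, h1, h2, -, -, h3⟩ := exists_openPartialHomeomorph (contDiff_exp ℝ).contDiffAt h0
  refine ⟨e, h1, h2, ?_⟩
  obtain ⟨L, hL, hL'⟩ := h3 0 h1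
  have : L = ContinuousLinearEquiv.refl ℝ 𝔸 := ContinuousLinearEquiv.coe_injective (hL.unique h0)
  rw [this, exp_zero] at hL'
  exact hL'

namespace ExpClosed

variable [CompleteSpace 𝔸] {S : Submonoid 𝔸}

/-- `exp X` is the limit of the powers `c(1/(k+1))^(k+1)`, hence in the closure of `S`. No
continuity of `c` away from `0` is needed. -/
theorem exp_mem_of_hasDerivAt (hS : ExpClosed S) {c : ℝ → 𝔸} (hc : ∀ t, c t ∈ S) (c0 : c 0 = 1)
    {X : 𝔸} (hX : HasDerivAt c X 0) : exp X ∈ S := by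
  obtain ⟨e, he0, hexp, hd⟩ := exists_log (𝔸 := 𝔸)
  have h1 : (1 : 𝔸) ∈ e.target := by rw [← exp_zero, ← hexp]; exact e.map_source he0
  have hL0 : e.symm 1 = 0 := by rw [← exp_zero, ← hexp]; exact e.left_inv he0
  rw [← c0] at hd h1
  have hL : HasDerivAt (fun t => e.symm (c t)) X 0 := hd.comp_hasDerivAt (0 : ℝ) hX
  have hev : ∀ᶠ t in 𝓝 (0 : ℝ), exp (e.symm (c t)) = c t := by
    filter_upwards [hX.continuousAt.eventually_mem (e.open_target.mem_nhds h1)] with t ht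
    rw [← hexp]; exact e.right_inv ht
  have hseq : Tendsto (fun k : ℕ => 1 / ((k : ℝ) + 1)) atTop (𝓝 0) :=
    tendsto_one_div_add_atTop_nhds_zero_nat
  have hseq' : Tendsto (fun k : ℕ => 1 / ((k : ℝ) + 1)) atTop (𝓝[≠] 0) :=
    tendsto_nhdsWithin_iff.2 ⟨hseq, Eventually.of_forall fun k => by
      simpa using Nat.cast_add_one_ne_zero k⟩
  have hlim : Tendsto (fun k : ℕ => ((k : ℝ) + 1) • e.symm (c (1 / ((k : ℝ) + 1)))) atTop (𝓝 X) := by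
    have := (hasDerivAt_iff_tendsto_slope_zero.1 hL).comp hseq'
    refine this.congr fun k => ?_
    simp [c0, hL0]
  refine hS.closure_mem X (mem_closure_of_tendsto ((continuous_exp'.tendsto X).comp hlim) ?_)
  filter_upwards [hseq.eventually hev] with k hk
  have : exp (((k : ℝ) + 1) • e.symm (c (1 / ((k : ℝ) + 1)))) = c (1 / ((k : ℝ) + 1)) ^ (k + 1) := by
    rw [← hk, ← exp_nsmul', hk]; push_cast; rfl
  simp only [Function.comp_apply, this]
  exact S.pow_mem (hc _) _

/-- The Lie algebra of a closed group. -/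
def lie (hS : ExpClosed S) : Submodule ℝ 𝔸 where
  carrier := {X | ∀ t : ℝ, exp (t • X) ∈ S}
  zero_mem' := fun t => by simp [S.one_mem]
  -- The product of the two one-parameter groups has velocity `t X + t Y` at `0`.
  add_mem' := fun {X Y} hX hY t => by
    refine hS.exp_mem_of_hasDerivAt (c := fun τ => exp (τ • t • X) * exp (τ • t • Y))
      (fun τ => ?_) (by simp) ?_
    · exact S.mul_mem (by rw [smul_smul]; exact hX _) (by rw [smul_smul]; exact hY _)
    · exact ((hasDerivAt_exp_smul (t • X) 0).mul (hasDerivAt_exp_smul (t • Y) 0)).congr_deriv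
        (by simp)
  smul_mem' := fun a X hX t => by rw [smul_smul]; exact hX _

theorem mem_lie (hS : ExpClosed S) {X : 𝔸} : X ∈ hS.lie ↔ ∀ t : ℝ, exp (t • X) ∈ S := Iff.rfl

theorem exp_mem_of_mem_lie (hS : ExpClosed S) {X : 𝔸} (hX : X ∈ hS.lie) : exp X ∈ S := by
  simpa using hX 1

theorem mem_lie_of_hasDerivAt (hS : ExpClosed S) {c : ℝ → 𝔸} (hc : ∀ t, c t ∈ S) (c0 : c 0 = 1)
    {X : 𝔸} (hX : HasDerivAt c X 0) : X ∈ hS.lie := by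
  intro t
  refine hS.exp_mem_of_hasDerivAt (c := fun τ => c (τ * t)) (fun τ => hc _) (by simpa using c0) ?_
  have h1 : HasDerivAt (fun τ : ℝ => τ * t) t 0 := by
    simpa using (hasDerivAt_id (0 : ℝ)).mul_const t
  rw [← zero_mul t] at hX
  exact hX.scomp (0 : ℝ) h1

theorem conj_mem_lie (hS : ExpClosed S) {u v X : 𝔸} (hu : u ∈ S) (hv : v ∈ S) (huv : u * v = 1)
    (hvu : v * u = 1) (hX : X ∈ hS.lie) : u * X * v ∈ hS.lie := by
  intro t
  have : t • (u * X * v) = u * (t • X) * v := by simp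
  rw [this, exp_conj_of_mul_eq_one huv hvu]
  exact S.mul_mem (S.mul_mem hu (hX t)) hv

variable [FiniteDimensional ℝ 𝔸]

/-- The bracket is the derivative at `0` of `exp (tX) Y exp (-tX)`, a curve in a finite-dimensional,
hence closed, subspace. -/
theorem lie_mem_lie (hS : ExpClosed S) {X Y : 𝔸} (hX : X ∈ hS.lie) (hY : Y ∈ hS.lie) :
    X * Y - Y * X ∈ hS.lie := by
  have hd : HasDerivAt (fun t : ℝ => exp (t • X) * Y * exp (t • -X)) (X * Y - Y * X) 0 := by
    refine (((hasDerivAt_exp_smul X 0).mul_const Y).mul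
      (hasDerivAt_exp_smul (-X) 0)).congr_deriv ?_
    simp [sub_eq_add_neg]
  have hm : ∀ t : ℝ, exp (t • X) * Y * exp (t • -X) ∈ hS.lie := fun t =>
    hS.conj_mem_lie (hX t) (by rw [smul_neg, ← neg_smul]; exact hX _) (by simp) (by simp) hY
  have hcl : IsClosed (hS.lie : Set 𝔸) := Submodule.closed_of_finiteDimensional _
  refine hcl.mem_of_tendsto (hasDerivAt_iff_tendsto_slope_zero.1 hd) (Eventually.of_forall fun t => ?_)
  refine hS.lie.smul_mem _ (hS.lie.sub_mem (hm _) (hm _))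

/-- A direction in which small elements `exp K ∈ S` accumulate belongs to the Lie algebra. -/
theorem mem_lie_of_tendsto (hS : ExpClosed S) {K : ℕ → 𝔸} {v : 𝔸} (hK : ∀ j, exp (K j) ∈ S)
    (hK0 : ∀ j, K j ≠ 0) (hlim : Tendsto K atTop (𝓝 0))
    (hv : Tendsto (fun j => ‖K j‖⁻¹ • K j) atTop (𝓝 v)) : v ∈ hS.lie := by
  have hpos : ∀ t : ℝ, 0 ≤ t → exp (t • v) ∈ S := by
    intro t ht
    -- The integer multiples `⌊t/‖K‖⌋ K` tend to `t v`, and their exponentials are powers of `exp K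
    -- ∈ S`.
    have hn : Tendsto (fun j => (⌊t / ‖K j‖⌋₊ : ℝ) * ‖K j‖) atTop (𝓝 t) := by
      have hK' : Tendsto (fun j => ‖K j‖) atTop (𝓝 0) := by simpa using hlim.norm
      have hp : ∀ j, 0 < ‖K j‖ := fun j => norm_pos_iff.2 (hK0 j)
      refine tendsto_of_tendsto_of_tendsto_of_le_of_le
        (by simpa using (tendsto_const_nhds (x := t)).sub hK') tendsto_const_nhds
        (fun j => ?_) (fun j => ?_)
      · have := Nat.lt_floor_add_one (t / ‖K j‖)
        rw [div_lt_iff₀ (hp j), add_mul, one_mul] at this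
        linarith
      · have := Nat.floor_le (div_nonneg ht (hp j).le)
        rwa [le_div_iff₀ (hp j)] at this
    have h2 : Tendsto (fun j => exp ((⌊t / ‖K j‖⌋₊ : ℝ) • K j)) atTop (𝓝 (exp (t • v))) := by
      refine ((continuous_exp'.tendsto _).comp (hn.smul hv)).congr fun j => ?_
      simp only [Function.comp_apply, smul_smul, mul_assoc,
        mul_inv_cancel₀ (norm_ne_zero_iff.2 (hK0 j)), mul_one]
    refine hS.closure_mem _ (mem_closure_of_tendsto h2 (Eventually.of_forall fun j => ?_))
    rw [exp_nsmul']
    exact S.pow_mem (hK j) _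
  intro t
  rcases le_total 0 t with ht | ht
  · exact hpos t ht
  · have := hS.neg_mem _ (hpos (-t) (by linarith))
    simpa using this

/-- Closed subgroup theorem: near `1`, the elements of `S` are `exp c * exp Y` for unique small
`c ∈ m`, `Y ∈ h`, where the Lie algebra of `S` is `m ⊕ h`. -/
theorem exists_local_product (hS : ExpClosed S) {m h : Submodule ℝ 𝔸} (hmh : m ⊔ h = hS.lie)
    (hdisj : Disjoint m h) :
    ∃ (N : Set 𝔸) (f : 𝔸 → m) (g : 𝔸 → h), IsOpen N ∧ 1 ∈ N ∧ f 1 = 0 ∧ g 1 = 0 ∧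
      (∀ x ∈ N, ContDiffAt ℝ ω f x) ∧ (∀ x ∈ N, ContDiffAt ℝ ω g x) ∧
      (∀ x ∈ N, x ∈ S → x = exp (f x : 𝔸) * exp (g x : 𝔸)) ∧
      ∀ᶠ y : m × h in 𝓝 0, exp (y.1 : 𝔸) * exp (y.2 : 𝔸) ∈ N ∧
        f (exp (y.1 : 𝔸) * exp (y.2 : 𝔸)) = y.1 ∧ g (exp (y.1 : 𝔸) * exp (y.2 : 𝔸)) = y.2 := by
  obtain ⟨k, hk⟩ := hS.lie.exists_isCompl
  let P : m × h × k → 𝔸 := fun x => exp (x.1 : 𝔸) * exp (x.2.1 : 𝔸) * exp (x.2.2 : 𝔸)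
  let p1 : (m × h × k) →L[ℝ] 𝔸 := m.subtypeL.comp (ContinuousLinearMap.fst ℝ _ _)
  let p2 : (m × h × k) →L[ℝ] 𝔸 := h.subtypeL.comp
    ((ContinuousLinearMap.fst ℝ _ _).comp (ContinuousLinearMap.snd ℝ _ _))
  let p3 : (m × h × k) →L[ℝ] 𝔸 := k.subtypeL.comp
    ((ContinuousLinearMap.snd ℝ _ _).comp (ContinuousLinearMap.snd ℝ _ _))
  have hP : ContDiff ℝ ω P := (((contDiff_exp ℝ).comp p1.contDiff).mul
    ((contDiff_exp ℝ).comp p2.contDiff)).mul ((contDiff_exp ℝ).comp p3.contDiff)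
  have hbij : Function.Bijective (p1 + p2 + p3) := by
    have happ : ∀ x : m × h × k, (p1 + p2 + p3) x = x.1 + x.2.1 + x.2.2 := fun x => rfl
    constructor
    · refine (injective_iff_map_eq_zero _).2 fun x hx => ?_
      obtain ⟨a, b, c⟩ := x
      rw [happ] at hx
      simp only at hx
      have hc : (c : 𝔸) = 0 := by
        refine (Submodule.disjoint_def.1 hk.disjoint) _ ?_ c.2
        rw [eq_neg_of_add_eq_zero_right hx, ← hmh]
        exact Submodule.neg_mem _ (Submodule.add_mem_sup a.2 b.2)
      rw [hc, add_zero] at hx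
      have hb : (b : 𝔸) = 0 := by
        refine (Submodule.disjoint_def.1 hdisj) _ ?_ b.2
        rw [eq_neg_of_add_eq_zero_right hx]
        exact Submodule.neg_mem _ a.2
      rw [hb, add_zero] at hx
      simp only [ZeroMemClass.coe_eq_zero] at hx hb hc
      simp [hx, hb, hc]
    · intro u
      have hu : u ∈ hS.lie ⊔ k := by rw [hk.sup_eq_top]; trivial
      obtain ⟨v, hv, c, hc, rfl⟩ := Submodule.mem_sup.1 hu
      rw [← hmh] at hv
      obtain ⟨a, ha, b, hb, rfl⟩ := Submodule.mem_sup.1 hv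
      exact ⟨(⟨a, ha⟩, ⟨b, hb⟩, ⟨c, hc⟩), by rw [happ]⟩
  let L : (m × h × k) ≃L[ℝ] 𝔸 := (LinearEquiv.ofBijective ((p1 + p2 + p3 : (m × h × k) →L[ℝ] 𝔸) :
    (m × h × k) →ₗ[ℝ] 𝔸) hbij).toContinuousLinearEquiv
  have hd : HasFDerivAt P (L : (m × h × k) →L[ℝ] 𝔸) 0 := by
    have hL : (L : (m × h × k) →L[ℝ] 𝔸) = p1 + p2 + p3 := ContinuousLinearMap.ext fun _ => rfl
    have he : ∀ q : (m × h × k) →L[ℝ] 𝔸, HasFDerivAt (fun x => exp (q x)) q 0 := fun q => by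
      have h0 : HasFDerivAt (exp : 𝔸 → 𝔸) (1 : 𝔸 →L[ℝ] 𝔸) (q 0) := by
        rw [map_zero]; exact hasFDerivAt_exp_zero (𝕂 := ℝ)
      exact h0.comp (0 : m × h × k) q.hasFDerivAt
    refine (((he p1).mul' (he p2)).mul' (he p3)).congr_fderiv ?_
    rw [hL]
    refine ContinuousLinearMap.ext fun x => ?_
    simp
    abel
  obtain ⟨e, he0, heP, -, hesymm, -⟩ := exists_openPartialHomeomorph hP.contDiffAt hd
  have hP0 : P 0 = 1 := by simp [P]
  have h1 : (1 : 𝔸) ∈ e.target := by rw [← hP0, ← heP]; exact e.map_source he0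
  have hes1 : e.symm 1 = 0 := by rw [← hP0, ← heP]; exact e.left_inv he0
  have hprod : ∀ x ∈ e.target, P (e.symm x) = x := fun x hx => by rw [← heP]; exact e.right_inv hx
  have hcont1 : ContinuousAt e.symm 1 := (hesymm 1 h1).continuousAt
  -- Heart of the closed subgroup theorem. Otherwise elements of `S` tending to `1` have nonzero
  -- `k`-coordinates `K j`. Removing the first two factors leaves `exp (K j) ∈ S`, and a limit of
  -- the directions `K j / ‖K j‖` is a unit vector in both `k` and the Lie algebra.
  have hev : ∀ᶠ x in 𝓝 (1 : 𝔸), x ∈ S → (e.symm x).2.2 = 0 := by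
    by_contra hcon
    have hfr : ∃ᶠ x in 𝓝 (1 : 𝔸), x ∈ e.target ∧ x ∈ S ∧ (e.symm x).2.2 ≠ 0 := by
      have := (Filter.not_eventually.1 hcon).and_eventually (e.open_target.mem_nhds h1)
      refine this.mono fun x hx => ⟨hx.2, ?_⟩
      simpa using hx.1
    obtain ⟨x, hx1, hx⟩ := Filter.exists_seq_forall_of_frequently hfr
    let K : ℕ → k := fun j => (e.symm (x j)).2.2
    have hK0 : Tendsto K atTop (𝓝 0) := by
      have : Tendsto (fun x => (e.symm x).2.2) (𝓝 1) (𝓝 (e.symm 1).2.2) :=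
        (continuous_snd.comp continuous_snd).continuousAt.tendsto.comp hcont1.tendsto
      rw [hes1] at this
      exact this.comp hx1
    have hKS : ∀ j, exp (K j : 𝔸) ∈ S := by
      intro j
      have h2 := hprod _ (hx j).1
      have ha : exp (-((e.symm (x j)).1 : 𝔸)) ∈ S :=
        hS.exp_mem_of_mem_lie (hmh ▸ Submodule.neg_mem _ (Submodule.mem_sup_left (e.symm (x j)).1.2))
      have hb : exp (-((e.symm (x j)).2.1 : 𝔸)) ∈ S :=
        hS.exp_mem_of_mem_lie (hmh ▸ Submodule.neg_mem _
          (Submodule.mem_sup_right (e.symm (x j)).2.1.2))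
      have h3 : exp (K j : 𝔸) = exp (-((e.symm (x j)).2.1 : 𝔸)) *
          (exp (-((e.symm (x j)).1 : 𝔸)) * x j) := by
        rw [← congrArg (fun u => exp (-((e.symm (x j)).2.1 : 𝔸)) *
          (exp (-((e.symm (x j)).1 : 𝔸)) * u)) h2]
        simp only [P]
        rw [mul_assoc (exp ((e.symm (x j)).1 : 𝔸)), ← mul_assoc (exp (-((e.symm (x j)).1 : 𝔸))),
          exp_neg_mul_exp, one_mul, ← mul_assoc, exp_neg_mul_exp, one_mul]
      rw [h3]
      exact S.mul_mem hb (S.mul_mem ha (hx j).2.1)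
    have hsph : ∀ j, ‖K j‖⁻¹ • K j ∈ Metric.sphere (0 : k) 1 := fun j => by
      have : ‖K j‖ ≠ 0 := norm_ne_zero_iff.2 (hx j).2.2
      rw [mem_sphere_zero_iff_norm, norm_smul, norm_inv, norm_norm, inv_mul_cancel₀ this]
    haveI : ProperSpace k := FiniteDimensional.proper ℝ k
    obtain ⟨v, hv, φ, hφ, hlim⟩ := (isCompact_sphere (0 : k) 1).tendsto_subseq hsph
    have hvl : (v : 𝔸) ∈ hS.lie := by
      refine hS.mem_lie_of_tendsto (K := fun j => (K (φ j) : 𝔸)) (fun j => hKS _)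
        (fun j hj => (hx (φ j)).2.2 (Subtype.ext hj)) ?_ ?_
      · exact (continuous_subtype_val.tendsto (0 : k)).comp (hK0.comp hφ.tendsto_atTop)
      · exact (continuous_subtype_val.tendsto v).comp hlim
    have hv0 : (v : 𝔸) = 0 := Submodule.disjoint_def.1 hk.disjoint _ hvl v.2
    rw [mem_sphere_zero_iff_norm, Subtype.ext (a2 := (0 : k)) hv0] at hv
    simp at hv
  obtain ⟨N₀, hN₀, hN₀o, h1N₀⟩ := eventually_nhds_iff.1 hev
  refine ⟨N₀ ∩ e.target, fun x => (e.symm x).1, fun x => (e.symm x).2.1, hN₀o.inter e.open_target,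
    ⟨h1N₀, h1⟩, by simp [hes1], by simp [hes1], ?_, ?_, ?_, ?_⟩
  · exact fun x hx => contDiff_fst.contDiffAt.comp x (hesymm x hx.2)
  · exact fun x hx => (contDiff_fst.comp contDiff_snd).contDiffAt.comp x (hesymm x hx.2)
  · intro x hx hxS
    have h2 := hprod x hx.2
    simp only [P, hN₀ x hx.1 hxS] at h2
    simpa using h2.symm
  · let ι : m × h → m × h × k := fun y => (y.1, y.2, 0)
    have hι : Continuous ι := by fun_prop
    have hPι : ∀ y, P (ι y) = exp (y.1 : 𝔸) * exp (y.2 : 𝔸) := fun y => by simp [P, ι]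
    have hev1 : ∀ᶠ y in 𝓝 (0 : m × h), ι y ∈ e.source :=
      hι.continuousAt.eventually_mem (e.open_source.mem_nhds he0)
    have hev2 : ∀ᶠ y in 𝓝 (0 : m × h), P (ι y) ∈ N₀ := by
      refine (hP.continuous.comp hι).continuousAt.eventually_mem (hN₀o.mem_nhds ?_)
      change P 0 ∈ N₀
      rwa [hP0]
    filter_upwards [hev1, hev2] with y hy1 hy2
    have hs : e.symm (exp (y.1 : 𝔸) * exp (y.2 : 𝔸)) = ι y := by
      rw [← hPι, ← heP]; exact e.left_inv hy1
    refine ⟨⟨hPι y ▸ hy2, ?_⟩, by rw [hs], by rw [hs]⟩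
    rw [← hPι, ← heP]; exact e.map_source hy1

end ExpClosed

end HomogeneousComplex

namespace HomogeneousComplex

open NormedSpace Set Filter

/-! ### The local chart of `G/H` -/

theorem hasDerivAt_mul_exp_smul {𝔸 : Type*} [NormedRing 𝔸] [NormedAlgebra ℝ 𝔸] [CompleteSpace 𝔸]
    (b Y : 𝔸) (t : ℝ) :
    HasDerivAt (fun t : ℝ => b * exp (t • Y)) (b * exp (t • Y) * Y) t :=
  ((hasDerivAt_exp_smul Y t).const_mul b).congr_deriv (mul_assoc _ _ _).symm

theorem isPathIn_mul_exp_smul {𝔹 : Type*} [NormedRing 𝔹] [NormedAlgebra ℂ 𝔹] [CompleteSpace 𝔹]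
    {P : Submodule ℂ 𝔹} {T : Set 𝔹} {b Y : 𝔹} (hY : Y ∈ P)
    (hT : ∀ t ∈ Icc (0 : ℝ) 1, b * exp (t • Y) ∈ T) :
    IsPathIn P T (fun t => b * exp (t • Y)) fun _ => Y :=
  ⟨fun t _ => hasDerivAt_mul_exp_smul b Y t, fun _ _ => hY, continuousOn_const, hT⟩

variable {Γ E 𝔸 𝔹 : Type*} [Group Γ] [TopologicalSpace Γ] [IsTopologicalGroup Γ]
  [NormedAddCommGroup E] [NormedSpace ℂ E] [FiniteDimensional ℂ E]
  [NormedRing 𝔸] [NormedAlgebra ℝ 𝔸] [FiniteDimensional ℝ 𝔸] [CompleteSpace 𝔸]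
  [NormedRing 𝔹] [NormedAlgebra ℂ 𝔹] [FiniteDimensional ℂ 𝔹] [CompleteSpace 𝔹]

/-- A closed linear group `G`, the centralizer `H` of an element `q`, and a splitting
`g ⊗ ℂ = a ⊕ p` with `g ∩ p` the centralizer of `q` in `g` and `g → (g ⊗ ℂ)/p` surjective. -/
structure CosetData (H : Subgroup Γ) (E 𝔸 𝔹 : Type*) [NormedAddCommGroup E] [NormedSpace ℂ E]
    [NormedRing 𝔸] [NormedAlgebra ℝ 𝔸] [CompleteSpace 𝔸] [NormedRing 𝔹] [NormedAlgebra ℂ 𝔹] where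
  J : Γ →* 𝔸
  inducing : Topology.IsInducing J
  inj : Function.Injective J
  closed : ExpClosed (MonoidHom.mrange J)
  ι : 𝔸 →ₐ[ℝ] 𝔹
  q : 𝔸
  mem_H : ∀ k, k ∈ H ↔ J k * q = q * J k
  S : Splitting E 𝔹
  lie_le : ∀ X ∈ closed.lie, ι X ∈ S.s
  exists_real : ∀ z, ∃ X ∈ closed.lie, ι X - S.a z ∈ S.p
  mem_p_iff : ∀ X ∈ closed.lie, (ι X ∈ S.p ↔ X * q = q * X)
  conj_mem_p : ∀ k ∈ H, ∀ X ∈ S.p, ι (J k) * X * ι (J k⁻¹) ∈ S.p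

namespace CosetData

variable {H : Subgroup Γ} (D : CosetData H E 𝔸 𝔹)

/-- The embedding `G → 𝔹`. -/
def JC : Γ →* 𝔹 := (D.ι : 𝔸 →* 𝔹).comp D.J

theorem JC_apply (x : Γ) : D.JC x = D.ι (D.J x) := rfl

/-- `ι` as a continuous linear map. -/
def ιL : 𝔸 →L[ℝ] 𝔹 := LinearMap.toContinuousLinearMap D.ι.toLinearMap

theorem ιL_apply (X : 𝔸) : D.ιL X = D.ι X := rfl

theorem continuous_ι : Continuous D.ι := D.ιL.continuous

theorem continuous_J : Continuous D.J := D.inducing.continuous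

theorem continuous_JC : Continuous D.JC := D.continuous_ι.comp D.continuous_J

theorem ι_exp (X : 𝔸) : D.ι (exp X) = exp (D.ι X) := map_exp' D.ι D.continuous_ι X

@[simp] theorem J_mul_inv (x : Γ) : D.J x * D.J x⁻¹ = 1 := by rw [← map_mul]; simp

@[simp] theorem J_inv_mul (x : Γ) : D.J x⁻¹ * D.J x = 1 := by rw [← map_mul]; simp

@[simp] theorem JC_mul_inv (x : Γ) : D.JC x * D.JC x⁻¹ = 1 := by rw [← map_mul]; simp

@[simp] theorem JC_inv_mul (x : Γ) : D.JC x⁻¹ * D.JC x = 1 := by rw [← map_mul]; simp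

/-- The Lie algebra `h` of `H`. -/
def h : Submodule ℝ 𝔸 where
  carrier := {X | X ∈ D.closed.lie ∧ X * D.q = D.q * X}
  zero_mem' := ⟨Submodule.zero_mem _, by simp⟩
  add_mem' := fun hX hY => ⟨Submodule.add_mem _ hX.1 hY.1, by rw [add_mul, mul_add, hX.2, hY.2]⟩
  smul_mem' := fun a X hX => ⟨Submodule.smul_mem _ a hX.1, by
    rw [smul_mul_assoc, hX.2, mul_smul_comm]⟩

theorem h_le : D.h ≤ D.closed.lie := fun _ hX => hX.1

theorem ι_mem_p {X : 𝔸} (hX : X ∈ D.h) : D.ι X ∈ D.S.p := (D.mem_p_iff X hX.1).2 hX.2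

/-- A complement of `h` in the Lie algebra. -/
def m : Submodule ℝ 𝔸 := Classical.choose D.h.exists_isCompl ⊓ D.closed.lie

theorem m_sup_h : D.m ⊔ D.h = D.closed.lie := by
  have hc := Classical.choose_spec D.h.exists_isCompl
  rw [m, inf_comm, inf_sup_assoc_of_le _ D.h_le, sup_comm, hc.sup_eq_top, inf_top_eq]

theorem disjoint_m_h : Disjoint D.m D.h :=
  (Classical.choose_spec D.h.exists_isCompl).symm.disjoint.mono_left inf_le_left

theorem m_le : D.m ≤ D.closed.lie := inf_le_right

theorem exists_J_eq_exp {X : 𝔸} (hX : X ∈ D.closed.lie) : ∃ x : Γ, D.J x = exp X :=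
  D.closed.exp_mem_of_mem_lie hX

theorem mem_H_of_J_eq_exp {x : Γ} {Y : 𝔸} (hY : Y ∈ D.h) (hx : D.J x = exp Y) : x ∈ H := by
  rw [D.mem_H, hx]
  exact Commute.exp_left (show Commute Y D.q from hY.2)

/-- A chart of `G/H` near the base point, with a section of `G → G/H` over it. -/
structure LocalChart where
  e : OpenPartialHomeomorph (Γ ⧸ H) E
  sec : E → Γ
  nbhd : Set Γ
  isOpen_nbhd : IsOpen nbhd
  one_mem : 1 ∈ nbhd
  sec_mem : ∀ z ∈ e.target, sec z ∈ nbhd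
  mk_sec : ∀ z ∈ e.target, (sec z : Γ ⧸ H) = e.symm z
  contDiffAt_sec : ∀ z ∈ e.target, ContDiffAt ℝ ω (fun z => D.J (sec z)) z
  mem_source : ∀ x ∈ nbhd, (x : Γ ⧸ H) ∈ e.source
  mem_leaf : ∀ x ∈ nbhd, D.JC x ∈ D.S.leaf
  e_eq : ∀ x ∈ nbhd, e x = (D.S.dec.symm (D.JC x)).1
  fiber : ∀ x ∈ nbhd, ∃ Y ∈ D.h, D.J x = D.J (sec (e x)) * exp Y ∧
    ∀ t ∈ Icc (0 : ℝ) 1, D.JC (sec (e x)) * exp (t • D.ι Y) ∈ D.S.dec.target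

/-- `exp c * exp Y` is on the leaf if the path `exp (t c) * exp (t Y)` is in the domain. -/
theorem ι_exp_mul_exp_mem_leaf {c Y : 𝔸} (hc : c ∈ D.closed.lie) (hY : Y ∈ D.closed.lie)
    (hT : ∀ t ∈ Icc (0 : ℝ) 1, D.ι (exp (t • c) * exp (t • Y)) ∈ D.S.dec.target) :
    D.ι (exp c * exp Y) ∈ D.S.leaf := by
  -- The logarithmic derivative of `exp (tc) exp (tY)` is `Ad(exp (-tY)) c + Y`, which lies in `s`.
  -- The path starts at `1`, a point of the leaf.
  have hpath : IsPathIn D.S.s D.S.dec.target (fun t => D.ι (exp (t • c) * exp (t • Y)))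
      fun t => exp (t • -D.ι Y) * D.ι c * exp (t • D.ι Y) + D.ι Y := by
    refine ⟨fun t _ => ?_, fun t _ => D.S.s.add_mem ?_ (D.lie_le Y hY), ?_, hT⟩
    · have h1 : HasDerivAt (fun t : ℝ => exp (t • c) * exp (t • Y))
          (exp (t • c) * exp (t • Y) * (exp (t • -Y) * c * exp (t • Y) + Y)) t := by
        refine ((hasDerivAt_exp_smul c t).mul (hasDerivAt_exp_smul Y t)).congr_deriv ?_
        have : exp (t • Y) * exp (t • -Y) = 1 := by rw [smul_neg, exp_mul_exp_neg]
        rw [mul_add, mul_assoc (exp (t • -Y)), ← mul_assoc _ (exp (t • -Y)),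
          mul_assoc (exp (t • c)) (exp (t • Y)) (exp (t • -Y)), this, mul_one]
        simp only [mul_assoc]
      refine (D.ιL.hasFDerivAt.comp_hasDerivAt t h1).congr_deriv ?_
      simp [ιL_apply, D.ι_exp]
    · have := exp_conj_mem_complex (s := D.S.s) (Y := t • -D.ι Y) (fun X hX => D.S.s_lie _
        ((D.S.s.restrictScalars ℝ).smul_mem t (D.S.s.neg_mem (D.lie_le Y hY))) _ hX) (D.lie_le c hc)
      simpa using this
    · have h1 : ∀ Z : 𝔹, Continuous fun t : ℝ => exp (t • Z) := fun Z =>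
        continuous_exp'.comp (by fun_prop)
      exact ((((h1 _).mul continuous_const).mul (h1 _)).add continuous_const).continuousOn
  have := D.S.mem_leaf_of_isPathIn hpath (by simpa using D.S.one_mem_leaf) 1 (by simp)
  simpa using this

/-- The chart in exponential coordinates on `m`. -/
def psi (c : D.m) : E := (D.S.dec.symm (D.ι (exp (c : 𝔸)))).1

/-- The derivative of `psi` at `0`. -/
def psi' : D.m →L[ℝ] E :=
  (ContinuousLinearMap.fst ℝ E (D.S.p × D.S.w)).comp
    (((D.S.sumEquiv.symm : 𝔹 →L[ℂ] _).restrictScalars ℝ).comp (D.ιL.comp D.m.subtypeL))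

/-- On `s` the first coordinate is reduction modulo `p`; this and the next lemma express that
without forming a quotient. -/
theorem sumEquiv_symm_fst {X : 𝔹} (hX : X ∈ D.S.s) : D.S.a (D.S.sumEquiv.symm X).1 - X ∈ D.S.p := by
  obtain ⟨_, ⟨z, rfl⟩, y, hy, rfl⟩ := Submodule.mem_sup.1 hX
  have h1 := D.S.sumEquiv_symm_a z
  have h2 := D.S.sumEquiv_symm_p ⟨y, hy⟩
  simp only at h2
  rw [map_add]
  simp [h1, h2, hy]

theorem sumEquiv_symm_fst_eq {X : 𝔹} {z : E} (hX : X - D.S.a z ∈ D.S.p) :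
    (D.S.sumEquiv.symm X).1 = z := by
  have h1 := D.S.sumEquiv_symm_a z
  have h2 := D.S.sumEquiv_symm_p ⟨_, hX⟩
  simp only [map_sub, h1] at h2
  have := congrArg Prod.fst h2
  simpa [sub_eq_zero] using this

/-- The map is `m → s/p`. A vector in the kernel lies in `p`, so it commutes with `q` and belongs to
`m ∩ h = 0`. Surjectivity is `exists_real`, after dropping the `h`-component, which `ι` sends into
`p`. -/
theorem psi'_bijective : Function.Bijective D.psi' := by
  have happ : ∀ c : D.m, D.psi' c = (D.S.sumEquiv.symm (D.ι (c : 𝔸))).1 := fun c => rfl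
  constructor
  · refine (injective_iff_map_eq_zero _).2 fun c hc => ?_
    rw [happ] at hc
    have h1 := D.sumEquiv_symm_fst (D.lie_le c (D.m_le c.2))
    rw [hc, map_zero, zero_sub, neg_mem_iff] at h1
    exact Subtype.ext (Submodule.disjoint_def.1 D.disjoint_m_h _ c.2
      ⟨D.m_le c.2, (D.mem_p_iff _ (D.m_le c.2)).1 h1⟩)
  · intro z
    obtain ⟨X, hX, hXz⟩ := D.exists_real z
    rw [← D.m_sup_h] at hX
    obtain ⟨c, hc, Y, hY, rfl⟩ := Submodule.mem_sup.1 hX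
    refine ⟨⟨c, hc⟩, ?_⟩
    rw [happ]
    refine D.sumEquiv_symm_fst_eq ?_
    have := D.S.p.sub_mem hXz (D.ι_mem_p hY)
    rwa [map_add, add_sub_right_comm, add_sub_cancel_right] at this

theorem exists_psi_chart : ∃ e : OpenPartialHomeomorph D.m E, 0 ∈ e.source ∧
    (∀ c, e c = D.psi c) ∧ ∀ z ∈ e.target, ContDiffAt ℝ ω e.symm z := by
  have hι : ContDiff ℝ ω (fun c : D.m => D.ι (exp (c : 𝔸))) :=
    D.ιL.contDiff.comp ((contDiff_exp ℝ).comp D.m.subtypeL.contDiff)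
  have h0 : D.ι (exp ((0 : D.m) : 𝔸)) = 1 := by simp
  have hdec : ContDiffAt ℝ ω D.S.dec.symm (D.ι (exp ((0 : D.m) : 𝔸))) := by
    rw [h0]
    exact (D.S.contDiffAt_dec_symm D.S.one_mem_dec_target).restrict_scalars ℝ
  have hpsi : ContDiffAt ℝ ω D.psi 0 :=
    contDiff_fst.contDiffAt.comp (0 : D.m) (hdec.comp (0 : D.m) hι.contDiffAt)
  let L : D.m ≃L[ℝ] E :=
    letI : FiniteDimensional ℝ E := FiniteDimensional.complexToReal E
    (LinearEquiv.ofBijective (D.psi' : D.m →ₗ[ℝ] E) D.psi'_bijective).toContinuousLinearEquiv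
  have hL : (L : D.m →L[ℝ] E) = D.psi' := ContinuousLinearMap.ext fun _ => rfl
  have hd : HasFDerivAt D.psi (L : D.m →L[ℝ] E) 0 := by
    rw [hL]
    have h1 : HasFDerivAt (fun c : D.m => exp (c : 𝔸)) D.m.subtypeL 0 := by
      have : HasFDerivAt (exp : 𝔸 → 𝔸) (1 : 𝔸 →L[ℝ] 𝔸) (D.m.subtypeL 0) := by
        rw [map_zero]; exact hasFDerivAt_exp_zero (𝕂 := ℝ)
      exact this.comp (0 : D.m) D.m.subtypeL.hasFDerivAt
    have h2 : HasFDerivAt D.S.dec.symm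
        ((D.S.sumEquiv.symm : 𝔹 →L[ℂ] E × D.S.p × D.S.w).restrictScalars ℝ)
        (D.ι (exp ((0 : D.m) : 𝔸))) := by
      rw [h0, ← D.S.fderiv_dec_symm_one]
      exact (D.S.hasFDerivAt_dec_symm D.S.one_mem_dec_target).restrictScalars ℝ
    exact hasFDerivAt_fst.comp (0 : D.m) (h2.comp (0 : D.m) (D.ιL.hasFDerivAt.comp (0 : D.m) h1))
  haveI : CompleteSpace D.m := FiniteDimensional.complete ℝ D.m
  obtain ⟨e, h1, h2, -, h4, -⟩ := exists_openPartialHomeomorph hpsi hd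
  exact ⟨e, h1, h2, h4⟩

/-- `c ↦ exp c q exp (-c)` is injective on a neighbourhood of `0` in `m`. -/
theorem exists_injOn_conj : ∃ U : Set D.m, IsOpen U ∧ 0 ∈ U ∧
    InjOn (fun c : D.m => exp (c : 𝔸) * D.q * exp (-(c : 𝔸))) U := by
  let A : D.m →L[ℝ] 𝔸 := ((ContinuousLinearMap.mul ℝ 𝔸).flip D.q -
    ContinuousLinearMap.mul ℝ 𝔸 D.q).comp D.m.subtypeL
  have hA : ∀ c : D.m, A c = c * D.q - D.q * c := fun c => rfl
  have hinj : LinearMap.ker (A : D.m →ₗ[ℝ] 𝔸) = ⊥ := by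
    refine (Submodule.eq_bot_iff _).2 fun c hc => ?_
    have : (c : 𝔸) * D.q - D.q * c = 0 := hc
    exact Subtype.ext (Submodule.disjoint_def.1 D.disjoint_m_h _ c.2
      ⟨D.m_le c.2, sub_eq_zero.1 this⟩)
  -- `A` is the derivative `c ↦ [c, q]` of the conjugation map at `0`, injective since `m ∩ h = 0`.
  -- Composing with a left inverse of `A` reduces local injectivity to the inverse function theorem.
  obtain ⟨B, hB⟩ := LinearMap.exists_leftInverse_of_injective (A : D.m →ₗ[ℝ] 𝔸) hinj
  let BL : 𝔸 →L[ℝ] D.m := LinearMap.toContinuousLinearMap B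
  let R : D.m → 𝔸 := fun c => exp (c : 𝔸) * D.q * exp (-(c : 𝔸))
  have hR : ContDiff ℝ ω R := (((contDiff_exp ℝ).comp D.m.subtypeL.contDiff).mul
    contDiff_const).mul ((contDiff_exp ℝ).comp D.m.subtypeL.contDiff.neg)
  have he : ∀ T : D.m →L[ℝ] 𝔸, HasFDerivAt (fun c => exp (T c)) T 0 := fun T => by
    have : HasFDerivAt (exp : 𝔸 → 𝔸) (1 : 𝔸 →L[ℝ] 𝔸) (T 0) := by
      rw [map_zero]; exact hasFDerivAt_exp_zero (𝕂 := ℝ)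
    exact this.comp (0 : D.m) T.hasFDerivAt
  have hRd : HasFDerivAt R A 0 := by
    have h := ((he D.m.subtypeL).mul' (hasFDerivAt_const D.q (0 : D.m))).mul' (he (-D.m.subtypeL))
    refine h.congr_fderiv (ContinuousLinearMap.ext fun c => ?_)
    rw [hA]
    simp
    abel
  have hd : HasFDerivAt (fun c => BL (R c))
      ((ContinuousLinearEquiv.refl ℝ D.m : D.m ≃L[ℝ] D.m) : D.m →L[ℝ] D.m) 0 := by
    refine (BL.hasFDerivAt.comp (0 : D.m) hRd).congr_fderiv (ContinuousLinearMap.ext fun c => ?_)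
    exact LinearMap.congr_fun hB c
  haveI : CompleteSpace D.m := FiniteDimensional.complete ℝ D.m
  obtain ⟨e, h1, h2, -⟩ := exists_openPartialHomeomorph (BL.contDiff.comp hR).contDiffAt hd
  refine ⟨e.source, e.open_source, h1, fun c hc c' hc' hcc => e.injOn hc hc' ?_⟩
  rw [h2, h2]
  exact congrArg BL hcc

/-- Near `1` every element of `G` is `exp c exp Y` with `c ∈ m` and `Y ∈ h`. Its coset is that of
`exp c`, and its first leaf coordinate is `psi c`. So `z ↦ exp (psi⁻¹ z) H` inverts the chart; it
remains to see that this map is injective, continuous and open. -/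
theorem exists_localChart : Nonempty D.LocalChart := by
  obtain ⟨N, f, g, hNo, h1N, hf1, hg1, hfc, hgc, hfg, hev⟩ :=
    D.closed.exists_local_product D.m_sup_h D.disjoint_m_h
  obtain ⟨ep, hp0, hpe, hpc⟩ := D.exists_psi_chart
  obtain ⟨U, hUo, h0U, hUinj⟩ := D.exists_injOn_conj
  choose σ hσ using fun c : D.m => D.exists_J_eq_exp (D.m_le c.2)
  have hexp : Continuous fun y : D.m × D.h => exp (y.1 : 𝔸) * exp (y.2 : 𝔸) :=
    (continuous_exp'.comp (by fun_prop)).mul (continuous_exp'.comp (by fun_prop))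
  have hev2 : ∀ᶠ y : D.m × D.h in 𝓝 0,
      D.ι (exp (y.1 : 𝔸) * exp (y.2 : 𝔸)) ∈ D.S.dec.target := by
    refine (D.continuous_ι.comp hexp).continuousAt.eventually_mem
      (D.S.dec.open_target.mem_nhds ?_)
    simpa using D.S.one_mem_dec_target
  -- On a ball the product coordinates are exact and the products lie in the domain of `dec`. Balls
  -- around `0` are star-shaped, so this also holds along the scaling paths used below.
  obtain ⟨r, hr, hball⟩ := Metric.eventually_nhds_iff_ball.1 (hev.and hev2)
  have hb : ∀ (c : D.m) (Y : D.h), c ∈ Metric.ball 0 r → Y ∈ Metric.ball 0 r → ∀ t ∈ Icc (0 : ℝ) 1,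
      ∀ τ ∈ Icc (0 : ℝ) 1, ((t • c, τ • Y) : D.m × D.h) ∈ Metric.ball (0 : D.m × D.h) r := by
    intro c Y hc hY t ht τ hτ
    rw [mem_ball_zero_iff] at hc hY ⊢
    refine max_lt ?_ ?_
    · rw [norm_smul, Real.norm_of_nonneg ht.1]
      exact (mul_le_of_le_one_left (norm_nonneg _) ht.2).trans_lt hc
    · rw [norm_smul, Real.norm_of_nonneg hτ.1]
      exact (mul_le_of_le_one_left (norm_nonneg _) hτ.2).trans_lt hY
  have hleaf : ∀ (c : D.m) (Y : D.h), c ∈ Metric.ball 0 r → Y ∈ Metric.ball 0 r →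
      D.ι (exp (c : 𝔸) * exp (Y : 𝔸)) ∈ D.S.leaf := fun c Y hc hY =>
    D.ι_exp_mul_exp_mem_leaf (D.m_le c.2) (D.h_le Y.2) fun t ht =>
      (hball _ (hb c Y hc hY t ht t ht)).2
  have h0r : ∀ {F : Type _} [NormedAddCommGroup F], (0 : F) ∈ Metric.ball (0 : F) r :=
    fun {F} _ => Metric.mem_ball_self hr
  let B : Set D.m := ep.source ∩ (Metric.ball 0 r ∩ U)
  have hBo : IsOpen B := ep.open_source.inter (Metric.isOpen_ball.inter hUo)
  have h0B : (0 : D.m) ∈ B := ⟨hp0, h0r, h0U⟩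
  let V : Set E := ep.target ∩ ep.symm ⁻¹' B
  have hVo : IsOpen V := ep.isOpen_inter_preimage_symm hBo
  let sec : E → Γ := fun z => σ (ep.symm z)
  have hsecJ : ∀ z, D.J (sec z) = exp (ep.symm z : 𝔸) := fun z => hσ _
  have hsecc : ∀ z ∈ V, ContDiffAt ℝ ω (fun z => D.J (sec z)) z := fun z hz => by
    simp only [hsecJ]
    exact ((contDiff_exp ℝ).comp D.m.subtypeL.contDiff).contDiffAt.comp z (hpc z hz.1)
  -- The elements `exp c exp Y` of `G` with `c ∈ B` and `Y` small.
  let nb : Set Γ := D.J ⁻¹' (N ∩ (fun u => (f u, g u)) ⁻¹' (B ×ˢ Metric.ball 0 r))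
  have hfgc : ContinuousOn (fun u => (f u, g u)) N := fun u hu =>
    ((hfc u hu).continuousAt.prodMk (hgc u hu).continuousAt).continuousWithinAt
  have hnbo : IsOpen nb := (hfgc.isOpen_inter_preimage hNo
    (hBo.prod Metric.isOpen_ball)).preimage D.continuous_J
  have h1nb : (1 : Γ) ∈ nb := by
    refine ⟨by simpa using h1N, ?_, ?_⟩
    · simpa [hf1] using h0B
    · simpa [hg1] using hr
  have hB0 : ∀ c ∈ B, exp (c : 𝔸) ∈ N ∧ f (exp (c : 𝔸)) = c ∧ g (exp (c : 𝔸)) = 0 := by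
    intro c hc
    have := (hball _ (hb c 0 hc.2.1 h0r 1 (by simp) 1 (by simp))).1
    simpa using this
  have hsecnb : ∀ z ∈ V, sec z ∈ nb := by
    intro z hz
    obtain ⟨h1, h2, h3⟩ := hB0 _ hz.2
    change D.J (sec z) ∈ N ∩ _
    rw [hsecJ]
    refine ⟨h1, ?_, ?_⟩
    · change f _ ∈ B; rw [h2]; exact hz.2
    · change g _ ∈ _; rw [h3]; exact h0r
  let s : E → Γ ⧸ H := fun z => (sec z : Γ ⧸ H)
  -- Elements of `H` commute with `q`, so the coset of `exp c` determines `exp c q exp (-c)`, and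
  -- this determines `c` in `U`.
  have hsinj : InjOn s V := by
    intro z hz z' hz' hzz
    have hk : (sec z)⁻¹ * sec z' ∈ H := QuotientGroup.eq.1 hzz
    rw [D.mem_H] at hk
    have hinv : ∀ z, D.J (sec z)⁻¹ = exp (-(ep.symm z : 𝔸)) := fun z => by
      have h1 := D.J_inv_mul (sec z)
      rw [hsecJ] at h1
      calc D.J (sec z)⁻¹ = D.J (sec z)⁻¹ * (exp (ep.symm z : 𝔸) * exp (-(ep.symm z : 𝔸))) := by
            rw [exp_mul_exp_neg, mul_one]
        _ = _ := by rw [← mul_assoc, h1, one_mul]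
    have hc : ep.symm z = ep.symm z' := by
      refine hUinj hz.2.2.2 hz'.2.2.2 ?_
      simp only
      rw [← hinv, ← hinv, ← hsecJ, ← hsecJ]
      rw [map_mul] at hk
      have h2 := congrArg (fun u => D.J (sec z) * u * D.J (sec z')⁻¹) hk
      simp only [mul_assoc] at h2
      rw [J_mul_inv, mul_one, ← mul_assoc (D.J (sec z)) (D.J (sec z)⁻¹), J_mul_inv, one_mul] at h2
      rw [mul_assoc, ← h2]
      simp only [mul_assoc]
    rw [← ep.right_inv hz.1, ← ep.right_inv hz'.1, hc]
  have hnb : ∀ x ∈ nb, ep (f (D.J x)) ∈ V ∧ (x : Γ ⧸ H) = s (ep (f (D.J x))) ∧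
      D.J x = D.J (sec (ep (f (D.J x)))) * exp (g (D.J x) : 𝔸) := by
    intro x hx
    have hxs : f (D.J x) ∈ ep.source := hx.2.1.1
    have hJ : D.J (sec (ep (f (D.J x)))) = exp (f (D.J x) : 𝔸) := by
      rw [hsecJ, ep.left_inv hxs]
    have hJx := hfg _ hx.1 ⟨x, rfl⟩
    rw [← hJ] at hJx
    refine ⟨⟨ep.map_source hxs, ?_⟩, ?_, hJx⟩
    · change ep.symm _ ∈ B
      rw [ep.left_inv hxs]; exact hx.2.1
    · refine (QuotientGroup.eq.2 (D.mem_H_of_J_eq_exp (g (D.J x)).2 ?_)).symm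
      rw [map_mul]
      nth_rewrite 2 [hJx]
      rw [← mul_assoc, J_inv_mul, one_mul]
  have hscont : ContinuousOn s V := by
    have : ContinuousOn sec V := D.inducing.continuousOn_iff.2 fun z hz =>
      (hsecc z hz).continuousAt.continuousWithinAt
    exact continuous_quotient_mk'.comp_continuousOn this
  -- Images under `s` are images of open subsets of `nb` under the quotient map `G → G/H`, which is
  -- open.
  have hsopen : IsOpenMap (V.domRestrict s) := by
    intro O hO
    obtain ⟨O', hO', rfl⟩ := isOpen_induced_iff.1 hO
    have himg : V.domRestrict s '' (Subtype.val ⁻¹' O') =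
        (fun x : Γ => (x : Γ ⧸ H)) '' (nb ∩ (fun x => ep (f (D.J x))) ⁻¹' O') := by
      ext y
      constructor
      · rintro ⟨⟨z, hz⟩, hzO, rfl⟩
        refine ⟨sec z, ⟨hsecnb z hz, ?_⟩, rfl⟩
        change ep (f (D.J (sec z))) ∈ O'
        rw [hsecJ, (hB0 _ hz.2).2.1, ep.right_inv hz.1]
        exact hzO
      · rintro ⟨x, ⟨hx, hxO⟩, rfl⟩
        exact ⟨⟨_, (hnb x hx).1⟩, hxO, (hnb x hx).2.1.symm⟩
    rw [himg]
    refine QuotientGroup.isOpenMap_coe _ (ContinuousOn.isOpen_inter_preimage ?_ hnbo hO')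
    refine ep.continuousOn.comp (t := ep.source) (fun x hx => ?_) fun x hx => hx.2.1.1
    exact ((hfc _ hx.1).continuousAt.comp D.continuous_J.continuousAt).continuousWithinAt
  let e' : OpenPartialHomeomorph E (Γ ⧸ H) :=
    OpenPartialHomeomorph.ofContinuousOpenRestrict (hsinj.toPartialEquiv s V) hscont hsopen hVo
  have he' : ∀ z, e' z = s z := fun z => rfl
  have hsource : e'.source = V := rfl
  have he'x : ∀ x ∈ nb, e'.symm (x : Γ ⧸ H) = ep (f (D.J x)) := fun x hx => by
    rw [(hnb x hx).2.1, ← he']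
    exact e'.left_inv (hnb x hx).1
  refine ⟨⟨e'.symm, sec, nb, hnbo, h1nb, hsecnb, fun z hz => rfl, hsecc, fun x hx => ?_,
    fun x hx => ?_, fun x hx => ?_, fun x hx => ⟨g (D.J x), (g (D.J x)).2, ?_, fun t ht => ?_⟩⟩⟩
  · rw [(hnb x hx).2.1, ← he']; exact e'.map_source (hnb x hx).1
  · rw [JC_apply, hfg _ hx.1 ⟨x, rfl⟩]
    exact hleaf _ _ hx.2.1.2.1 hx.2.2
  · have hxs : f (D.J x) ∈ ep.source := hx.2.1.1
    have hxp : ∀ t ∈ Icc (0 : ℝ) 1, exp (D.ι (f (D.J x))) * exp (t • D.ι (g (D.J x))) ∈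
        D.S.dec.target := fun t ht => by
      have := (hball _ (hb _ _ hx.2.1.2.1 hx.2.2 1 (by simp) t ht)).2
      simpa [D.ι_exp] using this
    have h0 : exp (D.ι (f (D.J x))) * exp ((0 : ℝ) • D.ι (g (D.J x))) ∈ D.S.leaf := by
      have := hleaf (f (D.J x)) 0 hx.2.1.2.1 h0r
      simpa [D.ι_exp] using this
    -- The factor `exp (tY)` moves in a direction of `p`, so it does not change the first
    -- coordinate.
    have h2 := D.S.dec_symm_fst_eq_of_isPathIn (isPathIn_mul_exp_smul
      (D.ι_mem_p (g (D.J x)).2) hxp) h0 (t := 1) (by simp)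
    rw [he'x x hx, hpe, psi, JC_apply]
    nth_rewrite 2 [hfg _ hx.1 ⟨x, rfl⟩]
    simpa [D.ι_exp] using h2.symm
  · rw [he'x x hx]; exact (hnb x hx).2.2
  · rw [he'x x hx, JC_apply, hsecJ, ep.left_inv hx.2.1.1]
    have := (hball _ (hb _ _ hx.2.1.2.1 hx.2.2 1 (by simp) t ht)).2
    simpa [D.ι_exp] using this

end CosetData

end HomogeneousComplex

namespace HomogeneousComplex

open NormedSpace Set Filter

/-! ### Holomorphic dependence on the point of `G/H` -/

set_option synthInstance.maxHeartbeats 200000 in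
theorem hasDerivAt_ringInverse_comp {R : Type*} [NormedRing R] [NormedAlgebra ℝ R]
    [CompleteSpace R] {B : ℝ → R} {B' : R} {t : ℝ} {v : Rˣ} (hB : HasDerivAt B B' t)
    (hv : B t = v) :
    HasDerivAt (fun t => Ring.inverse (B t)) (-(↑v⁻¹ * B' * ↑v⁻¹)) t := by
  have h := hasFDerivAt_ringInverse (𝕜 := ℝ) v
  rw [← hv] at h
  exact (h.comp_hasDerivAt t hB).congr_deriv (by simp)

variable {Γ E 𝔸 𝔹 : Type*} [Group Γ] [TopologicalSpace Γ] [IsTopologicalGroup Γ]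
  [NormedAddCommGroup E] [NormedSpace ℂ E] [FiniteDimensional ℂ E]
  [NormedRing 𝔸] [NormedAlgebra ℝ 𝔸] [FiniteDimensional ℝ 𝔸] [CompleteSpace 𝔸]
  [NormedRing 𝔹] [NormedAlgebra ℂ 𝔹] [FiniteDimensional ℂ 𝔹] [CompleteSpace 𝔹]

namespace CosetData

variable {H : Subgroup Γ} (D : CosetData H E 𝔸 𝔹)

/-- Translates of paths tangent to `p`. -/
theorem isPathIn_translate {T : Set 𝔹} (g : Γ) {k : Γ} (hk : k ∈ H) {c X : ℝ → 𝔹}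
    (hc : IsPathIn D.S.p {u | D.JC g * u * D.JC k⁻¹ ∈ T} c X) :
    IsPathIn D.S.p T (fun t => D.JC g * c t * D.JC k⁻¹) fun t => D.JC k * X t * D.JC k⁻¹ := by
  refine ⟨fun t ht => ?_, fun t ht => D.conj_mem_p k hk _ (hc.mem t ht), ?_, hc.maps⟩
  · refine (((hc.deriv t ht).const_mul _).mul_const _).congr_deriv ?_
    have := D.JC_inv_mul k
    calc D.JC g * (c t * X t) * D.JC k⁻¹ = D.JC g * c t * 1 * X t * D.JC k⁻¹ := by
          simp only [mul_assoc, one_mul]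
      _ = _ := by rw [← this]; simp only [mul_assoc]
  · exact (continuousOn_const.mul hc.cont).mul continuousOn_const

namespace LocalChart

variable {D} (C : D.LocalChart)

theorem e_sec {z : E} (hz : z ∈ C.e.target) : C.e (C.sec z : Γ ⧸ H) = z := by
  rw [C.mk_sec z hz]; exact C.e.right_inv hz

theorem one_mem_source : ((1 : Γ) : Γ ⧸ H) ∈ C.e.source := C.mem_source 1 C.one_mem

/-- The element of `H` by which `x` differs from the section. -/
def fac (x : Γ) : Γ := (C.sec (C.e (x : Γ ⧸ H)))⁻¹ * x

theorem fac_mem {x : Γ} (hx : (x : Γ ⧸ H) ∈ C.e.source) : C.fac x ∈ H := by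
  refine QuotientGroup.eq.1 ?_
  rw [C.mk_sec _ (C.e.map_source hx)]
  exact C.e.left_inv hx

theorem mul_fac_inv (x : Γ) : x * (C.fac x)⁻¹ = C.sec (C.e (x : Γ ⧸ H)) := by
  simp [fac]

theorem mul_fac_inv_mem {x : Γ} (hx : (x : Γ ⧸ H) ∈ C.e.source) : x * (C.fac x)⁻¹ ∈ C.nbhd := by
  rw [mul_fac_inv]; exact C.sec_mem _ (C.e.map_source hx)

theorem mk_mul_mem (x : Γ) {k : Γ} (hk : k ∈ H) : ((x * k : Γ) : Γ ⧸ H) = x :=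
  QuotientGroup.eq.2 (by simpa using hk)

/-- The coset does not see right multiplication by `k⁻¹`. With `k` fixed, this gives a formula for
the chart that is smooth in `x` near a point of the source far from `1`. -/
theorem e_eq_of_mem {x k : Γ} (hk : k ∈ H) (hx : x * k⁻¹ ∈ C.nbhd) :
    C.e (x : Γ ⧸ H) = (D.S.dec.symm (D.JC (x * k⁻¹))).1 := by
  rw [← C.e_eq _ hx, mk_mul_mem x (H.inv_mem hk)]

theorem continuousAt_sec {z : E} (hz : z ∈ C.e.target) : ContinuousAt C.sec z :=
  D.inducing.continuousAt_iff.2 (C.contDiffAt_sec z hz).continuousAt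

theorem continuousAt_JC_sec {z : E} (hz : z ∈ C.e.target) :
    ContinuousAt (fun z => D.JC (C.sec z)) z :=
  D.continuous_JC.continuousAt.comp (C.continuousAt_sec hz)

/-- A holomorphic section of the first coordinate of the splitting through `JC (sec z₀)`. -/
def hol (z₀ z : E) : 𝔹 :=
  exp (D.S.a z) * exp ((D.S.dec.symm (D.JC (C.sec z₀))).2.1 : 𝔹)

theorem contDiff_hol (z₀ : E) : ContDiff ℂ ω (C.hol z₀) :=
  ((contDiff_exp ℂ).comp D.S.a.contDiff).mul contDiff_const

theorem JC_sec_eq {z : E} (hz : z ∈ C.e.target) : D.JC (C.sec z) =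
    exp (D.S.a z) * exp ((D.S.dec.symm (D.JC (C.sec z))).2.1 : 𝔹) := by
  have h1 := D.S.eq_of_mem_leaf (C.mem_leaf _ (C.sec_mem z hz))
  rwa [← C.e_eq _ (C.sec_mem z hz), C.e_sec hz] at h1

theorem hol_self {z : E} (hz : z ∈ C.e.target) : C.hol z z = D.JC (C.sec z) := (C.JC_sec_eq hz).symm

/-- A function which is constant along paths tangent to `p` takes the same values at the section
`sec z` and at the holomorphic section `hol z`. -/
theorem eventually_eq_hol {F : Type*} {z₀ : E} (hz₀ : z₀ ∈ C.e.target) {O : Set 𝔹}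
    (hO : O ∈ 𝓝 (D.JC (C.sec z₀))) {f : 𝔹 → F}
    (hf : ∀ᶠ z in 𝓝 z₀, ∀ c X, IsPathIn D.S.p O c X → c 0 = D.JC (C.sec z) → f (c 0) = f (c 1)) :
    ∀ᶠ z in 𝓝 z₀, f (D.JC (C.sec z)) = f (C.hol z₀ z) := by
  set Y : E → D.S.p := fun z => (D.S.dec.symm (D.JC (C.sec z))).2.1 with hY
  have hYc : ContinuousAt Y z₀ := by
    have h1 : ContinuousAt D.S.dec.symm (D.JC (C.sec z₀)) :=
      (D.S.contDiffAt_dec_symm (C.mem_leaf _ (C.sec_mem z₀ hz₀)).1).continuousAt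
    have h2 : ContinuousAt (fun z => D.S.dec.symm (D.JC (C.sec z))) z₀ :=
      ContinuousAt.comp (f := fun z => D.JC (C.sec z)) h1 (C.continuousAt_JC_sec hz₀)
    exact h2.snd.fst
  let P : E × D.S.p → 𝔹 := fun v => exp (D.S.a v.1) * exp (v.2 : 𝔹)
  have hP : Continuous P := (continuous_exp'.comp (by fun_prop)).mul
    (continuous_exp'.comp (by fun_prop))
  have hP0 : P (z₀, Y z₀) = D.JC (C.sec z₀) := (C.JC_sec_eq hz₀).symm
  have hev : ∀ᶠ v in 𝓝 (z₀, Y z₀), P v ∈ O := hP.continuousAt.eventually_mem (by rwa [hP0])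
  obtain ⟨r, hr, hball⟩ := Metric.eventually_nhds_iff_ball.1 hev
  filter_upwards [hf, C.e.open_target.mem_nhds hz₀, Metric.ball_mem_nhds z₀ hr,
    hYc.eventually_mem (Metric.ball_mem_nhds _ hr)] with z hz1 hz2 hz3 hz4
  -- The segment in `p` from the `p`-coordinate of `sec z` to that of `sec z₀`. The path `exp (a z)
  -- exp (W t)` is tangent to `p` and joins `JC (sec z)` to `hol z₀ z`; convexity of the ball keeps
  -- it inside `O`.
  let W : ℝ → 𝔹 := fun t => (Y z : 𝔹) + t • ((Y z₀ : 𝔹) - Y z)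
  have hW : ∀ t, W t ∈ D.S.p := fun t => D.S.p.add_mem (Y z).2
    ((D.S.p.restrictScalars ℝ).smul_mem t (D.S.p.sub_mem (Y z₀).2 (Y z).2))
  have hWc : Continuous W := by fun_prop
  have hWd : ∀ t, HasDerivAt W ((Y z₀ : 𝔹) - Y z) t := fun t =>
    (((hasDerivAt_id t).smul_const ((Y z₀ : 𝔹) - Y z)).const_add (Y z : 𝔹)).congr_deriv
      (one_smul _ _)
  have hpath : IsPathIn D.S.p O (fun t => exp (D.S.a z) * exp (W t))
      fun t => exp (-W t) * fderiv ℂ exp (W t) ((Y z₀ : 𝔹) - Y z) := by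
    refine ⟨fun t _ => ?_, fun t _ => exp_neg_mul_fderiv_exp_mem_complex D.S.p_lie (hW t)
      (D.S.p.sub_mem (Y z₀).2 (Y z).2), ?_, fun t ht => ?_⟩
    · refine ((((hasFDerivAt_exp_complex (W t)).restrictScalars ℝ).comp_hasDerivAt t
        (hWd t)).const_mul (exp (D.S.a z))).congr_deriv ?_
      rw [mul_assoc, ← mul_assoc (exp (W t)), exp_mul_exp_neg, one_mul]
      rfl
    · refine Continuous.continuousOn ((continuous_exp'.comp hWc.neg).mul ?_)
      exact (((contDiff_exp ℂ (n := 1)).continuous_fderiv one_ne_zero).comp hWc).clm_apply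
        continuous_const
    · have hmem : (Y z) + t • (Y z₀ - Y z) ∈ Metric.ball (Y z₀) r := by
        have := (convex_ball (Y z₀) r).add_smul_sub_mem hz4 (Metric.mem_ball_self hr) ht
        exact this
      have := hball (z, (Y z) + t • (Y z₀ - Y z)) (by
        rw [Metric.mem_ball] at hz3 hmem ⊢
        exact max_lt hz3 hmem)
      exact this
  have h0 : exp (D.S.a z) * exp (W 0) = D.JC (C.sec z) := by
    rw [C.JC_sec_eq hz2]
    simp [W, hY]
  have := hz1 _ _ hpath h0
  rw [h0] at this
  rw [this]
  simp [W, hol, hY]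

/-- The coordinate changes of the translates of the chart are holomorphic. -/
theorem contDiffAt_transition (g : Γ) {z₀ : E} (hz₀ : z₀ ∈ C.e.target)
    (hg : g • C.e.symm z₀ ∈ C.e.source) :
    ContDiffAt ℂ ω (fun z => C.e (g • C.e.symm z)) z₀ := by
  rw [← C.mk_sec z₀ hz₀] at hg
  -- The factor in `H` is frozen at `z₀`; by continuity it still brings `g sec z` into `nbhd` for
  -- nearby `z`.
  set k := C.fac (g * C.sec z₀) with hk
  have hkH : k ∈ H := C.fac_mem hg
  have hmem : g * C.sec z₀ * k⁻¹ ∈ C.nbhd := C.mul_fac_inv_mem hg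
  have hcont : ContinuousAt (fun z => g * C.sec z * k⁻¹) z₀ :=
    (continuousAt_const.mul (C.continuousAt_sec hz₀)).mul continuousAt_const
  have hnb : ∀ᶠ z in 𝓝 z₀, g * C.sec z * k⁻¹ ∈ C.nbhd :=
    hcont.eventually_mem (C.isOpen_nbhd.mem_nhds hmem)
  let τ : 𝔹 → 𝔹 := fun u => D.JC g * u * D.JC k⁻¹
  have hτ : ∀ x, τ (D.JC x) = D.JC (g * x * k⁻¹) := fun x => by simp [τ]
  have hτc : ContDiff ℂ ω τ := (contDiff_const.mul contDiff_id).mul contDiff_const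
  have hτt : τ (D.JC (C.sec z₀)) ∈ D.S.dec.target := by
    rw [hτ]; exact (C.mem_leaf _ hmem).1
  -- This function is holomorphic near `JC (sec z₀)` and is constant along paths tangent to `p` that
  -- start at `JC (sec z)` for `z` near `z₀`, so the non-holomorphic section may be replaced by
  -- `hol`.
  let f : 𝔹 → E := fun u => (D.S.dec.symm (τ u)).1
  have hO : {u | τ u ∈ D.S.dec.target} ∈ 𝓝 (D.JC (C.sec z₀)) :=
    hτc.continuous.continuousAt.eventually_mem (D.S.dec.open_target.mem_nhds hτt)
  have hev := C.eventually_eq_hol hz₀ hO (f := f) (by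
    filter_upwards [hnb] with z hz c X hc hc0
    have hp := D.isPathIn_translate g hkH hc
    have h0 : D.JC g * c 0 * D.JC k⁻¹ ∈ D.S.leaf := by
      rw [hc0]; exact (congrArg (· ∈ D.S.leaf) (hτ (C.sec z))).mpr (C.mem_leaf _ hz)
    exact (D.S.dec_symm_fst_eq_of_isPathIn hp h0 (t := 1) (by simp)).symm)
  have hfc : ContDiffAt ℂ ω (fun z => f (C.hol z₀ z)) z₀ := by
    have h1 : ContDiffAt ℂ ω D.S.dec.symm (τ (C.hol z₀ z₀)) := by
      rw [C.hol_self hz₀]; exact D.S.contDiffAt_dec_symm hτt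
    exact contDiff_fst.contDiffAt.comp z₀
      (ContDiffAt.comp (f := fun z => τ (C.hol z₀ z)) z₀ h1
        (hτc.comp (C.contDiff_hol z₀)).contDiffAt)
  refine hfc.congr_of_eventuallyEq ?_
  filter_upwards [hev, hnb, C.e.open_target.mem_nhds hz₀] with z h1 h2 h3
  rw [← h1, ← C.mk_sec z h3]
  change C.e ((g * C.sec z : Γ) : Γ ⧸ H) = _
  rw [C.e_eq_of_mem hkH h2, ← hτ]

end LocalChart

/-- A representation of `H` on (the endomorphism algebra) `𝔻`, with an extension `lam` of its
differential to `p`. -/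
structure RepData (𝔻 : Type*) [NormedRing 𝔻] [NormedAlgebra ℂ 𝔻] [CompleteSpace 𝔻] where
  rho : H →* 𝔻
  lam : D.S.p →ₗ[ℂ] 𝔻
  map_lie : ∀ X Y : D.S.p, lam ⟨X * Y - Y * X, D.S.p_lie X X.2 Y Y.2⟩ = lam X * lam Y - lam Y * lam X
  rho_eq : ∀ (k : H) (Y : 𝔸) (hY : Y ∈ D.h), D.J k = exp Y → rho k = exp (lam ⟨D.ι Y, D.ι_mem_p hY⟩)
  lam_conj : ∀ (k : H) (X : D.S.p),
    lam ⟨D.JC k * X * D.JC (k : Γ)⁻¹, D.conj_mem_p k k.2 X X.2⟩ * rho k = rho k * lam X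

/-! ### Equivariant matrix functions over the chart. -/

section Rep

variable {𝔻 : Type*} [NormedRing 𝔻] [NormedAlgebra ℂ 𝔻] [CompleteSpace 𝔻] [FiniteDimensional ℂ 𝔻]
variable {D} (C : D.LocalChart) (R : D.RepData 𝔻)

namespace RepData

/-- The local homomorphism integrating `lam`. -/
def theta (u : 𝔹) : 𝔻 := D.S.theta R.lam u

/-- The `H`-equivariant extension of `theta` to the preimage of the domain of the chart. -/
def thetaHat (x : Γ) : 𝔻 :=
  open Classical in
  -- Over the source of the chart `fac_mem` selects the first branch, so the value `0` is a mere
  -- default.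
  if hx : C.fac x ∈ H then R.theta (D.JC (C.sec (C.e (x : Γ ⧸ H)))) * R.rho ⟨C.fac x, hx⟩ else 0

theorem isUnit_rho (k : H) : IsUnit (R.rho k) := ((Group.isUnit k).map R.rho)

theorem isUnit_theta (u : 𝔹) : IsUnit (R.theta u) := D.S.isUnit_theta R.lam u

variable {C}

theorem isUnit_thetaHat {x : Γ} (hx : (x : Γ ⧸ H) ∈ C.e.source) : IsUnit (R.thetaHat C x) := by
  rw [thetaHat, dif_pos (C.fac_mem hx)]
  exact (R.isUnit_theta _).mul (R.isUnit_rho _)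

/-- In `nbhd`, `x` is `b exp Y` with `b` the section and `Y ∈ h`. Both `θ(b exp (tY))` and `θ(b) exp
(t lam Y)` have logarithmic derivative `lam Y`, so they agree at `t = 1`, where `exp (lam Y)` is `ρ`
of the factor in `H`. -/
theorem thetaHat_of_mem {x : Γ} (hx : x ∈ C.nbhd) : R.thetaHat C x = R.theta (D.JC x) := by
  have hs := C.mem_source x hx
  obtain ⟨Y, hY, hJ, hpath⟩ := C.fiber x hx
  rw [thetaHat, dif_pos (C.fac_mem hs)]
  have hfac : D.J (C.fac x) = exp Y := by
    rw [LocalChart.fac, map_mul, hJ, ← mul_assoc, J_inv_mul, one_mul]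
  rw [R.rho_eq ⟨C.fac x, C.fac_mem hs⟩ Y hY hfac]
  set b := D.JC (C.sec (C.e (x : Γ ⧸ H))) with hb
  set l := R.lam ⟨D.ι Y, D.ι_mem_p hY⟩ with hl
  have hp := isPathIn_mul_exp_smul (P := D.S.p) (D.ι_mem_p hY) hpath
  have h0 : b * exp ((0 : ℝ) • D.ι Y) ∈ D.S.leaf := by
    simpa using C.mem_leaf _ (C.sec_mem _ (C.e.map_source hs))
  have hd : ∀ t ∈ Icc (0 : ℝ) 1,
      HasDerivAt (fun t : ℝ => R.theta (b * exp (t • D.ι Y)) * exp (t • -l)) 0 t := by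
    intro t ht
    refine ((D.S.hasDerivAt_theta R.lam R.map_lie hp h0 ht).mul
      (hasDerivAt_exp_smul' (-l) t)).congr_deriv ?_
    simp [hl, mul_assoc]
  have := constant_of_has_deriv_right_zero
    (fun t ht => (hd t ht).continuousAt.continuousWithinAt)
    (fun t ht => (hd t (Ico_subset_Icc_self ht)).hasDerivWithinAt) 1 (by simp)
  simp only [one_smul, zero_smul, exp_zero, mul_one] at this
  rw [← this, mul_assoc, exp_neg_mul_exp, mul_one]
  congr 1
  rw [D.JC_apply, hJ, map_mul, D.ι_exp]
  rfl

theorem thetaHat_mul {x : Γ} (hx : (x : Γ ⧸ H) ∈ C.e.source) (k : H) :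
    R.thetaHat C (x * k) = R.thetaHat C x * R.rho k := by
  have h1 : ((x * k : Γ) : Γ ⧸ H) = x := LocalChart.mk_mul_mem x k.2
  have hfac : C.fac (x * k) = C.fac x * k := by
    simp only [LocalChart.fac, h1, mul_assoc]
  rw [thetaHat, dif_pos (hfac ▸ H.mul_mem (C.fac_mem hx) k.2), thetaHat, dif_pos (C.fac_mem hx), h1,
    mul_assoc, ← map_mul]
  congr 2
  exact Subtype.ext hfac

theorem thetaHat_eq_of_mem {x : Γ} (k : H) (hx : x * (k : Γ)⁻¹ ∈ C.nbhd) :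
    R.thetaHat C x = R.theta (D.JC (x * (k : Γ)⁻¹)) * R.rho k := by
  have := R.thetaHat_mul (C.mem_source _ hx) k
  rwa [inv_mul_cancel_right, R.thetaHat_of_mem hx] at this

theorem contDiffAt_theta {u : 𝔹} (hu : u ∈ D.S.dec.target) : ContDiffAt ℂ ω R.theta u :=
  D.S.contDiffAt_theta R.lam hu

/-- The quotient `θ(g u k⁻¹) ρ(k) θ(u)⁻¹` is constant along paths tangent to `p`. -/
theorem quotient_eq (g : Γ) (k : H) {c X : ℝ → 𝔹}
    (hc : IsPathIn D.S.p
      ({u | D.JC g * u * D.JC (k : Γ)⁻¹ ∈ D.S.dec.target} ∩ D.S.dec.target) c X)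
    (h0 : c 0 ∈ D.S.leaf) (h0' : D.JC g * c 0 * D.JC (k : Γ)⁻¹ ∈ D.S.leaf) :
    R.theta (D.JC g * c 0 * D.JC (k : Γ)⁻¹) * R.rho k * Ring.inverse (R.theta (c 0)) =
      R.theta (D.JC g * c 1 * D.JC (k : Γ)⁻¹) * R.rho k * Ring.inverse (R.theta (c 1)) := by
  have hc1 : IsPathIn D.S.p D.S.dec.target c X := ⟨hc.deriv, hc.mem, hc.cont,
    fun t ht => (hc.maps t ht).2⟩
  have hc2 := D.isPathIn_translate g k.2
    (⟨hc.deriv, hc.mem, hc.cont, fun t ht => (hc.maps t ht).1⟩ :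
      IsPathIn D.S.p {u | D.JC g * u * D.JC (k : Γ)⁻¹ ∈ D.S.dec.target} c X)
  have hd : ∀ t ∈ Icc (0 : ℝ) 1, HasDerivAt (fun t => R.theta (D.JC g * c t * D.JC (k : Γ)⁻¹) *
      R.rho k * Ring.inverse (R.theta (c t))) 0 t := by
    intro t ht
    have hB := D.S.hasDerivAt_theta R.lam R.map_lie hc1 h0 ht
    have hA := (D.S.hasDerivAt_theta R.lam R.map_lie hc2 h0' ht).mul_const (R.rho k)
    obtain ⟨v, hv⟩ := R.isUnit_theta (c t)
    have hinv := hasDerivAt_ringInverse_comp (v := v) hB hv.symm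
    refine (hA.mul hinv).congr_deriv ?_
    have h1 : D.S.theta R.lam (c t) = v := hv.symm
    -- The translated path has logarithmic derivative `Ad k X`, and `lam (Ad k X) ρ(k) = ρ(k) lam
    -- X`. Hence the derivatives of the two `θ` factors cancel across `ρ(k)`.
    have h2 := R.lam_conj k ⟨X t, hc.mem t ht⟩
    rw [mul_assoc (D.S.theta R.lam _), h2]
    simp only [h1]
    simp [mul_assoc]
  have := constant_of_has_deriv_right_zero
    (fun t ht => (hd t ht).continuousAt.continuousWithinAt)
    (fun t ht => (hd t (Ico_subset_Icc_self ht)).hasDerivWithinAt) 1 (by simp)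
  exact this.symm

/-- The principle behind `contDiffAt_transition` applied to `u ↦ θ(g u k⁻¹) ρ(k) θ(u)⁻¹`, with `k ∈
H` frozen at `z₀`; by `quotient_eq` it is constant along paths tangent to `p`. -/
theorem contDiffAt_coordChange (g : Γ) {z₀ : E} (hz₀ : z₀ ∈ C.e.target)
    (hg : g • C.e.symm z₀ ∈ C.e.source) :
    ContDiffAt ℂ ω (fun z => R.thetaHat C (g * C.sec z) *
      Ring.inverse (R.thetaHat C (C.sec z))) z₀ := by
  rw [← C.mk_sec z₀ hz₀] at hg
  let k : H := ⟨C.fac (g * C.sec z₀), C.fac_mem hg⟩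
  have hmem : g * C.sec z₀ * (k : Γ)⁻¹ ∈ C.nbhd := C.mul_fac_inv_mem hg
  have hcont : ContinuousAt (fun z => g * C.sec z * (k : Γ)⁻¹) z₀ :=
    (continuousAt_const.mul (C.continuousAt_sec hz₀)).mul continuousAt_const
  have hnb : ∀ᶠ z in 𝓝 z₀, g * C.sec z * (k : Γ)⁻¹ ∈ C.nbhd :=
    hcont.eventually_mem (C.isOpen_nbhd.mem_nhds hmem)
  let τ : 𝔹 → 𝔹 := fun u => D.JC g * u * D.JC (k : Γ)⁻¹
  have hτ : ∀ x, τ (D.JC x) = D.JC (g * x * (k : Γ)⁻¹) := fun x => by simp [τ]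
  have hτc : ContDiff ℂ ω τ := (contDiff_const.mul contDiff_id).mul contDiff_const
  have hτt : τ (D.JC (C.sec z₀)) ∈ D.S.dec.target := by
    rw [hτ]; exact (C.mem_leaf _ hmem).1
  have ht : D.JC (C.sec z₀) ∈ D.S.dec.target := (C.mem_leaf _ (C.sec_mem z₀ hz₀)).1
  let f : 𝔹 → 𝔻 := fun u => R.theta (τ u) * R.rho k * Ring.inverse (R.theta u)
  have hO : {u | τ u ∈ D.S.dec.target} ∩ D.S.dec.target ∈ 𝓝 (D.JC (C.sec z₀)) :=
    inter_mem (hτc.continuous.continuousAt.eventually_mem (D.S.dec.open_target.mem_nhds hτt))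
      (D.S.dec.open_target.mem_nhds ht)
  have hev := C.eventually_eq_hol hz₀ hO (f := f) (by
    filter_upwards [hnb, C.e.open_target.mem_nhds hz₀] with z hz hz' c X hc hc0
    refine R.quotient_eq g k hc ?_ ?_
    · rw [hc0]; exact C.mem_leaf _ (C.sec_mem z hz')
    · rw [hc0]; exact (congrArg (· ∈ D.S.leaf) (hτ (C.sec z))).mpr (C.mem_leaf _ hz))
  have hfc : ContDiffAt ℂ ω (fun z => f (C.hol z₀ z)) z₀ := by
    have hf : ContDiffAt ℂ ω f (C.hol z₀ z₀) := by
      rw [C.hol_self hz₀]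
      refine ((ContDiffAt.comp _ (R.contDiffAt_theta hτt) hτc.contDiffAt).mul
        contDiffAt_const).mul ?_
      obtain ⟨v, hv⟩ := R.isUnit_theta (D.JC (C.sec z₀))
      have : ContDiffAt ℂ ω Ring.inverse (R.theta (D.JC (C.sec z₀))) := by
        rw [← hv]; exact contDiffAt_ringInverse ℂ v
      exact this.comp _ (R.contDiffAt_theta ht)
    exact hf.comp z₀ (C.contDiff_hol z₀).contDiffAt
  refine hfc.congr_of_eventuallyEq ?_
  filter_upwards [hev, hnb, C.e.open_target.mem_nhds hz₀] with z h1 h2 h3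
  rw [← h1, R.thetaHat_of_mem (C.sec_mem z h3), R.thetaHat_eq_of_mem k h2, ← hτ]

end RepData

end Rep

end CosetData

end HomogeneousComplex

namespace HomogeneousComplex

open NormedSpace Set Filter

/-! ### The complex manifold `G/H` -/

variable {Γ E 𝔸 𝔹 : Type*} [Group Γ] [TopologicalSpace Γ] [IsTopologicalGroup Γ]
  [NormedAddCommGroup E] [NormedSpace ℂ E] [FiniteDimensional ℂ E]
  [NormedRing 𝔸] [NormedAlgebra ℝ 𝔸] [FiniteDimensional ℝ 𝔸] [CompleteSpace 𝔸]
  [NormedRing 𝔹] [NormedAlgebra ℂ 𝔹] [FiniteDimensional ℂ 𝔹] [CompleteSpace 𝔹]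

namespace CosetData

variable {H : Subgroup Γ} (D : CosetData H E 𝔸 𝔹)

/-- The orbit map `x ↦ x q x⁻¹` descends to a continuous injection of `G/H` into the algebra, since
`H` is the centralizer of `q`. -/
theorem t2Space_quotient (D : CosetData H E 𝔸 𝔹) : T2Space (Γ ⧸ H) := by
  let φ : Γ → 𝔸 := fun x => D.J x * D.q * D.J x⁻¹
  have hφ : Continuous φ := (D.continuous_J.mul continuous_const).mul
    (D.continuous_J.comp continuous_inv)
  have hinv : ∀ x y : Γ, φ x = φ y ↔ x⁻¹ * y ∈ H := by
    intro x y
    rw [D.mem_H, map_mul]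
    constructor
    · intro h
      have := congrArg (fun u => D.J x⁻¹ * u * D.J y) h
      simp only [φ, mul_assoc, J_inv_mul, mul_one] at this
      rw [← mul_assoc (D.J x⁻¹) (D.J x), J_inv_mul, one_mul] at this
      rw [mul_assoc, ← this]
    · intro h
      have := congrArg (fun u => D.J x * u * D.J y⁻¹) h
      simp only [mul_assoc, J_mul_inv, mul_one] at this
      rw [← mul_assoc (D.J x) (D.J x⁻¹), J_mul_inv, one_mul] at this
      simp only [φ, mul_assoc, this]
  have hlift : ∀ a b : Γ, (QuotientGroup.leftRel H) a b → φ a = φ b := fun a b h =>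
    (hinv a b).2 (QuotientGroup.leftRel_apply.1 h)
  refine T2Space.of_injective_continuous (f := Quotient.lift φ hlift) ?_
    (continuous_quot_lift hlift hφ)
  rintro ⟨x⟩ ⟨y⟩ h
  exact QuotientGroup.eq.2 ((hinv x y).1 h)

theorem secondCountableTopology_quotient (D : CosetData H E 𝔸 𝔹) :
    SecondCountableTopology (Γ ⧸ H) := by
  have : ProperSpace 𝔸 := FiniteDimensional.proper ℝ 𝔸
  have : SecondCountableTopology Γ := D.inducing.secondCountableTopology
  infer_instance

namespace LocalChart

variable {D} (C : D.LocalChart)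

/-- The translate by `g` of the chart at the base point. -/
def chart (g : Γ) : OpenPartialHomeomorph (Γ ⧸ H) E :=
  (Homeomorph.smul g⁻¹).transOpenPartialHomeomorph C.e

theorem chart_apply (g : Γ) (x : Γ ⧸ H) : C.chart g x = C.e (g⁻¹ • x) := rfl

theorem chart_symm_apply (g : Γ) (z : E) : (C.chart g).symm z = g • C.e.symm z := by
  change (Homeomorph.smul g⁻¹).symm (C.e.symm z) = _
  rw [Homeomorph.symm_apply_eq]
  simp

theorem mem_chart_source {g : Γ} {x : Γ ⧸ H} : x ∈ (C.chart g).source ↔ g⁻¹ • x ∈ C.e.source :=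
  Iff.rfl

theorem mem_chart_out_source (x : Γ ⧸ H) : x ∈ (C.chart (Quotient.out x)).source := by
  rw [mem_chart_source]
  have : (Quotient.out x)⁻¹ • x = ((1 : Γ) : Γ ⧸ H) := by
    rw [inv_smul_eq_iff, MulAction.Quotient.smul_mk, smul_eq_mul, mul_one]
    exact (QuotientGroup.out_eq' x).symm
  rw [this]
  exact C.one_mem_source

/-- The atlas of `G/H` given by the translates of the chart at the base point. -/
@[reducible] def chartedSpace : ChartedSpace E (Γ ⧸ H) where
  atlas := range C.chart
  chartAt x := C.chart (Quotient.out x)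
  mem_chart_source := C.mem_chart_out_source
  chart_mem_atlas _ := ⟨_, rfl⟩

theorem chartAt_eq (x : Γ ⧸ H) : (@chartAt E _ (Γ ⧸ H) _ C.chartedSpace x) =
    C.chart (Quotient.out x) := rfl

/-- In translated charts the action of `g` is the transition of the base chart for `g₂⁻¹ g g₁`. With
`g = 1` this gives compatibility of the atlas, and for general `g` holomorphy of the action. -/
theorem contDiffAt_chart_smul_chart_symm (g g₁ g₂ : Γ) {z : E} (hz : z ∈ C.e.target)
    (h : g • g₁ • C.e.symm z ∈ (C.chart g₂).source) :
    ContDiffAt ℂ ω (fun z => C.chart g₂ (g • (C.chart g₁).symm z)) z := by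
  have := C.contDiffAt_transition (g₂⁻¹ * g * g₁) hz (by
    rw [mul_assoc, mul_smul, mul_smul]; exact h)
  refine this.congr_of_eventuallyEq (Eventually.of_forall fun w => ?_)
  simp only [chart_apply, chart_symm_apply, mul_smul]

theorem isManifold : @IsManifold ℂ _ E _ _ E _ 𝓘(ℂ, E) ω (Γ ⧸ H) _ C.chartedSpace := by
  letI := C.chartedSpace
  refine isManifold_of_contDiffOn 𝓘(ℂ, E) ω (Γ ⧸ H) ?_
  rintro _ _ ⟨g₁, rfl⟩ ⟨g₂, rfl⟩ z hz
  simp only [modelWithCornersSelf_coe, modelWithCornersSelf_coe_symm, range_id, inter_univ,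
    preimage_id, OpenPartialHomeomorph.trans_source, OpenPartialHomeomorph.symm_source] at hz
  have h1 : g₁ • C.e.symm z ∈ (C.chart g₂).source := by
    rw [← chart_symm_apply]; exact hz.2
  have := C.contDiffAt_chart_smul_chart_symm 1 g₁ g₂ (z := z) hz.1 (by simpa using h1)
  refine (this.congr_of_eventuallyEq (Eventually.of_forall fun w => ?_)).contDiffWithinAt
  simp

theorem contMDiff_smul (g : Γ) :
    letI := C.chartedSpace
    ContMDiff 𝓘(ℂ, E) 𝓘(ℂ, E) ω (fun x : Γ ⧸ H => g • x) := by
  letI := C.chartedSpace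
  intro x
  refine contMDiffAt_iff.2 ⟨(continuous_const_smul g).continuousAt, ?_⟩
  have hx := C.mem_chart_out_source x
  have := C.contDiffAt_chart_smul_chart_symm g (Quotient.out x) (Quotient.out (g • x))
    (z := C.chart (Quotient.out x) x) ((C.chart _).map_source hx) (by
      rw [← chart_symm_apply, (C.chart _).left_inv hx]; exact C.mem_chart_out_source (g • x))
  refine (this.congr_of_eventuallyEq (Eventually.of_forall fun w => ?_)).contDiffWithinAt
  simp [chartAt_eq]

/-- Local formula for the chart along a map into `G`. -/
theorem eventually_e_eq {X : Type*} [TopologicalSpace X] {f : X → Γ} {x₀ : X}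
    (hf : ContinuousAt f x₀) (hs : (f x₀ : Γ ⧸ H) ∈ C.e.source) :
    ∀ᶠ x in 𝓝 x₀, (f x : Γ ⧸ H) ∈ C.e.source ∧ f x * (C.fac (f x₀))⁻¹ ∈ C.nbhd ∧
      C.e (f x : Γ ⧸ H) = (D.S.dec.symm (D.JC (f x * (C.fac (f x₀))⁻¹))).1 := by
  have h1 : ∀ᶠ x in 𝓝 x₀, f x * (C.fac (f x₀))⁻¹ ∈ C.nbhd :=
    (hf.mul continuousAt_const).eventually_mem (C.isOpen_nbhd.mem_nhds (C.mul_fac_inv_mem hs))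
  have h2 : ∀ᶠ x in 𝓝 x₀, (f x : Γ ⧸ H) ∈ C.e.source :=
    (continuous_quotient_mk'.continuousAt.comp hf).eventually_mem (C.e.open_source.mem_nhds hs)
  filter_upwards [h1, h2] with x hx1 hx2
  exact ⟨hx2, hx1, C.e_eq_of_mem (C.fac_mem hs) hx1⟩

section Smooth

variable {X : Type*} [NormedAddCommGroup X] [NormedSpace ℝ X] {n : WithTop ℕ∞}

theorem contDiffAt_JC_mul_mul {f : X → Γ} {x₀ : X} (hf : ContDiffAt ℝ n (fun x => D.J (f x)) x₀)
    (g k : Γ) : ContDiffAt ℝ n (fun x => D.JC (g * f x * k)) x₀ := by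
  have : ContDiffAt ℝ n (fun x => D.JC (f x)) x₀ := D.ιL.contDiff.contDiffAt.comp x₀ hf
  simp only [map_mul]
  exact (contDiffAt_const.mul this).mul contDiffAt_const

theorem continuousAt_of_contDiffAt {f : X → Γ} {x₀ : X}
    (hf : ContDiffAt ℝ n (fun x => D.J (f x)) x₀) : ContinuousAt f x₀ :=
  D.inducing.continuousAt_iff.2 hf.continuousAt

/-- Freezing the factor of `g f(x₀)` in `H` expresses the chart through `dec` and the matrix of `f
x`. -/
theorem contDiffAt_e_comp {f : X → Γ} {x₀ : X} (hf : ContDiffAt ℝ n (fun x => D.J (f x)) x₀)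
    (g : Γ) (hs : ((g * f x₀ : Γ) : Γ ⧸ H) ∈ C.e.source) :
    ContDiffAt ℝ n (fun x => C.e ((g * f x : Γ) : Γ ⧸ H)) x₀ := by
  have hc : ContinuousAt (fun x => g * f x) x₀ :=
    continuousAt_const.mul (continuousAt_of_contDiffAt hf)
  have hev := C.eventually_e_eq hc hs
  have ht := (C.mem_leaf _ (C.mul_fac_inv_mem hs)).1
  have h1 : ContDiffAt ℝ n (fun x => (D.S.dec.symm (D.JC (g * f x * (C.fac (g * f x₀))⁻¹))).1) x₀ := by
    refine contDiff_fst.contDiffAt.comp x₀ ?_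
    have h2 : ContDiffAt ℝ n D.S.dec.symm (D.JC (g * f x₀ * (C.fac (g * f x₀))⁻¹)) :=
      ((D.S.contDiffAt_dec_symm ht).restrict_scalars ℝ).of_le le_top
    exact ContDiffAt.comp (f := fun x => D.JC (g * f x * (C.fac (g * f x₀))⁻¹)) x₀ h2
      (contDiffAt_JC_mul_mul hf g _)
  refine h1.congr_of_eventuallyEq ?_
  filter_upwards [hev] with x hx
  exact hx.2.2

theorem contMDiffAt_mk {f : X → Γ} {x₀ : X} (hf : ContDiffAt ℝ n (fun x => D.J (f x)) x₀) :
    letI := C.chartedSpace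
    ContMDiffAt 𝓘(ℝ, X) 𝓘(ℝ, E) n (fun x => (f x : Γ ⧸ H)) x₀ := by
  letI := C.chartedSpace
  refine contMDiffAt_iff.2 ⟨continuous_quotient_mk'.continuousAt.comp
    (continuousAt_of_contDiffAt hf), ?_⟩
  have := C.contDiffAt_e_comp hf (Quotient.out (f x₀ : Γ ⧸ H))⁻¹
    (C.mem_chart_out_source (f x₀ : Γ ⧸ H))
  refine (this.congr_of_eventuallyEq (Eventually.of_forall fun w => ?_)).contDiffWithinAt
  simp only [mfld_simps]
  rfl

end Smooth

end LocalChart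

/-- The element of `H` by which `g` differs from the chosen representative of its coset. -/
def outFac (H : Subgroup Γ) (g : Γ) : Γ := (Quotient.out (g : Γ ⧸ H))⁻¹ * g

theorem outFac_mem (g : Γ) : outFac H g ∈ H :=
  QuotientGroup.eq.1 (QuotientGroup.out_eq' (g : Γ ⧸ H))

/-- The complexified differential of `G → G/H` at `g`, in the chart at `gH`. -/
def diff (g : Γ) : 𝔹 →ₗ[ℂ] E :=
  LinearMap.fst ℂ E (D.S.p × D.S.w) ∘ₗ (D.S.sumEquiv.symm : 𝔹 →ₗ[ℂ] E × D.S.p × D.S.w) ∘ₗ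
    LinearMap.mulLeft ℂ (D.JC (outFac H g)) ∘ₗ LinearMap.mulRight ℂ (D.JC (outFac H g)⁻¹)

theorem diff_apply (g : Γ) (X : 𝔹) : D.diff g X =
    (D.S.sumEquiv.symm (D.JC (outFac H g) * (X * D.JC (outFac H g)⁻¹))).1 := rfl

theorem conj_mem_p_iff {k : Γ} (hk : k ∈ H) {X : 𝔹} :
    D.JC k * (X * D.JC k⁻¹) ∈ D.S.p ↔ X ∈ D.S.p := by
  refine ⟨fun h => ?_, fun h => by rw [← mul_assoc]; exact D.conj_mem_p k hk X h⟩
  have := D.conj_mem_p k⁻¹ (H.inv_mem hk) _ h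
  rw [inv_inv] at this
  change D.JC k⁻¹ * (D.JC k * (X * D.JC k⁻¹)) * D.JC k ∈ _ at this
  rwa [← mul_assoc (D.JC k⁻¹), JC_inv_mul, one_mul, mul_assoc, JC_inv_mul, mul_one] at this

theorem conj_mem_lie (k : Γ) {X : 𝔸} (hX : X ∈ D.closed.lie) :
    D.J k * X * D.J k⁻¹ ∈ D.closed.lie :=
  D.closed.conj_mem_lie ⟨k, rfl⟩ ⟨k⁻¹, rfl⟩ (D.J_mul_inv k) (D.J_inv_mul k) hX

/-- Modulo `p`, which `Ad k` preserves, every element of `s` comes from the real Lie algebra, which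
`Ad k` preserves as well. -/
theorem conj_mem_s {k : Γ} (hk : k ∈ H) {X : 𝔹} (hX : X ∈ D.S.s) :
    D.JC k * (X * D.JC k⁻¹) ∈ D.S.s := by
  obtain ⟨_, ⟨z, rfl⟩, y, hy, rfl⟩ := Submodule.mem_sup.1 hX
  obtain ⟨R, hR, hRz⟩ := D.exists_real z
  have h1 : D.JC k * (D.ι R * D.JC k⁻¹) ∈ D.S.s := by
    have := D.lie_le _ (D.conj_mem_lie k hR)
    rw [map_mul, map_mul, mul_assoc] at this
    exact this
  have h2 := D.S.p_le ((D.conj_mem_p_iff hk).2 hRz)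
  have h3 := D.S.p_le ((D.conj_mem_p_iff hk).2 hy)
  have : D.JC k * ((D.S.a z + y) * D.JC k⁻¹) = D.JC k * (D.ι R * D.JC k⁻¹) -
      D.JC k * ((D.ι R - D.S.a z) * D.JC k⁻¹) + D.JC k * (y * D.JC k⁻¹) := by
    noncomm_ring
  exact this ▸ D.S.s.add_mem (D.S.s.sub_mem h1 h2) h3

/-- `diff g` is `Ad k` followed by reduction modulo `p`, for some `k ∈ H`, and `Ad k` preserves both
`s` and `p`. -/
theorem diff_eq_zero_iff (g : Γ) {X : 𝔹} (hX : X ∈ D.S.s) : D.diff g X = 0 ↔ X ∈ D.S.p := by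
  have hk := outFac_mem (H := H) g
  rw [diff_apply, ← D.conj_mem_p_iff hk]
  refine ⟨fun h => ?_, fun h => D.sumEquiv_symm_fst_eq (by simpa using h)⟩
  have := D.sumEquiv_symm_fst (D.conj_mem_s hk hX)
  rwa [h, map_zero, zero_sub, neg_mem_iff] at this

theorem exists_diff_eq (g : Γ) (z : E) : ∃ X ∈ D.closed.lie, D.diff g (D.ι X) = z := by
  have hk := outFac_mem (H := H) g
  obtain ⟨R, hR, hRz⟩ := D.exists_real z
  refine ⟨_, D.conj_mem_lie (outFac H g)⁻¹ hR, ?_⟩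
  rw [diff_apply]
  refine D.sumEquiv_symm_fst_eq ?_
  convert hRz using 2
  rw [inv_inv, map_mul, map_mul]
  change D.JC (outFac H g) * (D.JC (outFac H g)⁻¹ * D.ι R * D.JC (outFac H g) *
    D.JC (outFac H g)⁻¹) = _
  rw [mul_assoc _ (D.JC (outFac H g)), JC_mul_inv, mul_one, ← mul_assoc, JC_mul_inv, one_mul]

namespace LocalChart

variable {D} (C : D.LocalChart)

theorem hasMFDerivAt_mk {c : ℝ → Γ} {X : 𝔸} (hc : HasDerivAt (fun t => D.J (c t)) X 0)
    (c0 : c 0 = 1) (g : Γ) :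
    letI := C.chartedSpace
    HasMFDerivAt 𝓘(ℝ, ℝ) 𝓘(ℝ, E) (fun t : ℝ => ((g * c t : Γ) : Γ ⧸ H)) 0
      (ContinuousLinearMap.toSpanSingleton ℝ (D.diff g (D.ι X) : E)) := by
  letI := C.chartedSpace
  have hcont : ContinuousAt c 0 := D.inducing.continuousAt_iff.2 hc.continuousAt
  have hcont' : ContinuousAt (fun t => g * c t) 0 := continuousAt_const.mul hcont
  refine ⟨continuous_quotient_mk'.continuousAt.comp hcont', ?_⟩
  -- The chart at `gH` is translated by the chosen representative `g k⁻¹`, so it sees the curve `k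
  -- c(t) H = k c(t) k⁻¹ H` through the base point. This is the source of `Ad k` in `diff`.
  set k := outFac H g with hk
  have hkH : k ∈ H := outFac_mem g
  have hev : ∀ᶠ t in 𝓝 (0 : ℝ), k * c t * k⁻¹ ∈ C.nbhd := by
    refine ((continuousAt_const.mul hcont).mul continuousAt_const).eventually_mem
      (C.isOpen_nbhd.mem_nhds ?_)
    change k * c 0 * k⁻¹ ∈ C.nbhd
    rw [c0, mul_one, mul_inv_cancel]
    exact C.one_mem
  have hd : HasDerivAt (fun t => (D.S.dec.symm (D.JC (k * c t * k⁻¹))).1) (D.diff g (D.ι X)) 0 := by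
    have h1 : HasDerivAt (fun t => D.JC (k * c t * k⁻¹)) (D.JC k * (D.ι X * D.JC k⁻¹)) 0 := by
      simp only [map_mul]
      have h2 : HasDerivAt (fun t => D.JC (c t)) (D.ι X) 0 :=
        D.ιL.hasFDerivAt.comp_hasDerivAt (0 : ℝ) hc
      exact ((h2.const_mul (D.JC k)).mul_const _).congr_deriv (mul_assoc _ _ _)
    have h3 : HasFDerivAt D.S.dec.symm
        ((D.S.sumEquiv.symm : 𝔹 →L[ℂ] E × D.S.p × D.S.w).restrictScalars ℝ)
        (D.JC (k * c 0 * k⁻¹)) := by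
      have : D.JC (k * c 0 * k⁻¹) = 1 := by simp [c0]
      rw [this, ← D.S.fderiv_dec_symm_one]
      exact (D.S.hasFDerivAt_dec_symm D.S.one_mem_dec_target).restrictScalars ℝ
    have h4 : HasDerivAt (fun t => D.S.dec.symm (D.JC (k * c t * k⁻¹)))
        (D.S.sumEquiv.symm (D.JC k * (D.ι X * D.JC k⁻¹))) 0 :=
      HasFDerivAt.comp_hasDerivAt (f := fun t => D.JC (k * c t * k⁻¹)) (0 : ℝ) h3 h1
    exact (ContinuousLinearMap.fst ℝ E (D.S.p × D.S.w)).hasFDerivAt.comp_hasDerivAt (0 : ℝ) h4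
  have hout : (Quotient.out ((g * c 0 : Γ) : Γ ⧸ H))⁻¹ * g = k := by rw [c0, mul_one, hk, outFac]
  refine (hd.hasFDerivAt.congr_of_eventuallyEq ?_).hasFDerivWithinAt
  filter_upwards [hev] with t ht
  simp only [writtenInExtChartAt, mfld_simps]
  change C.e ((Quotient.out ((g * c 0 : Γ) : Γ ⧸ H))⁻¹ • ((g * c t : Γ) : Γ ⧸ H)) = _
  rw [MulAction.Quotient.smul_mk, smul_eq_mul, ← mul_assoc, hout, C.e_eq_of_mem hkH ht]

end LocalChart

end CosetData

end HomogeneousComplex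

namespace HomogeneousComplex

open NormedSpace Set Filter

/-! ### Closed matrix groups -/

section MatrixGroup

variable {n : ℕ} {G : Subgroup (GL (Fin n) ℝ)} {𝔸 : Type*} [NormedRing 𝔸] [NormedAlgebra ℝ 𝔸]
  [FiniteDimensional ℝ 𝔸] [CompleteSpace 𝔸] (Φ : Matrix (Fin n) (Fin n) ℝ ≃ₐ[ℝ] 𝔸)

/-- The embedding of a matrix group in an algebra isomorphic to the matrix algebra. -/
def groupHom (G : Subgroup (GL (Fin n) ℝ)) : G →* 𝔸 :=
  (Units.coeHom 𝔸).comp ((Units.map (Φ : Matrix (Fin n) (Fin n) ℝ →* 𝔸)).comp G.subtype)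

theorem groupHom_apply (g : G) :
    groupHom Φ G g = Φ ((g : GL (Fin n) ℝ) : Matrix (Fin n) (Fin n) ℝ) := rfl

/-- The isomorphism of `GL(n, ℝ)` with the group of units, as a homeomorphism. -/
def unitsHomeomorph : GL (Fin n) ℝ ≃ₜ 𝔸ˣ where
  toEquiv := (Units.mapEquiv (Φ : Matrix (Fin n) (Fin n) ℝ ≃* 𝔸)).toEquiv
  continuous_toFun := Continuous.units_map (Φ : Matrix (Fin n) (Fin n) ℝ →* 𝔸)
    Φ.toLinearMap.continuous_of_finiteDimensional
  continuous_invFun := Continuous.units_map (Φ.symm : 𝔸 →* Matrix (Fin n) (Fin n) ℝ)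
    Φ.symm.toLinearMap.continuous_of_finiteDimensional

theorem isInducing_groupHom : Topology.IsInducing (groupHom Φ G) :=
  Units.isOpenEmbedding_val.isInducing.comp
    ((unitsHomeomorph Φ).isInducing.comp Topology.IsInducing.subtypeVal)

theorem groupHom_injective : Function.Injective (groupHom Φ G) := fun _ _ h =>
  Subtype.ext (Units.ext (Φ.injective h))

/-- The group is closed in `GL` only, and singular matrices may lie in its closure. But an
exponential is a unit, and the topology of the units is induced from the algebra, so closedness
among units suffices. -/
theorem expClosed_groupHom (hG : IsClosed (G : Set (GL (Fin n) ℝ))) :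
    ExpClosed (MonoidHom.mrange (groupHom Φ G)) where
  closure_mem X hX := by
    let u : 𝔸ˣ := ⟨exp X, exp (-X), exp_mul_exp_neg X, exp_neg_mul_exp X⟩
    have hcl : IsClosed (unitsHomeomorph Φ '' (G : Set (GL (Fin n) ℝ))) :=
      (unitsHomeomorph Φ).isClosedMap _ hG
    have hu : u ∈ closure (unitsHomeomorph Φ '' (G : Set (GL (Fin n) ℝ))) := by
      rw [Units.isOpenEmbedding_val.isInducing.closure_eq_preimage_closure_image]
      refine closure_mono ?_ hX
      rintro _ ⟨g, rfl⟩
      exact ⟨_, ⟨g, g.2, rfl⟩, rfl⟩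
    rw [hcl.closure_eq] at hu
    obtain ⟨g, hg, hgu⟩ := hu
    exact ⟨⟨g, hg⟩, congrArg Units.val hgu⟩
  neg_mem X := by
    rintro ⟨g, hg⟩
    refine ⟨g⁻¹, ?_⟩
    have h1 : groupHom Φ G g⁻¹ * exp X = 1 := by rw [← hg, ← map_mul]; simp
    calc groupHom Φ G g⁻¹ = groupHom Φ G g⁻¹ * (exp X * exp (-X)) := by simp
      _ = exp (-X) := by rw [← mul_assoc, h1, one_mul]

theorem map_eq_sum (M : Matrix (Fin n) (Fin n) ℝ) :
    Φ M = ∑ i, ∑ j, M i j • Φ (Matrix.single i j 1) := by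
  conv_lhs => rw [Matrix.matrix_eq_sum_single M]
  simp only [map_sum, ← map_smul, Matrix.smul_single, smul_eq_mul, mul_one]

/-- A matrix entry, as a continuous linear functional. -/
def entryL (i j : Fin n) : 𝔸 →L[ℝ] ℝ :=
  LinearMap.toContinuousLinearMap
    ((Matrix.entryLinearMap ℝ ℝ i j).comp (Φ.symm : 𝔸 ≃ₐ[ℝ] _).toLinearMap)

theorem entryL_map (i j : Fin n) (M : Matrix (Fin n) (Fin n) ℝ) : entryL Φ i j (Φ M) = M i j := by
  change (Φ.symm (Φ M)) i j = M i j
  rw [Φ.symm_apply_apply]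

theorem hasVelocity_iff {c : ℝ → G} {X : Matrix (Fin n) (Fin n) ℝ} :
    HasVelocity c X ↔ HasDerivAt (fun t => groupHom Φ G (c t)) (Φ X) 0 := by
  constructor
  · intro h
    rw [map_eq_sum Φ X]
    simp only [groupHom_apply, map_eq_sum Φ (Units.val _)]
    exact HasDerivAt.fun_sum fun i _ => HasDerivAt.fun_sum fun j _ => (h i j).smul_const _
  · intro h i j
    have := (entryL Φ i j).hasFDerivAt.comp_hasDerivAt (0 : ℝ) h
    rw [entryL_map] at this
    refine this.congr_of_eventuallyEq (Eventually.of_forall fun t => ?_)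
    exact (entryL_map Φ i j _).symm

theorem SmoothOn.contDiffOn {k : ℕ} {f : EuclideanSpace ℝ (Fin k) → G}
    {s : Set (EuclideanSpace ℝ (Fin k))} (hf : SmoothOn f s) :
    ContDiffOn ℝ ∞ (fun x => groupHom Φ G (f x)) s := by
  simp only [groupHom_apply, map_eq_sum Φ (Units.val _)]
  exact ContDiffOn.sum fun i _ => ContDiffOn.sum fun j _ => (hf i j).smul contDiffOn_const

/-- One-parameter groups are curves with the required velocity. Conversely, `mem_lie_of_hasDerivAt`
turns a velocity at `1` into a one-parameter group in `G`. -/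
theorem mem_lie_groupHom {hG : ExpClosed (MonoidHom.mrange (groupHom Φ G))} {X : 𝔸} :
    X ∈ hG.lie ↔ ∃ Y : lieAlg G, Φ Y = X := by
  constructor
  · intro hX
    choose c hc using fun t => MonoidHom.mem_mrange.1 (hG.mem_lie.1 hX t)
    have c0 : c 0 = 1 := groupHom_injective Φ (by rw [hc]; simp)
    refine ⟨⟨Φ.symm X, c, c0, (hasVelocity_iff Φ).2 ?_⟩, Φ.apply_symm_apply X⟩
    simp only [hc, Φ.apply_symm_apply]
    simpa using hasDerivAt_exp_smul X 0
  · rintro ⟨⟨Y, c, c0, hc⟩, rfl⟩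
    exact hG.mem_lie_of_hasDerivAt (c := fun t => groupHom Φ G (c t)) (fun t => ⟨c t, rfl⟩)
      (by simp [c0]) ((hasVelocity_iff Φ).1 hc)

end MatrixGroup

end HomogeneousComplex

namespace HomogeneousComplex

open NormedSpace Set Filter

/-! ### The grading of `𝔤 ⊗ ℂ` -/

section Complexification

variable {V : Type*} [AddCommGroup V] [Module ℝ V]

theorem exists_eq_one_tmul_add_I_tmul (x : ℂ ⊗[ℝ] V) :
    ∃ a b : V, x = (1 : ℂ) ⊗ₜ[ℝ] a + Complex.I ⊗ₜ[ℝ] b := by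
  induction x using TensorProduct.induction_on with
  | zero => exact ⟨0, 0, by simp⟩
  | tmul z v =>
    refine ⟨z.re • v, z.im • v, ?_⟩
    rw [← TensorProduct.smul_tmul, ← TensorProduct.smul_tmul, ← TensorProduct.add_tmul]
    congr 1
    apply Complex.ext <;> simp
  | add x y hx hy =>
    obtain ⟨a, b, rfl⟩ := hx
    obtain ⟨a', b', rfl⟩ := hy
    refine ⟨a + a', b + b', ?_⟩
    simp only [TensorProduct.tmul_add]
    abel

variable (V) in
/-- Complex conjugation on `V ⊗ ℂ`. -/
def conj : ℂ ⊗[ℝ] V →ₗ[ℝ] ℂ ⊗[ℝ] V := LinearMap.rTensor V Complex.conjAe.toLinearMap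

@[simp] theorem conj_tmul (z : ℂ) (v : V) :
    conj V (z ⊗ₜ[ℝ] v) = (starRingEnd ℂ z) ⊗ₜ[ℝ] v := rfl

@[simp] theorem conj_conj (x : ℂ ⊗[ℝ] V) : conj V (conj V x) = x := by
  induction x using TensorProduct.induction_on with
  | zero => simp
  | tmul z v => simp
  | add x y hx hy => simp [hx, hy]

theorem conj_smul (c : ℂ) (x : ℂ ⊗[ℝ] V) : conj V (c • x) = starRingEnd ℂ c • conj V x := by
  induction x using TensorProduct.induction_on with
  | zero => simp
  | tmul z v => simp [TensorProduct.smul_tmul']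
  | add x y hx hy => simp [hx, hy]

theorem eq_zero_of_one_tmul_eq_zero {v : V} (h : (1 : ℂ) ⊗ₜ[ℝ] v = 0) : v = 0 := by
  have := congrArg (fun x => TensorProduct.lid ℝ V (LinearMap.rTensor V Complex.reLm x)) h
  simpa using this

theorem exists_add_conj_eq (x : ℂ ⊗[ℝ] V) : ∃ v : V, x + conj V x = (1 : ℂ) ⊗ₜ[ℝ] v := by
  obtain ⟨a, b, rfl⟩ := exists_eq_one_tmul_add_I_tmul x
  refine ⟨(2 : ℝ) • a, ?_⟩
  simp only [map_add, conj_tmul, map_one, Complex.conj_I, TensorProduct.neg_tmul, two_smul,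
    TensorProduct.tmul_add]
  abel

end Complexification

section Grading

variable {n : ℕ} {G : Subgroup (GL (Fin n) ℝ)} (q : lieAlg G)

/-- The bracket of `𝔤 ⊗ ℂ`, as a bilinear map. -/
def bracketC (G : Subgroup (GL (Fin n) ℝ)) :
    ℂ ⊗[ℝ] lieAlg G →ₗ[ℂ] ℂ ⊗[ℝ] lieAlg G →ₗ[ℂ] ℂ ⊗[ℝ] lieAlg G :=
  (LieAlgebra.ad ℂ (ℂ ⊗[ℝ] lieAlg G)).toLinearMap

theorem bracketC_tmul (z w : ℂ) (X Y : lieAlg G) :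
    bracketC G (z ⊗ₜ[ℝ] X) (w ⊗ₜ[ℝ] Y) = (z * w) ⊗ₜ[ℝ] ⁅X, Y⁆ := rfl

theorem bracketC_leibniz (x y z : ℂ ⊗[ℝ] lieAlg G) : bracketC G x (bracketC G y z) =
    bracketC G (bracketC G x y) z + bracketC G y (bracketC G x z) :=
  leibniz_lie x y z

theorem mem_gradedPiece {r : ℝ} {x : ℂ ⊗[ℝ] lieAlg G} :
    x ∈ gradedPiece q r ↔ bracketC G (Complex.I ⊗ₜ[ℝ] q) x = (r : ℂ) • x :=
  Module.End.mem_eigenspace_iff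

theorem bracketC_mem_gradedPiece {r s : ℝ} {x y : ℂ ⊗[ℝ] lieAlg G} (hx : x ∈ gradedPiece q r)
    (hy : y ∈ gradedPiece q s) : bracketC G x y ∈ gradedPiece q (r + s) := by
  rw [mem_gradedPiece] at *
  rw [bracketC_leibniz, hx, hy, map_smul, map_smul, LinearMap.smul_apply, ← add_smul]
  push_cast
  rfl

/-- `Q = iq` is purely imaginary, so conjugation changes the sign of `ad Q`. Hence it exchanges the
eigenspaces for `r` and `-r`. -/
theorem conj_bracketC (x : ℂ ⊗[ℝ] lieAlg G) : conj _ (bracketC G (Complex.I ⊗ₜ[ℝ] q) x) =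
    -bracketC G (Complex.I ⊗ₜ[ℝ] q) (conj _ x) := by
  induction x using TensorProduct.induction_on with
  | zero => simp
  | tmul z v =>
    rw [conj_tmul, bracketC_tmul, bracketC_tmul, conj_tmul, map_mul, Complex.conj_I, neg_mul,
      TensorProduct.neg_tmul]
  | add x y hx hy => rw [map_add, map_add, hx, hy, map_add, map_add, neg_add]

theorem conj_mem_gradedPiece {r : ℝ} {x : ℂ ⊗[ℝ] lieAlg G} (hx : x ∈ gradedPiece q r) :
    conj _ x ∈ gradedPiece q (-r) := by
  rw [mem_gradedPiece] at *
  have := conj_bracketC q x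
  rw [hx, conj_smul, Complex.conj_ofReal] at this
  rw [← neg_eq_iff_eq_neg.2 this]
  simp

/-- The sum of the eigenspaces of `ad Q` with eigenvalues in `A`. -/
def gradedSum (A : Set ℝ) : Submodule ℂ (ℂ ⊗[ℝ] lieAlg G) := ⨆ r ∈ A, gradedPiece q r

theorem gradedPiece_le_gradedSum {A : Set ℝ} {r : ℝ} (hr : r ∈ A) :
    gradedPiece q r ≤ gradedSum q A := le_biSup (gradedPiece q) hr

theorem gradedSum_induction {A : Set ℝ} {P : ℂ ⊗[ℝ] lieAlg G → Prop} (h0 : P 0)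
    (hadd : ∀ x y, P x → P y → P (x + y)) (hmem : ∀ r ∈ A, ∀ x ∈ gradedPiece q r, P x)
    {x : ℂ ⊗[ℝ] lieAlg G} (hx : x ∈ gradedSum q A) : P x := by
  rw [gradedSum, iSup_subtype'] at hx
  exact Submodule.iSup_induction _ (motive := P) hx (fun r y hy => hmem r r.2 y hy) h0 hadd

theorem gradedSum_mono {A B : Set ℝ} (h : A ⊆ B) : gradedSum q A ≤ gradedSum q B :=
  biSup_mono fun _ hr => h hr

theorem gradedSum_union (A B : Set ℝ) : gradedSum q (A ∪ B) = gradedSum q A ⊔ gradedSum q B :=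
  iSup_union

theorem disjoint_gradedSum {A B : Set ℝ} (h : Disjoint A B) :
    Disjoint (gradedSum q A) (gradedSum q B) :=
  iSupIndep.disjoint_biSup_biSup (f := fun r : ℝ => gradedPiece q r)
    ((Module.End.eigenspaces_iSupIndep (adQ q)).comp Complex.ofReal_injective) h

theorem bracketC_mem_gradedSum {A B C : Set ℝ} (hABC : ∀ a ∈ A, ∀ b ∈ B, a + b ∈ C)
    {x y : ℂ ⊗[ℝ] lieAlg G} (hx : x ∈ gradedSum q A) (hy : y ∈ gradedSum q B) :
    bracketC G x y ∈ gradedSum q C := by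
  refine gradedSum_induction q (P := fun x => bracketC G x y ∈ gradedSum q C) (by simp)
    (fun x x' h h' => by rw [map_add]; exact Submodule.add_mem _ h h') (fun r hr x hx => ?_) hx
  refine gradedSum_induction q (P := fun y => bracketC G x y ∈ gradedSum q C) (by simp)
    (fun y y' h h' => by rw [map_add]; exact Submodule.add_mem _ h h') (fun s hs y hy => ?_) hy
  exact gradedPiece_le_gradedSum q (hABC r hr s hs) (bracketC_mem_gradedPiece q hx hy)

theorem conj_mem_gradedSum {A B : Set ℝ} (hAB : ∀ a ∈ A, -a ∈ B) {x : ℂ ⊗[ℝ] lieAlg G}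
    (hx : x ∈ gradedSum q A) : conj _ x ∈ gradedSum q B := by
  refine gradedSum_induction q (P := fun x => conj _ x ∈ gradedSum q B) (by simp)
    (fun x x' h h' => by rw [map_add]; exact Submodule.add_mem _ h h') (fun r hr x hx => ?_) hx
  exact gradedPiece_le_gradedSum q (hAB r hr) (conj_mem_gradedPiece q hx)

theorem gradedSum_singleton (r : ℝ) : gradedSum q {r} = gradedPiece q r := iSup_singleton

theorem gradedSum_univ (hq : IsGradingElement q) : gradedSum q univ = ⊤ := by
  rw [gradedSum, iSup_univ]; exact hq

theorem gradedSum_Ioi_eq : gradedSum q (Ioi 0) = ⨆ r : {r : ℝ // 0 < r}, gradedPiece q r :=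
  iSup_subtype'

theorem gradedSum_Iio_eq : gradedSum q (Iio 0) = ⨆ r : {r : ℝ // 0 < r}, gradedPiece q (-r) := by
  refine le_antisymm (iSup₂_le fun r hr => ?_) (iSup_le fun r => ?_)
  · exact (le_of_eq (by simp)).trans
      (le_iSup (fun r : {r : ℝ // 0 < r} => gradedPiece q (-r)) ⟨-r, neg_pos.2 hr⟩)
  · exact gradedPiece_le_gradedSum q (neg_lt_zero.2 r.2)

theorem Ici_eq_union : Ici (0 : ℝ) = {0} ∪ Ioi 0 := by
  ext r; simp [le_iff_eq_or_lt, eq_comm]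

theorem gradedSum_Iio_sup_Ici (hq : IsGradingElement q) :
    gradedSum q (Iio 0) ⊔ gradedSum q (Ici 0) = ⊤ := by
  rw [← gradedSum_union, Iio_union_Ici, gradedSum_univ q hq]

/-- The real points of the sum of the nonnegative eigenspaces are of degree `0`. -/
theorem one_tmul_mem_gradedSum_Ici {X : lieAlg G} :
    (1 : ℂ) ⊗ₜ[ℝ] X ∈ gradedSum q (Ici 0) ↔ (1 : ℂ) ⊗ₜ[ℝ] X ∈ gradedPiece q 0 := by
  refine ⟨fun h => ?_, fun h => gradedPiece_le_gradedSum q self_mem_Ici h⟩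
  rw [Ici_eq_union, gradedSum_union, gradedSum_singleton] at h
  obtain ⟨x, hx, y, hy, hxy⟩ := Submodule.mem_sup.1 h
  -- A real vector equals its conjugate, which has degrees `≤ 0`. Its positive component `y` then
  -- has degrees both `> 0` and `≤ 0`, so it vanishes.
  have h1 : conj _ x + conj _ y = x + y := by
    rw [← map_add, hxy, conj_tmul, map_one]
  have hx' := conj_mem_gradedPiece q hx
  rw [neg_zero] at hx'
  have h0 : gradedPiece q 0 ≤ gradedSum q (Iic 0) := gradedPiece_le_gradedSum q self_mem_Iic
  have hneg : ∀ a ∈ Ioi (0 : ℝ), -a ∈ Iic (0 : ℝ) := fun a ha => mem_Iic.2 (by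
    linarith [mem_Ioi.1 ha])
  have h2 : y ∈ gradedSum q (Iic 0) := by
    have : y = conj _ x + conj _ y - x := by rw [h1]; abel
    rw [this]
    exact Submodule.sub_mem _ (Submodule.add_mem _ (h0 hx')
      (conj_mem_gradedSum q hneg hy)) (h0 hx)
  have h3 : y = 0 := Submodule.disjoint_def.1
    (disjoint_gradedSum q (Set.Iic_disjoint_Ioi le_rfl)) y h2 hy
  rw [← hxy, h3, add_zero]
  exact hx

end Grading

end HomogeneousComplex

namespace HomogeneousComplex

open NormedSpace Set Filter

section Concrete

variable {n : ℕ} {G : Subgroup (GL (Fin n) ℝ)} {𝔸 𝔹 : Type*} [NormedRing 𝔸] [NormedAlgebra ℝ 𝔸]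
  [FiniteDimensional ℝ 𝔸] [CompleteSpace 𝔸] [NormedRing 𝔹] [NormedAlgebra ℂ 𝔹]
  [FiniteDimensional ℂ 𝔹] [CompleteSpace 𝔹]
  (Φ : Matrix (Fin n) (Fin n) ℝ ≃ₐ[ℝ] 𝔸) (Ψ : Matrix (Fin n) (Fin n) ℂ ≃ₐ[ℂ] 𝔹)

/-! ### The complexification inside the complex matrices -/

/-- The inclusion of the real matrices in the complex matrices. -/
def realInclusion : 𝔸 →ₐ[ℝ] 𝔹 :=
  ((Ψ : Matrix (Fin n) (Fin n) ℂ →ₐ[ℂ] 𝔹).restrictScalars ℝ).comp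
    (Complex.ofRealAm.mapMatrix.comp (Φ.symm : 𝔸 →ₐ[ℝ] Matrix (Fin n) (Fin n) ℝ))

theorem realInclusion_map (M : Matrix (Fin n) (Fin n) ℝ) :
    realInclusion Φ Ψ (Φ M) = Ψ (M.map (fun x : ℝ => (x : ℂ))) := by
  change Ψ ((Φ.symm (Φ M)).map (fun x : ℝ => (x : ℂ))) = _
  rw [Φ.symm_apply_apply]

/-- The map `𝔤 ⊗ ℂ → M_n(ℂ)`. -/
def complexify (G : Subgroup (GL (Fin n) ℝ)) : ℂ ⊗[ℝ] lieAlg G →ₗ[ℂ] 𝔹 :=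
  LinearMap.liftBaseChange ℂ ((realInclusion Φ Ψ).toLinearMap ∘ₗ Φ.toLinearMap ∘ₗ
    (lieAlg G).toSubmodule.subtype)

theorem complexify_tmul (z : ℂ) (X : lieAlg G) :
    complexify Φ Ψ G (z ⊗ₜ[ℝ] X) = z • realInclusion Φ Ψ (Φ X) := LinearMap.liftBaseChange_tmul ..

/-- The matrices of `𝔤` are real, so `A + iB = 0` separates entrywise into real and imaginary parts.
-/
theorem complexify_injective : Function.Injective (complexify Φ Ψ G) := by
  refine (injective_iff_map_eq_zero _).2 fun x hx => ?_
  obtain ⟨a, b, rfl⟩ := exists_eq_one_tmul_add_I_tmul x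
  rw [map_add, complexify_tmul, complexify_tmul, one_smul, realInclusion_map, realInclusion_map,
    ← map_smul, ← map_add, map_eq_zero_iff _ Ψ.injective] at hx
  have hij : ∀ i j, (a : Matrix (Fin n) (Fin n) ℝ) i j = 0 ∧
      (b : Matrix (Fin n) (Fin n) ℝ) i j = 0 := fun i j => by
    have := congrFun (congrFun hx i) j
    simp only [Matrix.add_apply, Matrix.map_apply, Matrix.smul_apply, Matrix.zero_apply,
      smul_eq_mul] at this
    have h1 := congrArg Complex.re this
    have h2 := congrArg Complex.im this
    simp only [Complex.add_re, Complex.add_im, Complex.mul_re, Complex.mul_im, Complex.I_re,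
      Complex.I_im, Complex.ofReal_re, Complex.ofReal_im, Complex.zero_re, Complex.zero_im] at h1 h2
    constructor <;> linarith
  have ha : a = 0 := Subtype.ext (Matrix.ext fun i j => (hij i j).1)
  have hb : b = 0 := Subtype.ext (Matrix.ext fun i j => (hij i j).2)
  rw [ha, hb, TensorProduct.tmul_zero, TensorProduct.tmul_zero, add_zero]

theorem complexify_bracketC (x y : ℂ ⊗[ℝ] lieAlg G) : complexify Φ Ψ G (bracketC G x y) =
    complexify Φ Ψ G x * complexify Φ Ψ G y - complexify Φ Ψ G y * complexify Φ Ψ G x := by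
  induction x using TensorProduct.induction_on with
  | zero => simp
  | add x x' h h' =>
    rw [map_add, LinearMap.add_apply, map_add, h, h', map_add]
    noncomm_ring
  | tmul z X =>
    induction y using TensorProduct.induction_on with
    | zero => simp
    | add y y' h h' =>
      rw [map_add, map_add, h, h', map_add]
      noncomm_ring
    | tmul w Y =>
      rw [bracketC_tmul, complexify_tmul, complexify_tmul, complexify_tmul]
      have : ((⁅X, Y⁆ : lieAlg G) : Matrix (Fin n) (Fin n) ℝ) = X * Y - Y * X := Ring.lie_def _ _
      rw [this, map_sub, map_mul, map_mul, map_sub, map_mul, map_mul, smul_mul_smul_comm,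
        smul_mul_smul_comm, mul_comm w z, smul_sub]

variable (q : lieAlg G)

theorem mem_gradedPiece_iff {r : ℝ} {x : ℂ ⊗[ℝ] lieAlg G} : x ∈ gradedPiece q r ↔
    complexify Φ Ψ G (Complex.I ⊗ₜ[ℝ] q) * complexify Φ Ψ G x -
      complexify Φ Ψ G x * complexify Φ Ψ G (Complex.I ⊗ₜ[ℝ] q) = (r : ℂ) • complexify Φ Ψ G x := by
  rw [mem_gradedPiece, ← complexify_bracketC, ← map_smul, (complexify_injective Φ Ψ).eq_iff]

theorem one_tmul_mem_gradedPiece_zero_iff {X : lieAlg G} :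
    (1 : ℂ) ⊗ₜ[ℝ] X ∈ gradedPiece q 0 ↔
      Φ X * Φ q = Φ q * Φ X := by
  have key : (1 : ℂ) ⊗ₜ[ℝ] X ∈ gradedPiece q 0 ↔ ⁅q, X⁆ = 0 := by
    rw [mem_gradedPiece, bracketC_tmul, Complex.ofReal_zero, zero_smul, mul_one]
    constructor
    · intro h
      have h1 := congrArg (fun x => (-Complex.I) • x) h
      simp only [TensorProduct.smul_tmul', smul_eq_mul, neg_mul, Complex.I_mul_I, neg_neg,
        smul_zero] at h1
      exact eq_zero_of_one_tmul_eq_zero h1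
    · intro h
      rw [h, TensorProduct.tmul_zero]
  rw [key, ← map_mul, ← map_mul, Φ.injective.eq_iff, Subtype.ext_iff]
  change (q : Matrix (Fin n) (Fin n) ℝ) * X - X * q = 0 ↔ _
  rw [sub_eq_zero, eq_comm]

/-- The subalgebra of `M_n(ℂ)` spanned by the eigenvectors with eigenvalues in `A`. -/
def gradedImage (A : Set ℝ) : Submodule ℂ 𝔹 := (gradedSum q A).map (complexify Φ Ψ G)

theorem lie_mem_gradedImage {A B C : Set ℝ} (hABC : ∀ a ∈ A, ∀ b ∈ B, a + b ∈ C) {X Y : 𝔹}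
    (hX : X ∈ gradedImage Φ Ψ q A) (hY : Y ∈ gradedImage Φ Ψ q B) :
    X * Y - Y * X ∈ gradedImage Φ Ψ q C := by
  obtain ⟨x, hx, rfl⟩ := hX
  obtain ⟨y, hy, rfl⟩ := hY
  exact ⟨bracketC G x y, bracketC_mem_gradedSum q hABC hx hy, complexify_bracketC Φ Ψ x y⟩

/-- The adjoint action of `g ∈ G` on `𝔤`. -/
theorem conj_mem_lieAlg (g : G) (X : lieAlg G) :
    ((g : GL (Fin n) ℝ) : Matrix (Fin n) (Fin n) ℝ) * X *
      (((g⁻¹ : G) : GL (Fin n) ℝ) : Matrix (Fin n) (Fin n) ℝ) ∈ lieAlg G := by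
  obtain ⟨c, c0, hc⟩ := X.2
  exact ⟨fun t => g * c t * g⁻¹, by simp [c0], hc.conj g⟩

theorem exists_complexify_conj_eq (g : G) (x : ℂ ⊗[ℝ] lieAlg G) : ∃ y, complexify Φ Ψ G y =
    realInclusion Φ Ψ (groupHom Φ G g) * complexify Φ Ψ G x *
      realInclusion Φ Ψ (groupHom Φ G g⁻¹) := by
  induction x using TensorProduct.induction_on with
  | zero => exact ⟨0, by simp⟩
  | add x x' h h' =>
    obtain ⟨y, hy⟩ := h
    obtain ⟨y', hy'⟩ := h'
    exact ⟨y + y', by rw [map_add, hy, hy', map_add]; noncomm_ring⟩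
  | tmul z X =>
    refine ⟨z ⊗ₜ ⟨_, conj_mem_lieAlg g X⟩, ?_⟩
    rw [complexify_tmul, complexify_tmul, mul_smul_comm, smul_mul_assoc, groupHom_apply,
      groupHom_apply, ← map_mul, ← map_mul, ← map_mul, ← map_mul]

/-- An element of `H` commutes with `Q`, so its adjoint action commutes with `ad Q` and preserves
each eigenspace. -/
theorem conj_mem_gradedImage {k : G} (hk : k ∈ centralizer q) {A : Set ℝ} {X : 𝔹}
    (hX : X ∈ gradedImage Φ Ψ q A) : realInclusion Φ Ψ (groupHom Φ G k) * X *
      realInclusion Φ Ψ (groupHom Φ G k⁻¹) ∈ gradedImage Φ Ψ q A := by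
  obtain ⟨x, hx, rfl⟩ := hX
  set K := realInclusion Φ Ψ (groupHom Φ G k)
  set K' := realInclusion Φ Ψ (groupHom Φ G k⁻¹)
  have hK : K' * K = 1 := by simp only [K, K', ← map_mul]; simp
  have hK' : K * K' = 1 := by simp only [K, K', ← map_mul]; simp
  set Q := complexify Φ Ψ G (Complex.I ⊗ₜ[ℝ] q) with hQ
  have hKQ : K * Q = Q * K := by
    rw [hQ, complexify_tmul, mul_smul_comm, smul_mul_assoc, ← map_mul, ← map_mul, groupHom_apply,
      ← map_mul, ← map_mul]
    congr 3
  have hQK : K' * Q = Q * K' := by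
    calc K' * Q = K' * Q * (K * K') := by rw [hK', mul_one]
      _ = K' * (Q * K) * K' := by simp only [mul_assoc]
      _ = Q * K' := by rw [← hKQ, ← mul_assoc, hK, one_mul]
  refine gradedSum_induction q
    (P := fun x => K * complexify Φ Ψ G x * K' ∈ gradedImage Φ Ψ q A) (by simp)
    (fun x x' h h' => ?_) (fun r hr x hx => ?_) hx
  · rw [map_add, mul_add, add_mul]
    exact Submodule.add_mem _ h h'
  · obtain ⟨y, hy⟩ := exists_complexify_conj_eq Φ Ψ k x
    refine ⟨y, gradedPiece_le_gradedSum q hr ((mem_gradedPiece_iff Φ Ψ q).2 ?_), hy⟩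
    rw [mem_gradedPiece_iff Φ Ψ q, ← hQ] at hx
    rw [← hQ, hy, ← smul_mul_assoc, ← mul_smul_comm, ← hx]
    change Q * (K * complexify Φ Ψ G x * K') - K * complexify Φ Ψ G x * K' * Q = _
    rw [mul_assoc (K * complexify Φ Ψ G x) K' Q, hQK, ← mul_assoc Q, ← mul_assoc Q, ← hKQ]
    noncomm_ring

/-- The dimension of `G/H`. -/
def cosetDim : ℕ := Module.finrank ℂ (gradedSum q (Iio 0))

/-- A linear coordinate system on the negative part of `𝔤 ⊗ ℂ`. -/
def negCoord : Model (cosetDim q) ≃ₗ[ℂ] gradedSum q (Iio 0) :=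
  LinearEquiv.ofFinrankEq _ _ finrank_euclideanSpace_fin

/-- The negative part of `𝔤 ⊗ ℂ` as a space of complex matrices. -/
def negMap : Model (cosetDim q) →L[ℂ] 𝔹 :=
  LinearMap.toContinuousLinearMap (complexify Φ Ψ G ∘ₗ (gradedSum q (Iio 0)).subtype ∘ₗ
    (negCoord q : Model (cosetDim q) →ₗ[ℂ] gradedSum q (Iio 0)))

theorem negMap_apply (z : Model (cosetDim q)) :
    negMap Φ Ψ q z = complexify Φ Ψ G (negCoord q z : ℂ ⊗[ℝ] lieAlg G) := rfl

theorem range_negMap : LinearMap.range (negMap Φ Ψ q : Model (cosetDim q) →ₗ[ℂ] 𝔹) =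
    gradedImage Φ Ψ q (Iio 0) := by
  ext X
  constructor
  · rintro ⟨z, rfl⟩
    exact ⟨_, (negCoord q z).2, rfl⟩
  · rintro ⟨x, hx, rfl⟩
    refine ⟨(negCoord q).symm ⟨x, hx⟩, ?_⟩
    change negMap Φ Ψ q _ = _
    rw [negMap_apply, LinearEquiv.apply_symm_apply]

theorem gradedImage_sup (hq : IsGradingElement q) :
    gradedImage Φ Ψ q (Iio 0) ⊔ gradedImage Φ Ψ q (Ici 0) = LinearMap.range (complexify Φ Ψ G) := by
  rw [gradedImage, gradedImage, ← Submodule.map_sup, gradedSum_Iio_sup_Ici q hq, Submodule.map_top]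

/-- The decomposition of `𝔤 ⊗ ℂ` in negative and nonnegative part. -/
def gradedSplitting (hq : IsGradingElement q) : Splitting (Model (cosetDim q)) 𝔹 where
  a := negMap Φ Ψ q
  p := gradedImage Φ Ψ q (Ici 0)
  a_inj z z' h := by
    rw [negMap_apply, negMap_apply, (complexify_injective Φ Ψ).eq_iff] at h
    exact (negCoord q).injective (Subtype.ext h)
  disj := by
    rw [range_negMap]
    exact Submodule.disjoint_map (complexify_injective Φ Ψ)
      (disjoint_gradedSum q (Set.Iio_disjoint_Ici le_rfl))
  p_lie X hX Y hY := lie_mem_gradedImage Φ Ψ q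
    (fun a ha b hb => add_nonneg (mem_Ici.1 ha) (mem_Ici.1 hb)) hX hY
  s_lie := by
    rw [range_negMap, gradedImage_sup Φ Ψ q hq]
    rintro _ ⟨x, rfl⟩ _ ⟨y, rfl⟩
    exact ⟨bracketC G x y, complexify_bracketC Φ Ψ x y⟩

theorem gradedSplitting_s (hq : IsGradingElement q) :
    (gradedSplitting Φ Ψ q hq).s = LinearMap.range (complexify Φ Ψ G) := by
  rw [← gradedImage_sup Φ Ψ q hq, ← range_negMap]
  rfl

theorem complexify_mem_gradedImage {A : Set ℝ} {x : ℂ ⊗[ℝ] lieAlg G} :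
    complexify Φ Ψ G x ∈ gradedImage Φ Ψ q A ↔ x ∈ gradedSum q A := by
  refine ⟨?_, fun h => ⟨x, h, rfl⟩⟩
  rintro ⟨y, hy, hyx⟩
  exact complexify_injective Φ Ψ hyx ▸ hy

/-- The data of the homogeneous space of a closed matrix group defined by a grading element. -/
def gradedCosetData (hG : IsClosed (G : Set (GL (Fin n) ℝ))) (hq : IsGradingElement q) :
    CosetData (centralizer q) (Model (cosetDim q)) 𝔸 𝔹 where
  J := groupHom Φ G
  inducing := isInducing_groupHom Φ
  inj := groupHom_injective Φ
  closed := expClosed_groupHom Φ hG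
  ι := realInclusion Φ Ψ
  q := Φ q
  mem_H k := by
    rw [groupHom_apply, ← map_mul, ← map_mul, Φ.injective.eq_iff]
    rfl
  S := gradedSplitting Φ Ψ q hq
  lie_le X hX := by
    obtain ⟨Y, rfl⟩ := (mem_lie_groupHom Φ).1 hX
    rw [gradedSplitting_s]
    exact ⟨(1 : ℂ) ⊗ₜ Y, by rw [complexify_tmul, one_smul]⟩
  -- For the negative vector `x` with coordinates `z`, the real vector `x + conj x` differs from `x`
  -- by `conj x`, which has positive degrees.
  exists_real z := by
    obtain ⟨X, hX⟩ := exists_add_conj_eq (negCoord q z : ℂ ⊗[ℝ] lieAlg G)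
    refine ⟨Φ X, (mem_lie_groupHom Φ).2 ⟨X, rfl⟩, ?_⟩
    refine ⟨conj _ (negCoord q z : ℂ ⊗[ℝ] lieAlg G), conj_mem_gradedSum q (fun a ha =>
      mem_Ici.2 (neg_nonneg.2 (le_of_lt (mem_Iio.1 ha)))) (negCoord q z).2, ?_⟩
    rw [← one_smul ℂ (realInclusion Φ Ψ (Φ X)), ← complexify_tmul, ← hX, map_add]
    exact (add_sub_cancel_left _ _).symm
  mem_p_iff X hX := by
    obtain ⟨Y, rfl⟩ := (mem_lie_groupHom Φ).1 hX
    rw [← one_tmul_mem_gradedPiece_zero_iff, ← one_tmul_mem_gradedSum_Ici,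
      ← complexify_mem_gradedImage Φ Ψ, complexify_tmul, one_smul]
    rfl
  conj_mem_p k hk X hX := conj_mem_gradedImage Φ Ψ q hk hX

end Concrete

end HomogeneousComplex

namespace HomogeneousComplex

open NormedSpace Set Filter

/-! ### The complexified tangent spaces -/

section Tangent

variable {T : Type*} [AddCommGroup T] [Module ℂ T] [Module ℝ T] [IsScalarTower ℝ ℂ T]

variable (T) in
/-- The projection `T ⊗ ℂ → T`, `z ⊗ t ↦ z t`, with kernel the `(0,1)` vectors. -/
def contractC : ℂ ⊗[ℝ] T →ₗ[ℂ] T := LinearMap.liftBaseChange ℂ (LinearMap.id : T →ₗ[ℝ] T)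

theorem contractC_tmul (z : ℂ) (t : T) : contractC T (z ⊗ₜ[ℝ] t) = z • t :=
  LinearMap.liftBaseChange_tmul ..

/-- The contractions of `v` and of its conjugate record the `(1,0)` and `(0,1)` components of `v`;
together they are injective. -/
theorem eq_zero_of_contractC {v : ℂ ⊗[ℝ] T} (h : contractC T v = 0)
    (h' : contractC T (conj T v) = 0) : v = 0 := by
  obtain ⟨a, b, rfl⟩ := exists_eq_one_tmul_add_I_tmul v
  simp only [map_add, conj_tmul, contractC_tmul, map_one, Complex.conj_I, one_smul, neg_smul]
    at h h'
  have ha : (2 : ℂ) • a = 0 := by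
    calc (2 : ℂ) • a = (a + Complex.I • b) + (a + -(Complex.I • b)) := by rw [two_smul]; abel
      _ = 0 := by rw [h, h', add_zero]
  have ha : a = 0 := (smul_eq_zero.1 ha).resolve_left two_ne_zero
  rw [ha, zero_add] at h
  rw [ha, (smul_eq_zero.1 h).resolve_left Complex.I_ne_zero]
  simp

theorem contractC_complexStructure (v : ℂ ⊗[ℝ] T) :
    contractC T ((complexStructure T).baseChange ℂ v) = Complex.I • contractC T v := by
  induction v using TensorProduct.induction_on with
  | zero => simp
  | add x y hx hy => simp only [map_add, hx, hy, smul_add]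
  | tmul z t =>
    rw [LinearMap.baseChange_tmul, contractC_tmul, contractC_tmul]
    exact smul_comm z Complex.I t

theorem conj_complexStructure (v : ℂ ⊗[ℝ] T) : conj T ((complexStructure T).baseChange ℂ v) =
    (complexStructure T).baseChange ℂ (conj T v) := by
  induction v using TensorProduct.induction_on with
  | zero => simp
  | add x y hx hy => simp only [map_add, hx, hy]
  | tmul z t => simp only [LinearMap.baseChange_tmul, conj_tmul]

theorem eq_zero_of_I_smul_eq_neg {t : T} (h : Complex.I • t = -Complex.I • t) : t = 0 := by
  rw [neg_smul, eq_neg_iff_add_eq_zero, ← two_smul ℂ, smul_smul] at h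
  exact (smul_eq_zero.1 h).resolve_left (by simp)

/-- Contraction intertwines the complexified complex structure with multiplication by `i`. The
conjugate of a `(1,0)` vector is a `-i`-eigenvector, so its contraction `t` satisfies `i t = -i t`.
-/
theorem mem_vectors10_iff {v : ℂ ⊗[ℝ] T} : v ∈ vectors10 T ↔ contractC T (conj T v) = 0 := by
  rw [vectors10, Module.End.mem_eigenspace_iff]
  constructor
  · intro h
    have h1 := congrArg (fun v => contractC T (conj T v)) h
    simp only [conj_complexStructure, contractC_complexStructure, conj_smul, Complex.conj_I,
      map_smul] at h1
    exact eq_zero_of_I_smul_eq_neg h1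
  · intro h
    rw [← sub_eq_zero]
    apply eq_zero_of_contractC
    · rw [map_sub, contractC_complexStructure, map_smul, sub_self]
    · rw [map_sub, conj_complexStructure, conj_smul, map_sub, contractC_complexStructure, map_smul,
        h, smul_zero, smul_zero, sub_self]

theorem mem_vectors01_iff {v : ℂ ⊗[ℝ] T} : v ∈ vectors01 T ↔ contractC T v = 0 := by
  rw [vectors01, Module.End.mem_eigenspace_iff]
  constructor
  · intro h
    have h1 := congrArg (contractC T) h
    rw [contractC_complexStructure, map_smul] at h1
    exact eq_zero_of_I_smul_eq_neg h1
  · intro h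
    rw [← sub_eq_zero]
    apply eq_zero_of_contractC
    · rw [map_sub, contractC_complexStructure, map_smul, h, smul_zero, smul_zero, sub_self]
    · rw [map_sub, conj_complexStructure, conj_smul, map_sub, contractC_complexStructure, map_smul,
        map_neg, Complex.conj_I, neg_neg, sub_self]

variable {V : Type*} [AddCommGroup V] [Module ℝ V] {D : V →ₗ[ℝ] T} {δ : ℂ ⊗[ℝ] V →ₗ[ℂ] T}

theorem contractC_baseChange (hD : ∀ X, D X = δ ((1 : ℂ) ⊗ₜ X)) (x : ℂ ⊗[ℝ] V) :
    contractC T (D.baseChange ℂ x) = δ x := by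
  induction x using TensorProduct.induction_on with
  | zero => simp
  | add x y hx hy => simp only [map_add, hx, hy]
  | tmul z v =>
    rw [LinearMap.baseChange_tmul, contractC_tmul, hD, ← map_smul, TensorProduct.smul_tmul',
      smul_eq_mul, mul_one]

theorem conj_baseChange (x : ℂ ⊗[ℝ] V) :
    conj T (D.baseChange ℂ x) = D.baseChange ℂ (conj V x) := by
  induction x using TensorProduct.induction_on with
  | zero => simp
  | add x y hx hy => simp only [map_add, hx, hy]
  | tmul z v => simp only [LinearMap.baseChange_tmul, conj_tmul]

/-- If a real linear map extends to a complex linear map on `V ⊗ ℂ` which vanishes on `P` and is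
surjective on the conjugate `N` of `P`, then its complexification maps `N` onto the `(1,0)` vectors
and `P` onto the `(0,1)` vectors. -/
theorem map_baseChange_eq {N P : Submodule ℂ (ℂ ⊗[ℝ] V)} (hD : ∀ X, D X = δ ((1 : ℂ) ⊗ₜ X))
    (hNP : ∀ x ∈ N, conj V x ∈ P) (hP : ∀ x ∈ P, δ x = 0)
    (hN : ∀ t, ∃ x ∈ N, δ x = t) :
    N.map (D.baseChange ℂ) = vectors10 T ∧ P.map (D.baseChange ℂ) = vectors01 T := by
  constructor
  · apply le_antisymm
    · rintro _ ⟨x, hx, rfl⟩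
      rw [mem_vectors10_iff, conj_baseChange, contractC_baseChange hD, hP _ (hNP x hx)]
    · intro v hv
      -- Matching one contraction suffices: the contractions of both conjugates vanish, so
      -- `eq_zero_of_contractC` applies to the difference.
      obtain ⟨x, hx, hxv⟩ := hN (contractC T v)
      refine ⟨x, hx, sub_eq_zero.1 (eq_zero_of_contractC ?_ ?_)⟩
      · rw [map_sub, contractC_baseChange hD, hxv, sub_self]
      · rw [map_sub, map_sub, conj_baseChange, contractC_baseChange hD, hP _ (hNP x hx),
          mem_vectors10_iff.1 hv, sub_self]
  · apply le_antisymm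
    · rintro _ ⟨x, hx, rfl⟩
      rw [mem_vectors01_iff, contractC_baseChange hD, hP x hx]
    · intro v hv
      obtain ⟨x, hx, hxv⟩ := hN (contractC T (conj T v))
      refine ⟨conj V x, hNP x hx, sub_eq_zero.1 (eq_zero_of_contractC ?_ ?_)⟩
      · rw [map_sub, contractC_baseChange hD, hP _ (hNP x hx), mem_vectors01_iff.1 hv, sub_self]
      · rw [map_sub, map_sub, conj_baseChange, contractC_baseChange hD, conj_conj, hxv, sub_self]

end Tangent

/-! ### The complex manifold of a closed matrix group and its tangent spaces. -/

section ComplexManifold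

variable {n : ℕ} {G : Subgroup (GL (Fin n) ℝ)} {𝔸 𝔹 : Type*} [NormedRing 𝔸] [NormedAlgebra ℝ 𝔸]
  [FiniteDimensional ℝ 𝔸] [CompleteSpace 𝔸] [NormedRing 𝔹] [NormedAlgebra ℂ 𝔹]
  [FiniteDimensional ℂ 𝔹] [CompleteSpace 𝔹]
  {Φ : Matrix (Fin n) (Fin n) ℝ ≃ₐ[ℝ] 𝔸} {Ψ : Matrix (Fin n) (Fin n) ℂ ≃ₐ[ℂ] 𝔹}
  {q : lieAlg G} {hG : IsClosed (G : Set (GL (Fin n) ℝ))} {hq : IsGradingElement q}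
  (C : (gradedCosetData Φ Ψ q hG hq).LocalChart)

/-- The complexified differential of `G → G/H` at `g`, on `𝔤 ⊗ ℂ`. -/
def diffC (Φ : Matrix (Fin n) (Fin n) ℝ ≃ₐ[ℝ] 𝔸) (Ψ : Matrix (Fin n) (Fin n) ℂ ≃ₐ[ℂ] 𝔹)
    (hG : IsClosed (G : Set (GL (Fin n) ℝ))) (hq : IsGradingElement q) (g : G) :
    ℂ ⊗[ℝ] lieAlg G →ₗ[ℂ] Model (cosetDim q) :=
  (gradedCosetData Φ Ψ q hG hq).diff g ∘ₗ complexify Φ Ψ G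

theorem diffC_one_tmul (g : G) (X : lieAlg G) : diffC Φ Ψ hG hq g ((1 : ℂ) ⊗ₜ X) =
    (gradedCosetData Φ Ψ q hG hq).diff g (realInclusion Φ Ψ (Φ X)) := by
  rw [diffC, LinearMap.comp_apply, complexify_tmul, one_smul]

theorem diffC_eq_zero_iff (g : G) (x : ℂ ⊗[ℝ] lieAlg G) :
    diffC Φ Ψ hG hq g x = 0 ↔ x ∈ gradedSum q (Ici 0) := by
  rw [← complexify_mem_gradedImage Φ Ψ]
  refine (gradedCosetData Φ Ψ q hG hq).diff_eq_zero_iff g ?_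
  change _ ∈ (gradedSplitting Φ Ψ q hq).s
  rw [gradedSplitting_s]
  exact ⟨x, rfl⟩

theorem exists_diffC_one_tmul_eq (g : G) (t : Model (cosetDim q)) :
    ∃ X : lieAlg G, diffC Φ Ψ hG hq g ((1 : ℂ) ⊗ₜ X) = t := by
  obtain ⟨X, hX, h⟩ := (gradedCosetData Φ Ψ q hG hq).exists_diff_eq g t
  obtain ⟨Y, rfl⟩ := (mem_lie_groupHom Φ).1 hX
  exact ⟨Y, by rw [diffC_one_tmul]; exact h⟩

theorem hasMFDerivAt_mk_mul (g : G) {c : ℝ → G} {X : lieAlg G} (c0 : c 0 = 1)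
    (hc : HasVelocity c (X : Matrix (Fin n) (Fin n) ℝ)) :
    letI := C.chartedSpace
    HasMFDerivAt 𝓘(ℝ, ℝ) 𝓘(ℝ, Model (cosetDim q))
      (fun t : ℝ => ((g * c t : G) : G ⧸ centralizer q)) 0
      (ContinuousLinearMap.toSpanSingleton ℝ (diffC Φ Ψ hG hq g ((1 : ℂ) ⊗ₜ X))) := by
  rw [diffC_one_tmul]
  exact C.hasMFDerivAt_mk ((hasVelocity_iff Φ).1 hc) c0 g

theorem isHomogeneousComplexManifold :
    letI := C.chartedSpace
    IsHomogeneousComplexManifold (centralizer q) (d := cosetDim q) := by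
  letI := C.chartedSpace
  refine ⟨(gradedCosetData Φ Ψ q hG hq).t2Space_quotient,
    (gradedCosetData Φ Ψ q hG hq).secondCountableTopology_quotient, C.isManifold, ?_, fun g => ?_,
    C.contMDiff_smul⟩
  · intro k s f hs hf x hx
    have h : ContDiffAt ℝ ∞ (fun x => (gradedCosetData Φ Ψ q hG hq).J (f x)) x :=
      (hf.contDiffOn Φ).contDiffAt (hs.mem_nhds hx)
    exact (C.contMDiffAt_mk h).contMDiffWithinAt
  · let D : lieAlg G →ₗ[ℝ] Model (cosetDim q) :=
      ((diffC Φ Ψ hG hq g).restrictScalars ℝ) ∘ₗ TensorProduct.mk ℝ ℂ (lieAlg G) 1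
    have hD : Function.Surjective D := fun t => by
      obtain ⟨X, hX⟩ := exists_diffC_one_tmul_eq (Φ := Φ) (Ψ := Ψ) (hG := hG) (hq := hq) g t
      exact ⟨X, hX⟩
    exact ⟨D, fun c X c0 hc => hasMFDerivAt_mk_mul C g c0 hc, hD⟩

/-- Uniqueness of derivatives forces `D` to be the restriction of `diffC` to real vectors, whose
kernel on `𝔤 ⊗ ℂ` is the nonnegative part. The real points of that part are `𝔥`, while conjugation
carries negative degrees to positive ones, as `map_baseChange_eq` requires. -/
theorem tangentDecomposition :
    letI := C.chartedSpace
    TangentDecomposition q (d := cosetDim q) := by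
  letI := C.chartedSpace
  intro g D hD
  have hDX : ∀ X : lieAlg G, D X = diffC Φ Ψ hG hq g ((1 : ℂ) ⊗ₜ X) := fun X => by
    obtain ⟨c, c0, hc⟩ := X.2
    have h1 := hD c X c0 hc
    have h2 := hasMFDerivAt_mk_mul C g c0 hc
    have h3 := hasMFDerivAt_unique h1 h2
    have h4 := congrArg (fun L : ℝ →L[ℝ] Model (cosetDim q) => L 1) h3
    exact (one_smul ℝ (D X)).symm.trans (h4.trans (one_smul ℝ _))
  refine ⟨?_, ?_⟩
  · ext X
    rw [LinearMap.mem_ker, LinearMap.mem_ker, hDX]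
    refine (diffC_eq_zero_iff g _).trans ?_
    rw [one_tmul_mem_gradedSum_Ici, one_tmul_mem_gradedPiece_zero_iff Φ, ← map_mul, ← map_mul,
      Φ.injective.eq_iff, Subtype.ext_iff]
    change _ ↔ (q : Matrix (Fin n) (Fin n) ℝ) * X - X * q = 0
    rw [sub_eq_zero, eq_comm]
  · rw [← gradedSum_Iio_eq, ← gradedSum_Ioi_eq]
    refine map_baseChange_eq (T := Model (cosetDim q)) (δ := diffC Φ Ψ hG hq g) hDX
      (fun x hx => conj_mem_gradedSum q (fun a ha => neg_pos.2 (mem_Iio.1 ha)) hx)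
      (fun x hx => (diffC_eq_zero_iff g x).2 (gradedSum_mono q Ioi_subset_Ici_self hx)) fun t => ?_
    obtain ⟨X, hX⟩ := exists_diffC_one_tmul_eq (Φ := Φ) (Ψ := Ψ) (hG := hG) (hq := hq) g t
    obtain ⟨x, hx, y, hy, hxy⟩ := Submodule.mem_sup.1
      ((gradedSum_Iio_sup_Ici q hq).symm ▸ Submodule.mem_top : (1 : ℂ) ⊗ₜ[ℝ] X ∈ _)
    refine ⟨x, hx, ?_⟩
    rw [← hX, ← hxy, map_add, (diffC_eq_zero_iff g y).2 hy, add_zero]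

end ComplexManifold

end HomogeneousComplex

namespace HomogeneousComplex

open NormedSpace Set Filter

/-! ### The differential of a representation of `H` -/

/-- A continuous one-parameter group in a Banach algebra is differentiable at `0`. -/
theorem exists_hasDerivAt_of_map_add {𝔻 : Type*} [NormedRing 𝔻] [NormedAlgebra ℝ 𝔻]
    [CompleteSpace 𝔻] {f : ℝ → 𝔻} (hf : Continuous f) (h0 : f 0 = 1)
    (hadd : ∀ s t, f (s + t) = f s * f t) : ∃ B, HasDerivAt f B 0 := by
  let F : ℝ → 𝔻 := fun t => ∫ s in (0 : ℝ)..t, f s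
  have hF : ∀ t, HasDerivAt F (f t) t := fun t =>
    intervalIntegral.integral_hasDerivAt_right (hf.intervalIntegrable _ _)
      (hf.stronglyMeasurableAtFilter _ _) hf.continuousAt
  have hF0 : F 0 = 0 := intervalIntegral.integral_same
  have hslope : Tendsto (fun t => t⁻¹ • F t) (𝓝[≠] 0) (𝓝 1) := by
    have := (hF 0).tendsto_slope_zero
    simpa [hF0, h0] using this
  have hunit : ∀ᶠ t in 𝓝[≠] (0 : ℝ), IsUnit (t⁻¹ • F t) :=
    hslope.eventually_mem (Units.isOpen.mem_nhds (isUnit_one : IsUnit (1 : 𝔻)))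
  obtain ⟨a, ha, ha0⟩ := (hunit.and self_mem_nhdsWithin).exists
  have haF : IsUnit (F a) := by
    have := (IsUnit.map (algebraMap ℝ 𝔻) (IsUnit.mk0 a ha0)).mul ha
    rwa [← Algebra.smul_def, smul_smul, mul_inv_cancel₀ ha0, one_smul] at this
  obtain ⟨u, hu⟩ := haF
  -- Integrating `f(t + s) = f(t) f(s)` over `s ∈ [0, a]` gives `f(t) F(a) = F(t + a) - F(t)`. For
  -- small `a ≠ 0`, `F(a)` is invertible because `F(a)/a` is close to `1`, so `f` is as
  -- differentiable as `F`.
  have key : ∀ t, f t = (F (t + a) - F t) * ((u⁻¹ : 𝔻ˣ) : 𝔻) := by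
    intro t
    rw [Units.eq_mul_inv_iff_mul_eq, hu]
    calc f t * F a = ∫ s in (0 : ℝ)..a, f t * f s :=
          ((ContinuousLinearMap.mul ℝ 𝔻 (f t)).intervalIntegral_comp_comm
            (hf.intervalIntegrable _ _)).symm
      _ = ∫ s in (0 : ℝ)..a, f (t + s) := by simp only [hadd]
      _ = ∫ s in t..(t + a), f s := by
          rw [intervalIntegral.integral_comp_add_left (fun s => f s) t, add_zero]
      _ = F (t + a) - F t := (intervalIntegral.integral_interval_sub_left
          (hf.intervalIntegrable _ _) (hf.intervalIntegrable _ _)).symm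
  refine ⟨(f (0 + a) - f 0) * ((u⁻¹ : 𝔻ˣ) : 𝔻), ?_⟩
  have h1 : HasDerivAt (fun t => F (t + a)) (f (0 + a)) 0 := (hF (0 + a)).comp_add_const 0 a
  exact ((h1.sub (hF 0)).mul_const _).congr_of_eventuallyEq (Eventually.of_forall key)

theorem fst_exp {𝔸 𝔻 : Type*} [NormedRing 𝔸] [NormedAlgebra ℝ 𝔸] [CompleteSpace 𝔸] [NormedRing 𝔻]
    [NormedAlgebra ℝ 𝔻] [CompleteSpace 𝔻] (x : 𝔸 × 𝔻) : (exp x).1 = exp x.1 :=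
  map_exp' (AlgHom.fst ℝ 𝔸 𝔻) continuous_fst x

theorem snd_exp {𝔸 𝔻 : Type*} [NormedRing 𝔸] [NormedAlgebra ℝ 𝔸] [CompleteSpace 𝔸] [NormedRing 𝔻]
    [NormedAlgebra ℝ 𝔻] [CompleteSpace 𝔻] (x : 𝔸 × 𝔻) : (exp x).2 = exp x.2 :=
  map_exp' (AlgHom.snd ℝ 𝔸 𝔻) continuous_snd x

/-! ### The Lie algebra of the graph of a representation. -/

section Graph

variable {Γ E 𝔸 𝔹 𝔻 : Type*} [Group Γ] [TopologicalSpace Γ] [IsTopologicalGroup Γ]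
  [NormedAddCommGroup E] [NormedSpace ℂ E] [FiniteDimensional ℂ E]
  [NormedRing 𝔸] [NormedAlgebra ℝ 𝔸] [FiniteDimensional ℝ 𝔸] [CompleteSpace 𝔸]
  [NormedRing 𝔹] [NormedAlgebra ℂ 𝔹] [FiniteDimensional ℂ 𝔹] [CompleteSpace 𝔹]
  [NormedRing 𝔻] [NormedAlgebra ℝ 𝔻] [FiniteDimensional ℝ 𝔻] [CompleteSpace 𝔻]

namespace CosetData

variable {H : Subgroup Γ} (D : CosetData H E 𝔸 𝔹) (rho : H →* 𝔻)

/-- The graph of a representation of `H`, as a submonoid of an algebra. -/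
def graph : Submonoid (𝔸 × 𝔻) := MonoidHom.mrange ((D.J.comp H.subtype).prod rho)

theorem mem_graph {x : 𝔸 × 𝔻} : x ∈ D.graph rho ↔ ∃ k : H, D.J k = x.1 ∧ rho k = x.2 := by
  refine MonoidHom.mem_mrange.trans (exists_congr fun k => ?_)
  exact Prod.ext_iff

/-- A limit of elements of `H` that is an exponential lies in `G`, hence in `H`, because commuting
with `q` passes to limits. As `J` is inducing, there is convergence in `H` itself, and continuity of
`rho` gives the second component. -/
theorem expClosed_graph {rho : H →* 𝔻} (hrho : Continuous rho) : ExpClosed (D.graph rho) where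
  closure_mem X hX := by
    obtain ⟨u, hu, hlim⟩ := mem_closure_iff_seq_limit.1 hX
    choose k hk hk' using fun j => (D.mem_graph rho).1 (hu j)
    have h1 : Tendsto (fun j => D.J (k j)) atTop (𝓝 (exp X.1)) := by
      simp only [hk]
      rw [← fst_exp]
      exact (continuous_fst.tendsto _).comp hlim
    have h2 : Tendsto (fun j => rho (k j)) atTop (𝓝 (exp X.2)) := by
      simp only [hk']
      rw [← snd_exp]
      exact (continuous_snd.tendsto _).comp hlim
    obtain ⟨x, hx⟩ := D.closed.closure_mem X.1
      (mem_closure_of_tendsto h1 (Eventually.of_forall fun j => ⟨_, rfl⟩))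
    have hxH : x ∈ H := by
      rw [D.mem_H, hx]
      refine tendsto_nhds_unique (h1.mul_const D.q) ((h1.const_mul D.q).congr fun j => ?_)
      exact ((D.mem_H _).1 (k j).2).symm
    have h3 : Tendsto k atTop (𝓝 ⟨x, hxH⟩) := by
      rw [tendsto_subtype_rng, D.inducing.tendsto_nhds_iff]
      change Tendsto (fun j => D.J (k j)) atTop (𝓝 (D.J x))
      rw [hx]
      exact h1
    refine (D.mem_graph rho).2 ⟨⟨x, hxH⟩, by rw [fst_exp]; exact hx, ?_⟩
    rw [snd_exp]
    exact tendsto_nhds_unique ((hrho.tendsto _).comp h3) h2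
  neg_mem X hX := by
    obtain ⟨k, hk, hk'⟩ := (D.mem_graph rho).1 hX
    rw [fst_exp] at hk
    rw [snd_exp] at hk'
    refine (D.mem_graph rho).2 ⟨k⁻¹, ?_, ?_⟩
    · have h1 : D.J (k⁻¹ : H) * exp X.1 = 1 := by rw [← hk, ← map_mul]; simp
      rw [fst_exp, Prod.fst_neg]
      calc D.J (k⁻¹ : H) = D.J (k⁻¹ : H) * (exp X.1 * exp (-X.1)) := by simp
        _ = exp (-X.1) := by rw [← mul_assoc, h1, one_mul]
    · have h1 : rho k⁻¹ * exp X.2 = 1 := by rw [← hk', ← map_mul]; simp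
      rw [snd_exp, Prod.snd_neg]
      calc rho k⁻¹ = rho k⁻¹ * (exp X.2 * exp (-X.2)) := by simp
        _ = exp (-X.2) := by rw [← mul_assoc, h1, one_mul]

variable {D} {rho} (hS : ExpClosed (D.graph rho))

theorem exists_of_mem_lie_graph {X : 𝔸 × 𝔻} (hX : X ∈ hS.lie) (t : ℝ) :
    ∃ k : H, D.J k = exp (t • X.1) ∧ rho k = exp (t • X.2) := by
  obtain ⟨k, hk, hk'⟩ := (D.mem_graph rho).1 (hS.mem_lie.1 hX t)
  rw [fst_exp] at hk
  rw [snd_exp] at hk'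
  exact ⟨k, hk, hk'⟩

theorem fst_mem_h {X : 𝔸 × 𝔻} (hX : X ∈ hS.lie) : X.1 ∈ D.h := by
  choose k hk hk' using exists_of_mem_lie_graph hS hX
  refine ⟨D.closed.mem_lie.2 fun t => ⟨k t, hk t⟩, ?_⟩
  have h1 := (hasDerivAt_exp_smul X.1 0).mul_const D.q
  have h2 := (hasDerivAt_exp_smul X.1 0).const_mul D.q
  have : (fun t : ℝ => exp (t • X.1) * D.q) = fun t : ℝ => D.q * exp (t • X.1) := by
    funext t
    rw [← hk]
    exact (D.mem_H _).1 (k t).2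
  rw [this] at h1
  simpa using h1.unique h2

theorem rho_eq_exp_of_mem_lie_graph {X : 𝔸 × 𝔻} (hX : X ∈ hS.lie) {k : H}
    (hk : D.J k = exp X.1) : rho k = exp X.2 := by
  obtain ⟨k', hk', hk''⟩ := exists_of_mem_lie_graph hS hX 1
  rw [one_smul] at hk' hk''
  rw [← hk'', Subtype.ext (D.inj (hk.trans hk'.symm))]

/-- Over `1 ∈ H` the graph contains only `1`, so the one-parameter group `exp (tB)` is constant.
Thus the Lie algebra of the graph is again the graph of a map. -/
theorem snd_eq_zero {B : 𝔻} (hB : ((0 : 𝔸), B) ∈ hS.lie) : B = 0 := by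
  have h : ∀ t : ℝ, exp (t • B) = 1 := fun t => by
    obtain ⟨k, hk, hk'⟩ := exists_of_mem_lie_graph hS hB t
    have : k = 1 := Subtype.ext (D.inj (by rw [hk]; simp))
    rw [← hk', this, map_one]
  have h1 := hasDerivAt_exp_smul B 0
  simp only [h] at h1
  simpa using h1.unique (hasDerivAt_const (0 : ℝ) (1 : 𝔻))

theorem snd_unique {X : 𝔸} {B B' : 𝔻} (hB : (X, B) ∈ hS.lie) (hB' : (X, B') ∈ hS.lie) : B = B' := by
  have := hS.lie.sub_mem hB hB'
  rw [Prod.mk_sub_mk, sub_self] at this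
  exact sub_eq_zero.1 (snd_eq_zero hS this)

/-- `t ↦ rho (exp (tX))` is a continuous one-parameter group, hence differentiable, and its velocity
is the required `B`. -/
theorem exists_mem_lie_graph (hrho : Continuous rho) {X : 𝔸} (hX : X ∈ D.h) :
    ∃ B, (X, B) ∈ hS.lie := by
  choose x hx using fun t : ℝ => MonoidHom.mem_mrange.1 (D.closed.mem_lie.1 hX.1 t)
  have hxH : ∀ t, x t ∈ H := fun t => D.mem_H_of_J_eq_exp (D.h.smul_mem t hX) (hx t)
  let k : ℝ → H := fun t => ⟨x t, hxH t⟩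
  have hk : Continuous k := by
    refine Continuous.subtype_mk (D.inducing.continuous_iff.2 ?_) hxH
    change Continuous fun t => D.J (x t)
    simp only [hx]
    exact continuous_exp'.comp (by fun_prop)
  have k0 : k 0 = 1 := Subtype.ext (D.inj (by change D.J (x 0) = D.J 1; rw [hx]; simp))
  have hadd : ∀ s t, k (s + t) = k s * k t := fun s t => Subtype.ext (D.inj (by
    change D.J (x (s + t)) = D.J (x s * x t)
    rw [map_mul, hx, hx, hx, exp_smul_add]))
  obtain ⟨B, hB⟩ := exists_hasDerivAt_of_map_add (hrho.comp hk) (by simp [k0])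
    (fun s t => by simp [hadd])
  refine ⟨B, hS.mem_lie_of_hasDerivAt (c := fun t => (D.J (x t), rho (k t)))
    (fun t => (D.mem_graph rho).2 ⟨k t, rfl, rfl⟩) ?_ ?_⟩
  · change (D.J (k 0), rho (k 0)) = 1
    rw [k0]
    simp
  · refine HasDerivAt.prodMk ?_ hB
    simp only [hx]
    simpa using hasDerivAt_exp_smul X 0

/-- The differential of a continuous representation of `H`. -/
theorem exists_differential {rho : H →* 𝔻} (hrho : Continuous rho) : ∃ d : D.h →ₗ[ℝ] 𝔻,
    ∀ X : D.h, ((X : 𝔸), d X) ∈ (D.expClosed_graph hrho).lie := by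
  have hS := D.expClosed_graph hrho
  choose d hd using fun X : D.h => exists_mem_lie_graph hS hrho X.2
  refine ⟨⟨⟨d, fun X Y => ?_⟩, fun a X => ?_⟩, hd⟩
  · exact snd_unique hS (hd (X + Y)) (hS.lie.add_mem (hd X) (hd Y))
  · exact snd_unique hS (hd (a • X)) (hS.lie.smul_mem a (hd X))

theorem lie_mem_lie_graph {X Y : 𝔸} {B C : 𝔻} (hX : (X, B) ∈ hS.lie) (hY : (Y, C) ∈ hS.lie) :
    (X * Y - Y * X, B * C - C * B) ∈ hS.lie := hS.lie_mem_lie hX hY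

theorem conj_mem_lie_graph (k : H) {X : 𝔸} {B : 𝔻} (hX : (X, B) ∈ hS.lie) :
    (D.J k * X * D.J (k : Γ)⁻¹, rho k * B * rho k⁻¹) ∈ hS.lie :=
  hS.conj_mem_lie (u := (D.J k, rho k)) (v := (D.J (k⁻¹ : H), rho k⁻¹))
    ((D.mem_graph rho).2 ⟨k, rfl, rfl⟩) ((D.mem_graph rho).2 ⟨k⁻¹, rfl, rfl⟩)
    (Prod.ext (by simp) (by simp [← map_mul])) (Prod.ext (by simp) (by simp [← map_mul])) hX

end CosetData

end Graph

end HomogeneousComplex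

namespace HomogeneousComplex

open NormedSpace Set Filter

theorem add_I_smul_lie {R : Type*} [Ring R] [Algebra ℂ R] (a b a' b' : R) :
    (a + Complex.I • b) * (a' + Complex.I • b') - (a' + Complex.I • b') * (a + Complex.I • b) =
      (a * a' - a' * a) - (b * b' - b' * b) + Complex.I • (a * b' - b' * a) +
        Complex.I • (b * a' - a' * b) := by
  simp only [mul_add, add_mul, smul_mul_assoc, mul_smul_comm, smul_smul, smul_add,
    Complex.I_mul_I, neg_smul, one_smul, smul_sub]
  abel

/-! ### Extending the differential of the representation to `p`. -/

section Extension

variable {n : ℕ} {G : Subgroup (GL (Fin n) ℝ)} {𝔸 𝔹 𝔻 : Type*} [NormedRing 𝔸] [NormedAlgebra ℝ 𝔸]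
  [FiniteDimensional ℝ 𝔸] [CompleteSpace 𝔸] [NormedRing 𝔹] [NormedAlgebra ℂ 𝔹]
  [FiniteDimensional ℂ 𝔹] [CompleteSpace 𝔹] [NormedRing 𝔻] [NormedAlgebra ℂ 𝔻]
  [FiniteDimensional ℂ 𝔻] [CompleteSpace 𝔻]
  (Φ : Matrix (Fin n) (Fin n) ℝ ≃ₐ[ℝ] 𝔸) (Ψ : Matrix (Fin n) (Fin n) ℂ ≃ₐ[ℂ] 𝔹)
  (q : lieAlg G) (hG : IsClosed (G : Set (GL (Fin n) ℝ))) (hq : IsGradingElement q)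

theorem mem_h_gradedCosetData {X : lieAlg G} :
    Φ X ∈ (gradedCosetData Φ Ψ q hG hq).h ↔ (1 : ℂ) ⊗ₜ[ℝ] X ∈ gradedPiece q 0 := by
  rw [one_tmul_mem_gradedPiece_zero_iff Φ]
  exact ⟨fun h => h.2, fun h => ⟨(mem_lie_groupHom Φ).2 ⟨X, rfl⟩, h⟩⟩

theorem exists_of_mem_h {A : 𝔸} (hA : A ∈ (gradedCosetData Φ Ψ q hG hq).h) :
    ∃ X : lieAlg G, Φ X = A ∧ (1 : ℂ) ⊗ₜ[ℝ] X ∈ gradedPiece q 0 := by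
  obtain ⟨X, rfl⟩ := (mem_lie_groupHom Φ).1 hA.1
  exact ⟨X, rfl, (mem_h_gradedCosetData Φ Ψ q hG hq).1 hA⟩

/-- The degree `0` part is stable under conjugation, so it contains real and imaginary parts. -/
theorem one_tmul_mem_gradedPiece_zero_of_add {a b : lieAlg G}
    (h : (1 : ℂ) ⊗ₜ[ℝ] a + Complex.I ⊗ₜ[ℝ] b ∈ gradedPiece q 0) :
    (1 : ℂ) ⊗ₜ[ℝ] a ∈ gradedPiece q 0 ∧ (1 : ℂ) ⊗ₜ[ℝ] b ∈ gradedPiece q 0 := by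
  have h' := conj_mem_gradedPiece q h
  rw [neg_zero, map_add, conj_tmul, conj_tmul, map_one, Complex.conj_I, TensorProduct.neg_tmul] at h'
  constructor
  · have := Submodule.smul_mem _ (2⁻¹ : ℂ) (Submodule.add_mem _ h h')
    convert this using 1
    rw [add_add_add_comm, add_neg_cancel, add_zero, ← two_smul ℂ, smul_smul,
      inv_mul_cancel₀ two_ne_zero, one_smul]
  · have := Submodule.smul_mem _ (-Complex.I * 2⁻¹ : ℂ) (Submodule.sub_mem _ h h')
    convert this using 1
    rw [add_sub_add_left_eq_sub, sub_neg_eq_add, ← two_smul ℂ, smul_smul, mul_assoc,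
      inv_mul_cancel₀ two_ne_zero, mul_one, TensorProduct.smul_tmul', smul_eq_mul, neg_mul,
      Complex.I_mul_I, neg_neg]

theorem exists_eq_of_mem_gradedImage_Ici {X : 𝔹} (hX : X ∈ gradedImage Φ Ψ q (Ici 0)) :
    ∃ A ∈ (gradedCosetData Φ Ψ q hG hq).h, ∃ B ∈ (gradedCosetData Φ Ψ q hG hq).h,
      ∃ Z ∈ gradedImage Φ Ψ q (Ioi 0),
        X = realInclusion Φ Ψ A + Complex.I • realInclusion Φ Ψ B + Z := by
  obtain ⟨x, hx, rfl⟩ := hX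
  rw [Ici_eq_union, gradedSum_union, gradedSum_singleton] at hx
  obtain ⟨y, hy, z, hz, rfl⟩ := Submodule.mem_sup.1 hx
  obtain ⟨a, b, rfl⟩ := exists_eq_one_tmul_add_I_tmul y
  obtain ⟨ha, hb⟩ := one_tmul_mem_gradedPiece_zero_of_add q hy
  refine ⟨_, (mem_h_gradedCosetData Φ Ψ q hG hq).2 ha, _,
    (mem_h_gradedCosetData Φ Ψ q hG hq).2 hb, _, ⟨z, hz, rfl⟩, ?_⟩
  rw [map_add, map_add, complexify_tmul, complexify_tmul, one_smul]

theorem realInclusion_mem_gradedImage_zero {A : 𝔸} (hA : A ∈ (gradedCosetData Φ Ψ q hG hq).h) :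
    realInclusion Φ Ψ A ∈ gradedImage Φ Ψ q {0} := by
  obtain ⟨X, rfl, hX⟩ := exists_of_mem_h Φ Ψ q hG hq hA
  refine ⟨(1 : ℂ) ⊗ₜ X, ?_, by rw [complexify_tmul, one_smul]⟩
  rw [gradedSum_singleton]
  exact hX

theorem isCompl_gradedSum_zero (hq : IsGradingElement q) :
    IsCompl (gradedSum q {0}) (gradedSum q {0}ᶜ) :=
  ⟨disjoint_gradedSum q disjoint_compl_right, codisjoint_iff.2 (by
    rw [← gradedSum_union, union_compl_self, gradedSum_univ q hq])⟩

/-- A real linear map on the Lie algebra of `H` extends to a complex linear map that vanishes on the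
positive part. -/
theorem exists_extension (d : (gradedCosetData Φ Ψ q hG hq).h →ₗ[ℝ] 𝔻) : ∃ L : 𝔹 →ₗ[ℂ] 𝔻,
    (∀ A : (gradedCosetData Φ Ψ q hG hq).h, L (realInclusion Φ Ψ A) = d A) ∧
      ∀ X ∈ gradedImage Φ Ψ q (Ioi 0), L X = 0 := by
  obtain ⟨e, he⟩ := LinearMap.exists_extend d
  obtain ⟨K, hK⟩ := LinearMap.exists_leftInverse_of_injective (complexify Φ Ψ G)
    (LinearMap.ker_eq_bot.2 (complexify_injective Φ Ψ))
  have hK' : ∀ x, K (complexify Φ Ψ G x) = x := fun x => congrArg (fun f => f x) hK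
  -- Projecting to degree `0` before applying the complexified map makes the extension vanish in
  -- positive degrees.
  let P := (gradedSum q {0}).projection _ (isCompl_gradedSum_zero q hq)
  let dC : ℂ ⊗[ℝ] lieAlg G →ₗ[ℂ] 𝔻 := LinearMap.liftBaseChange ℂ
    (e ∘ₗ Φ.toLinearMap ∘ₗ (lieAlg G).toSubmodule.subtype)
  refine ⟨dC ∘ₗ P ∘ₗ K, ?_, ?_⟩
  · rintro ⟨A, hA⟩
    obtain ⟨X, rfl, hX⟩ := exists_of_mem_h Φ Ψ q hG hq hA
    rw [← gradedSum_singleton] at hX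
    have h1 : realInclusion Φ Ψ (Φ X) = complexify Φ Ψ G ((1 : ℂ) ⊗ₜ X) := by
      rw [complexify_tmul, one_smul]
    change dC (P (K (realInclusion Φ Ψ (Φ X)))) = _
    rw [h1, hK', Submodule.projection_apply_of_mem_left _ hX]
    refine (LinearMap.liftBaseChange_tmul ..).trans ((one_smul ℂ _).trans ?_)
    exact congrArg (fun f => f ⟨Φ X, hA⟩) he
  · rintro _ ⟨x, hx, rfl⟩
    change dC (P (K (complexify Φ Ψ G x))) = 0
    have hx' : x ∈ gradedSum q {0}ᶜ := gradedSum_mono q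
      (fun r hr => (ne_of_gt (mem_Ioi.1 hr) : r ≠ 0)) hx
    rw [hK', Submodule.projection_apply_of_mem_right _ hx', map_zero]

/-- The differential of a continuous representation of `H`, extended by `0` on the positive part. -/
theorem exists_repData {rho : centralizer q →* 𝔻} (hrho : Continuous rho) :
    ∃ R : (gradedCosetData Φ Ψ q hG hq).RepData 𝔻, R.rho = rho := by
  set D := gradedCosetData Φ Ψ q hG hq
  obtain ⟨d, hd⟩ := D.exists_differential hrho
  obtain ⟨L, hL, hL0⟩ := exists_extension Φ Ψ q hG hq d
  have hS := D.expClosed_graph hrho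
  have hLB : ∀ {A : 𝔸} {B : 𝔻}, (A, B) ∈ hS.lie → L (realInclusion Φ Ψ A) = B := fun {A B} h =>
    (hL ⟨A, CosetData.fst_mem_h hS h⟩).trans (CosetData.snd_unique hS (hd _) h)
  -- Write elements of `p` as `A + iB + Z` with `A, B ∈ 𝔥` and `Z` of positive degree. All brackets
  -- involving a positive vector are positive and killed by `L`; the others reduce by bilinearity to
  -- brackets in `𝔥`, where `L` is the differential of `rho`.
  have key : ∀ X ∈ D.S.p, ∀ Y ∈ D.S.p, L (X * Y - Y * X) = L X * L Y - L Y * L X := by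
    intro X hX Y hY
    obtain ⟨A, hA, B, hB, Z, hZ, rfl⟩ := exists_eq_of_mem_gradedImage_Ici Φ Ψ q hG hq hX
    obtain ⟨A', hA', B', hB', Z', hZ', rfl⟩ := exists_eq_of_mem_gradedImage_Ici Φ Ψ q hG hq hY
    set ι := realInclusion Φ Ψ
    set X₀ := ι A + Complex.I • ι B with hX₀
    set Y₀ := ι A' + Complex.I • ι B' with hY₀
    have mem0 : ∀ {A B}, A ∈ D.h → B ∈ D.h → ι A + Complex.I • ι B ∈ gradedImage Φ Ψ q {0} :=
      fun hA hB => Submodule.add_mem _ (realInclusion_mem_gradedImage_zero Φ Ψ q hG hq hA)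
        (Submodule.smul_mem _ _ (realInclusion_mem_gradedImage_zero Φ Ψ q hG hq hB))
    have h1 := lie_mem_gradedImage Φ Ψ q (C := Ioi 0) (fun a ha b hb => by
      rw [mem_singleton_iff] at ha; rw [ha, zero_add]; exact hb) (mem0 hA hB) hZ'
    have h2 := lie_mem_gradedImage Φ Ψ q (C := Ioi 0) (fun a ha b hb => by
      rw [mem_singleton_iff] at hb; rw [hb, add_zero]; exact ha) hZ (mem0 hA' hB')
    have h3 := lie_mem_gradedImage Φ Ψ q (C := Ioi 0) (fun a ha b hb =>
      add_pos (mem_Ioi.1 ha) (mem_Ioi.1 hb)) hZ hZ'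
    have h4 : (X₀ + Z) * (Y₀ + Z') - (Y₀ + Z') * (X₀ + Z) = (X₀ * Y₀ - Y₀ * X₀) +
        ((X₀ * Z' - Z' * X₀) + (Z * Y₀ - Y₀ * Z) + (Z * Z' - Z' * Z)) := by noncomm_ring
    have h5 : ∀ {A A'} (hA : A ∈ D.h) (hA' : A' ∈ D.h), L (ι A * ι A' - ι A' * ι A) =
        d ⟨A, hA⟩ * d ⟨A', hA'⟩ - d ⟨A', hA'⟩ * d ⟨A, hA⟩ := fun hA hA' => by
      rw [← map_mul, ← map_mul, ← map_sub]
      exact hLB (CosetData.lie_mem_lie_graph hS (hd ⟨_, hA⟩) (hd ⟨_, hA'⟩))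
    have h7 : L (X₀ + Z) = d ⟨A, hA⟩ + Complex.I • d ⟨B, hB⟩ := by
      rw [map_add, hL0 Z hZ, add_zero, map_add, map_smul, ← hL, ← hL]
    have h8 : L (Y₀ + Z') = d ⟨A', hA'⟩ + Complex.I • d ⟨B', hB'⟩ := by
      rw [map_add, hL0 Z' hZ', add_zero, map_add, map_smul, ← hL, ← hL]
    rw [h7, h8, h4, map_add, hL0 _ (Submodule.add_mem _ (Submodule.add_mem _ h1 h2) h3), add_zero,
      add_I_smul_lie, add_I_smul_lie, map_add, map_add, map_sub, map_smul, map_smul, h5 hA hA',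
      h5 hB hB', h5 hA hB', h5 hB hA']
  refine ⟨⟨rho, L ∘ₗ D.S.p.subtype, fun X Y => key X X.2 Y Y.2, ?_, ?_⟩, rfl⟩
  · intro k Y hY hk
    change rho k = exp (L (realInclusion Φ Ψ Y))
    rw [hLB (hd ⟨Y, hY⟩)]
    exact CosetData.rho_eq_exp_of_mem_lie_graph hS (hd ⟨Y, hY⟩) hk
  · rintro k ⟨X, hX⟩
    obtain ⟨A, hA, B, hB, Z, hZ, rfl⟩ := exists_eq_of_mem_gradedImage_Ici Φ Ψ q hG hq hX
    set ι := realInclusion Φ Ψ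
    have h1 : ∀ {A} (hA : A ∈ D.h), L (ι (D.J k) * ι A * ι (D.J (k : G)⁻¹)) * rho k =
        rho k * L (ι A) := fun hA => by
      rw [← map_mul, ← map_mul, hLB (CosetData.conj_mem_lie_graph hS k (hd ⟨_, hA⟩)),
        hLB (hd ⟨_, hA⟩), mul_assoc, ← map_mul, inv_mul_cancel, map_one, mul_one]
    have h2 : L (ι (D.J k) * Z * ι (D.J (k : G)⁻¹)) = 0 :=
      hL0 _ (conj_mem_gradedImage Φ Ψ q k.2 hZ)
    change L (ι (D.J k) * (ι A + Complex.I • ι B + Z) * ι (D.J (k : G)⁻¹)) * rho k =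
      rho k * L (ι A + Complex.I • ι B + Z)
    rw [mul_add, mul_add, add_mul, add_mul, map_add, map_add, h2, add_zero, mul_smul_comm,
      smul_mul_assoc, map_smul, add_mul, smul_mul_assoc, h1 hA, h1 hB, map_add, map_add, map_smul,
      hL0 Z hZ, add_zero, mul_add, mul_smul_comm]

end Extension

end HomogeneousComplex

namespace HomogeneousComplex

open NormedSpace Set Filter

/-! ### Homogeneous bundles -/

section Smoothness

variable {Γ E 𝔸 𝔹 𝔻 : Type*} [Group Γ] [TopologicalSpace Γ] [IsTopologicalGroup Γ]
  [NormedAddCommGroup E] [NormedSpace ℂ E] [FiniteDimensional ℂ E]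
  [NormedRing 𝔸] [NormedAlgebra ℝ 𝔸] [FiniteDimensional ℝ 𝔸] [CompleteSpace 𝔸]
  [NormedRing 𝔹] [NormedAlgebra ℂ 𝔹] [FiniteDimensional ℂ 𝔹] [CompleteSpace 𝔹]
  [NormedRing 𝔻] [NormedAlgebra ℂ 𝔻] [CompleteSpace 𝔻] [FiniteDimensional ℂ 𝔻]
  {H : Subgroup Γ} {D : CosetData H E 𝔸 𝔹} {C : D.LocalChart} (R : D.RepData 𝔻)

namespace CosetData.RepData

/-- With the element of `H` frozen at `x₀`, `θ̂` becomes locally the analytic `θ` times a constant.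
Continuity and smoothness of `θ̂` follow from this. -/
theorem eventually_thetaHat_eq {x₀ : Γ} (hx : (x₀ : Γ ⧸ H) ∈ C.e.source) : ∃ k : H,
    D.JC (x₀ * (k : Γ)⁻¹) ∈ D.S.dec.target ∧
      ∀ᶠ x in 𝓝 x₀, R.thetaHat C x = R.theta (D.JC (x * (k : Γ)⁻¹)) * R.rho k := by
  refine ⟨⟨C.fac x₀, C.fac_mem hx⟩, (C.mem_leaf _ (C.mul_fac_inv_mem hx)).1, ?_⟩
  have h1 : ∀ᶠ x in 𝓝 x₀, x * (C.fac x₀)⁻¹ ∈ C.nbhd :=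
    (continuousAt_id.mul continuousAt_const).eventually_mem
      (C.isOpen_nbhd.mem_nhds (C.mul_fac_inv_mem hx))
  filter_upwards [h1] with x hx'
  exact R.thetaHat_eq_of_mem ⟨C.fac x₀, C.fac_mem hx⟩ hx'

theorem continuousAt_thetaHat {x₀ : Γ} (hx : (x₀ : Γ ⧸ H) ∈ C.e.source) :
    ContinuousAt (R.thetaHat C) x₀ := by
  obtain ⟨k, ht, hk⟩ := R.eventually_thetaHat_eq hx
  refine ContinuousAt.congr (ContinuousAt.mul ?_ continuousAt_const) (hk.mono fun x h => h.symm)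
  exact ContinuousAt.comp (f := fun x => D.JC (x * (k : Γ)⁻¹)) (R.contDiffAt_theta ht).continuousAt
    (D.continuous_JC.comp (continuous_id.mul continuous_const)).continuousAt

theorem continuousAt_inverse_thetaHat {x₀ : Γ} (hx : (x₀ : Γ ⧸ H) ∈ C.e.source) :
    ContinuousAt (fun x => Ring.inverse (R.thetaHat C x)) x₀ := by
  obtain ⟨u, hu⟩ := R.isUnit_thetaHat hx
  have h : ContinuousAt Ring.inverse (R.thetaHat C x₀) := by
    rw [← hu]; exact NormedRing.inverse_continuousAt u
  exact ContinuousAt.comp h (R.continuousAt_thetaHat hx)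

theorem contDiffAt_thetaHat_comp {X : Type*} [NormedAddCommGroup X] [NormedSpace ℝ X]
    {n : WithTop ℕ∞} {f : X → Γ} {x₀ : X} (hf : ContDiffAt ℝ n (fun x => D.J (f x)) x₀)
    (g : Γ) (hs : ((g * f x₀ : Γ) : Γ ⧸ H) ∈ C.e.source) :
    ContDiffAt ℝ n (fun x => R.thetaHat C (g * f x)) x₀ := by
  obtain ⟨k, ht, hk⟩ := R.eventually_thetaHat_eq hs
  have hc : ContinuousAt (fun x => g * f x) x₀ :=
    continuousAt_const.mul (LocalChart.continuousAt_of_contDiffAt hf)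
  refine ContDiffAt.congr_of_eventuallyEq (ContDiffAt.mul (f := fun x =>
    R.theta (D.JC (g * f x * (k : Γ)⁻¹))) (g := fun _ => R.rho k) ?_ contDiffAt_const)
    (hc.eventually hk)
  have h2 : ContDiffAt ℝ n R.theta (D.JC (g * f x₀ * (k : Γ)⁻¹)) :=
    ((R.contDiffAt_theta ht).restrict_scalars ℝ).of_le le_top
  exact ContDiffAt.comp (f := fun x => D.JC (g * f x * (k : Γ)⁻¹)) x₀ h2
    (LocalChart.contDiffAt_JC_mul_mul hf g _)

theorem inverse_thetaHat_mul {x : Γ} (hx : (x : Γ ⧸ H) ∈ C.e.source) :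
    Ring.inverse (R.thetaHat C x) * R.thetaHat C x = 1 :=
  Ring.inverse_mul_cancel _ (R.isUnit_thetaHat hx)

theorem thetaHat_mul_inverse {x : Γ} (hx : (x : Γ ⧸ H) ∈ C.e.source) :
    R.thetaHat C x * Ring.inverse (R.thetaHat C x) = 1 :=
  Ring.mul_inverse_cancel _ (R.isUnit_thetaHat hx)

end CosetData.RepData

end Smoothness

/-! ### Local trivializations of `O(W)`. -/

section Bundle

universe v

variable {n d : ℕ} {G : Subgroup (GL (Fin n) ℝ)} {H : Subgroup G} {𝔸 𝔹 : Type*}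
  [NormedRing 𝔸] [NormedAlgebra ℝ 𝔸] [FiniteDimensional ℝ 𝔸] [CompleteSpace 𝔸]
  [NormedRing 𝔹] [NormedAlgebra ℂ 𝔹] [FiniteDimensional ℂ 𝔹] [CompleteSpace 𝔹]
  {W : Type v} [NormedAddCommGroup W] [NormedSpace ℂ W] [FiniteDimensional ℂ W] [CompleteSpace W]
  {D : CosetData H (Model d) 𝔸 𝔹} (C : D.LocalChart) (R : D.RepData (W →L[ℂ] W))
  {ρ : Representation ℂ H W}

theorem HomBundle.continuous_mk (ρ : Representation ℂ H W) : Continuous (HomBundle.mk ρ) :=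
  continuous_coinduced_rng

theorem HomBundle.isQuotientMap_mk (ρ : Representation ℂ H W) :
    Topology.IsQuotientMap (HomBundle.mk ρ) :=
  ⟨⟨rfl⟩, HomBundle.mk_surjective ρ⟩

theorem HomBundle.continuous_proj (ρ : Representation ℂ H W) :
    Continuous (TotalSpace.proj : HomBundle ρ → G ⧸ H) :=
  (HomBundle.isQuotientMap_mk ρ).continuous_iff.2 (continuous_quotient_mk'.comp continuous_fst)

theorem HomBundle.mk_mul (ρ : Representation ℂ H W) (g : G) (k : H) (w : W) :
    HomBundle.mk ρ (g, ρ k w) = HomBundle.mk ρ (g * k, w) := by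
  refine (HomBundle.mk_eq_mk_iff ρ _ _).2 ⟨k, Prod.ext rfl ?_⟩
  change w = ρ k⁻¹ (ρ k w)
  rw [← Module.End.mul_apply, ← map_mul, inv_mul_cancel, map_one, Module.End.one_apply]

/-- The value of a point of `O(W)` at the chosen representative of its coset. -/
def outValue (ρ : Representation ℂ H W) {x : G ⧸ H} (s : Fiber ρ x) : W :=
  (s : {g : G // (g : G ⧸ H) = x} → W) ⟨Quotient.out x, QuotientGroup.out_eq' x⟩

theorem mk_outValue (ρ : Representation ℂ H W) (p : HomBundle ρ) :
    HomBundle.mk ρ (Quotient.out p.proj, outValue ρ p.snd) = p := by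
  obtain ⟨⟨g, w⟩, rfl⟩ := HomBundle.mk_surjective ρ p
  refine (HomBundle.mk_eq_mk_iff ρ _ _).2
    ⟨⟨(Quotient.out (g : G ⧸ H))⁻¹ * g, CosetData.outFac_mem g⟩, Prod.ext ?_ ?_⟩
  · change g = Quotient.out (g : G ⧸ H) * ((Quotient.out (g : G ⧸ H))⁻¹ * g)
    rw [mul_inv_cancel_left]
  · change w = ρ _⁻¹ (ρ ⟨(Quotient.out (g : G ⧸ H))⁻¹ * g, _⟩ w)
    rw [← Module.End.mul_apply, ← map_mul, inv_mul_cancel, map_one, Module.End.one_apply]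


variable (ρ) in
/-- The local trivialization `[g', w] ↦ (g' H, θ(g⁻¹ g') w)` over the chart at `g`. -/
def trivFun (g : G) (p : HomBundle ρ) : (G ⧸ H) × W :=
  (p.proj, R.thetaHat C (g⁻¹ * Quotient.out p.proj) (outValue ρ p.snd))

variable (ρ) in
/-- The inverse of the local trivialization over the chart at `g`. -/
def trivInv (g : G) (y : (G ⧸ H) × W) : HomBundle ρ :=
  HomBundle.mk ρ (g * C.sec (C.chart g y.1),
    Ring.inverse (R.thetaHat C (C.sec (C.chart g y.1))) y.2)

variable {C R}

theorem mem_chart_source_mk {g x : G} : (x : G ⧸ H) ∈ (C.chart g).source ↔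
    ((g⁻¹ * x : G) : G ⧸ H) ∈ C.e.source := Iff.rfl

theorem mk_sec_chart {g : G} {y : G ⧸ H} (hy : y ∈ (C.chart g).source) :
    ((C.sec (C.chart g y) : G) : G ⧸ H) ∈ C.e.source ∧
      ((g * C.sec (C.chart g y) : G) : G ⧸ H) = y := by
  have ht := (C.chart g).map_source hy
  rw [C.mk_sec _ ht]
  refine ⟨C.e.map_target ht, ?_⟩
  calc ((g * C.sec (C.chart g y) : G) : G ⧸ H) = g • ((C.sec (C.chart g y) : G) : G ⧸ H) := rfl
    _ = (C.chart g).symm (C.chart g y) := by rw [C.mk_sec _ ht, C.chart_symm_apply]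
    _ = y := (C.chart g).left_inv hy

/-- By equivariance of `θ̂`, passing from the chosen representative of the coset to `x` absorbs the
factor `ρ(k)` acting on `w`. -/
theorem trivFun_mk (hR : ∀ (k : H) (w : W), R.rho k w = ρ k w) {g x : G}
    (hx : (x : G ⧸ H) ∈ (C.chart g).source) (w : W) :
    trivFun C R ρ g (HomBundle.mk ρ (x, w)) = (↑x, R.thetaHat C (g⁻¹ * x) w) := by
  refine Prod.ext rfl ?_
  let k : H := ⟨(Quotient.out (x : G ⧸ H))⁻¹ * x, CosetData.outFac_mem x⟩
  have hk : g⁻¹ * Quotient.out (x : G ⧸ H) * k = g⁻¹ * x := by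
    change g⁻¹ * Quotient.out (x : G ⧸ H) * ((Quotient.out (x : G ⧸ H))⁻¹ * x) = _
    rw [mul_assoc, mul_inv_cancel_left]
  have hs : ((g⁻¹ * Quotient.out (x : G ⧸ H) : G) : G ⧸ H) ∈ C.e.source := by
    rw [← mem_chart_source_mk, QuotientGroup.out_eq']
    exact hx
  change R.thetaHat C (g⁻¹ * Quotient.out (x : G ⧸ H)) (ρ k w) = R.thetaHat C (g⁻¹ * x) w
  rw [← hk, R.thetaHat_mul hs, mul_apply_eq_comp, hR]

theorem trivInv_trivFun (hR : ∀ (k : H) (w : W), R.rho k w = ρ k w) {g : G} {p : HomBundle ρ}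
    (hp : p.proj ∈ (C.chart g).source) : trivInv C R ρ g (trivFun C R ρ g p) = p := by
  obtain ⟨⟨x, w⟩, rfl⟩ := HomBundle.mk_surjective ρ p
  have hx : (x : G ⧸ H) ∈ (C.chart g).source := hp
  rw [trivFun_mk hR hx, trivInv]
  obtain ⟨hs, hy⟩ := mk_sec_chart hx
  set s := C.sec (C.chart g (x : G ⧸ H)) with hs'
  let k : H := ⟨(g * s)⁻¹ * x, QuotientGroup.eq.1 hy⟩
  have hk : g * s * k = x := mul_inv_cancel_left _ _
  have hk' : g⁻¹ * x = s * k := by rw [← hk, mul_assoc, inv_mul_cancel_left]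
  change HomBundle.mk ρ (g * s, Ring.inverse (R.thetaHat C s) (R.thetaHat C (g⁻¹ * x) w)) = _
  rw [hk', R.thetaHat_mul hs, ← mul_apply_eq_comp, ← mul_assoc,
    R.inverse_thetaHat_mul hs, one_mul, hR, HomBundle.mk_mul, hk]

theorem trivFun_trivInv (hR : ∀ (k : H) (w : W), R.rho k w = ρ k w) {g : G} {y : (G ⧸ H) × W}
    (hy : y.1 ∈ (C.chart g).source) : trivFun C R ρ g (trivInv C R ρ g y) = y := by
  obtain ⟨hs, hy'⟩ := mk_sec_chart hy
  rw [trivInv, trivFun_mk hR (by rw [hy']; exact hy), inv_mul_cancel_left,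
    ← mul_apply_eq_comp, R.thetaHat_mul_inverse hs, hy', one_apply_eq_self]

/-- Left translations in terms of the local trivializations. -/
theorem trivFun_translate (hR : ∀ (k : H) (w : W), R.rho k w = ρ k w) (g : G) {g₀ g₁ : G}
    {p : HomBundle ρ} (hp : p.proj ∈ (C.chart g₀).source)
    (hp' : g • p.proj ∈ (C.chart g₁).source) :
    (trivFun C R ρ g₁ (HomBundle.translate ρ g p)).2 =
      (R.thetaHat C (g₁⁻¹ * g * g₀ * C.sec (C.chart g₀ p.proj)) *
        Ring.inverse (R.thetaHat C (C.sec (C.chart g₀ p.proj)))) (trivFun C R ρ g₀ p).2 := by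
  obtain ⟨hs, hy'⟩ := mk_sec_chart hp
  conv_lhs => rw [← trivInv_trivFun hR hp]
  rw [trivInv, HomBundle.translate_mk, trivFun_mk hR, mul_apply_eq_comp]
  · simp only [mul_assoc]
    rfl
  · change g • ((g₀ * C.sec (C.chart g₀ p.proj) : G) : G ⧸ H) ∈ _
    rw [hy']
    exact hp'

/-- As `O(W)` carries the quotient topology, continuity is tested on `G × W`, where `trivFun_mk`
gives an explicit formula. -/
theorem continuousOn_trivFun (hR : ∀ (k : H) (w : W), R.rho k w = ρ k w) (g : G) :
    ContinuousOn (trivFun C R ρ g) (TotalSpace.proj ⁻¹' (C.chart g).source) := by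
  rw [(HomBundle.isQuotientMap_mk ρ).continuousOn_isOpen_iff
    ((C.chart g).open_source.preimage (HomBundle.continuous_proj ρ))]
  rintro ⟨x, w⟩ hx
  have hx' : (x : G ⧸ H) ∈ (C.chart g).source := hx
  refine ContinuousAt.continuousWithinAt ?_
  have h1 : ContinuousAt (fun y : G × W => ((y.1 : G ⧸ H), R.thetaHat C (g⁻¹ * y.1) y.2)) (x, w) := by
    refine (continuous_quotient_mk'.comp continuous_fst).continuousAt.prodMk ?_
    refine ContinuousAt.clm_apply ?_ continuousAt_snd
    exact ContinuousAt.comp (f := fun y : G × W => g⁻¹ * y.1) (R.continuousAt_thetaHat hx')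
      (continuous_const.mul continuous_fst).continuousAt
  refine h1.congr ?_
  have hO : (fun y : G × W => (y.1 : G ⧸ H)) ⁻¹' (C.chart g).source ∈ 𝓝 (x, w) :=
    ((C.chart g).open_source.preimage
      (continuous_quotient_mk'.comp continuous_fst)).mem_nhds hx'
  filter_upwards [hO] with y hy
  exact (trivFun_mk hR hy y.2).symm

theorem continuousOn_trivInv (g : G) :
    ContinuousOn (trivInv C R ρ g) ((C.chart g).source ×ˢ univ) := by
  rintro ⟨y, w⟩ ⟨hy, -⟩
  have hy' : y ∈ (C.chart g).source := hy
  obtain ⟨hs, -⟩ := mk_sec_chart hy'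
  refine ContinuousAt.continuousWithinAt ?_
  have h1 : ContinuousAt (fun y : (G ⧸ H) × W => C.sec (C.chart g y.1)) (y, w) :=
    ContinuousAt.comp (f := fun y : (G ⧸ H) × W => C.chart g y.1)
      (C.continuousAt_sec ((C.chart g).map_source hy'))
      (ContinuousAt.comp (f := Prod.fst) ((C.chart g).continuousAt hy') continuousAt_fst)
  have h2 : ContinuousAt (fun y : (G ⧸ H) × W =>
      Ring.inverse (R.thetaHat C (C.sec (C.chart g y.1)))) (y, w) :=
    ContinuousAt.comp (f := fun y : (G ⧸ H) × W => C.sec (C.chart g y.1))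
      (R.continuousAt_inverse_thetaHat hs) h1
  have h5 : ContinuousAt (fun y : (G ⧸ H) × W => (g * C.sec (C.chart g y.1),
      Ring.inverse (R.thetaHat C (C.sec (C.chart g y.1))) y.2)) (y, w) :=
    (continuousAt_const.mul h1).prodMk (h2.clm_apply continuousAt_snd)
  exact ContinuousAt.comp (f := fun y : (G ⧸ H) × W => (g * C.sec (C.chart g y.1),
    Ring.inverse (R.thetaHat C (C.sec (C.chart g y.1))) y.2))
    (HomBundle.continuous_mk ρ).continuousAt h5

variable (C R) in
/-- The local trivialization of `O(W)` over the chart at `g`. -/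
def triv (hR : ∀ (k : H) (w : W), R.rho k w = ρ k w) (g : G) :
    Trivialization W (TotalSpace.proj : HomBundle ρ → G ⧸ H) where
  toFun := trivFun C R ρ g
  invFun := trivInv C R ρ g
  source := TotalSpace.proj ⁻¹' (C.chart g).source
  target := (C.chart g).source ×ˢ univ
  map_source' _ hp := ⟨hp, mem_univ _⟩
  map_target' y hy := by
    change ((g * C.sec (C.chart g y.1) : G) : G ⧸ H) ∈ (C.chart g).source
    rw [(mk_sec_chart hy.1).2]
    exact hy.1
  left_inv' _ hp := trivInv_trivFun hR hp
  right_inv' _ hy := trivFun_trivInv hR hy.1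
  open_source := (C.chart g).open_source.preimage (HomBundle.continuous_proj ρ)
  open_target := (C.chart g).open_source.prod isOpen_univ
  continuousOn_toFun := continuousOn_trivFun hR g
  continuousOn_invFun := continuousOn_trivInv g
  baseSet := (C.chart g).source
  open_baseSet := (C.chart g).open_source
  source_eq := rfl
  target_eq := rfl
  proj_toFun _ _ := rfl

end Bundle

end HomogeneousComplex

namespace HomogeneousComplex

open NormedSpace Set Filter

/-! ### The holomorphic vector bundle structure. -/

section Bundle

universe v

variable {n d : ℕ} {G : Subgroup (GL (Fin n) ℝ)} {H : Subgroup G} {𝔸 𝔹 : Type*}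
  [NormedRing 𝔸] [NormedAlgebra ℝ 𝔸] [FiniteDimensional ℝ 𝔸] [CompleteSpace 𝔸]
  [NormedRing 𝔹] [NormedAlgebra ℂ 𝔹] [FiniteDimensional ℂ 𝔹] [CompleteSpace 𝔹]
  {W : Type v} [NormedAddCommGroup W] [NormedSpace ℂ W] [FiniteDimensional ℂ W] [CompleteSpace W]
  {D : CosetData H (Model d) 𝔸 𝔹} (C : D.LocalChart) (R : D.RepData (W →L[ℂ] W))
  {ρ : Representation ℂ H W} (hR : ∀ (k : H) (w : W), R.rho k w = ρ k w)

theorem continuous_outValue (x : G ⧸ H) : Continuous (outValue ρ : Fiber ρ x → W) :=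
  (continuous_apply _).comp continuous_subtype_val

/-- A point of the fibre is determined by its value at one representative, and its other values are
images of this one under the operators `ρ(k)⁻¹`, continuous in finite dimension. -/
theorem isInducing_outValue (x : G ⧸ H) : Topology.IsInducing (outValue ρ : Fiber ρ x → W) := by
  refine ⟨le_antisymm (continuous_iff_le_induced.1 (continuous_outValue x)) ?_⟩
  let k : {g : G // (g : G ⧸ H) = x} → H := fun a =>
    ⟨(Quotient.out x)⁻¹ * a, QuotientGroup.eq.1 ((QuotientGroup.out_eq' x).trans a.2.symm)⟩
  have h : ∀ (s : Fiber ρ x) (a : {g : G // (g : G ⧸ H) = x}),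
      s.1 a = ρ (k a)⁻¹ (outValue ρ s) := fun s a =>
    s.2 ⟨Quotient.out x, QuotientGroup.out_eq' x⟩ a (k a) (mul_inv_cancel_left _ _).symm
  let t : TopologicalSpace (Fiber ρ x) := TopologicalSpace.induced (outValue ρ) inferInstance
  have ht : Continuous[t, _] (outValue ρ : Fiber ρ x → W) := continuous_induced_dom
  change t ≤ instTopologicalSpaceSubtype
  refine continuous_iff_le_induced.1 ?_
  refine (@continuous_pi_iff _ _ _ t _ _).2 fun a => ?_
  have h1 : (fun s : Fiber ρ x => s.1 a) = fun s => ρ (k a)⁻¹ (outValue ρ s) :=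
    funext fun s => h s a
  refine Eq.mpr (congrArg (fun f => Continuous[t, _] f) h1) ?_
  exact @Continuous.comp _ _ _ t _ _ _ _ (ρ (k a)⁻¹).continuous_of_finiteDimensional ht

theorem continuous_totalSpaceMk (x : G ⧸ H) :
    Continuous (@TotalSpace.mk (G ⧸ H) W (fun x => Fiber ρ x) x) := by
  have h : (@TotalSpace.mk (G ⧸ H) W (fun x => Fiber ρ x) x) = fun s =>
      HomBundle.mk ρ (Quotient.out x, outValue ρ s) := funext fun s =>
    (mk_outValue ρ (TotalSpace.mk x s)).symm
  rw [h]
  exact (HomBundle.continuous_mk ρ).comp (continuous_const.prodMk (continuous_outValue x))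

/-- Undoing the invertible factor `θ̂` in a trivialization recovers the value at the representative
as a function on the total space, continuous at the given point. So the total space induces the
fibre topology. -/
theorem isInducing_totalSpaceMk (C : D.LocalChart) (R : D.RepData (W →L[ℂ] W))
    (hR : ∀ (k : H) (w : W), R.rho k w = ρ k w) (x : G ⧸ H) :
    Topology.IsInducing (@TotalSpace.mk (G ⧸ H) W (fun x => Fiber ρ x) x) := by
  rw [Topology.isInducing_iff_nhds]
  intro s
  refine le_antisymm ((continuous_totalSpaceMk x).tendsto s).le_comap ?_
  set g := Quotient.out x
  have hx : x ∈ (C.chart g).source := C.mem_chart_out_source x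
  have hs : ((g⁻¹ * Quotient.out x : G) : G ⧸ H) ∈ C.e.source := by
    rw [← mem_chart_source_mk, QuotientGroup.out_eq']
    exact hx
  set θ := R.thetaHat C (g⁻¹ * Quotient.out x)
  have hθ : ∀ w, (Ring.inverse θ) (θ w) = w := fun w => by
    rw [← mul_apply_eq_comp, R.inverse_thetaHat_mul hs, one_apply_eq_self]
  have hcont : ContinuousAt (fun p : HomBundle ρ => Ring.inverse θ (triv C R hR g p).2)
      (TotalSpace.mk x s) :=
    (Ring.inverse θ).continuous.continuousAt.comp
      (continuousAt_snd.comp ((triv C R hR g).continuousAt hx))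
  have hval : ∀ s : Fiber ρ x, Ring.inverse θ (triv C R hR g (TotalSpace.mk x s)).2 =
      outValue ρ s := fun s => hθ _
  rw [(isInducing_outValue x).nhds_eq_comap, ← funext hval]
  refine (comap_mono hcont.tendsto.le_comap).trans_eq ?_
  rw [comap_comap]
  rfl

/-- The bundle `O(W)` as a fibre bundle. -/
@[reducible] def fiberBundle : FiberBundle W (fun x : G ⧸ H => Fiber ρ x) where
  totalSpaceMk_isInducing' x := isInducing_totalSpaceMk C R hR x
  trivializationAtlas' := range (triv C R hR)
  trivializationAt' x := triv C R hR (Quotient.out x)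
  mem_baseSet_trivializationAt' x := C.mem_chart_out_source x
  trivialization_mem_atlas' _ := ⟨_, rfl⟩

theorem isLinear_triv (g : G) : (triv C R hR g).IsLinear ℂ where
  linear x _ := by
    refine ⟨fun s t => ?_, fun c s => ?_⟩
    · exact map_add (R.thetaHat C (g⁻¹ * Quotient.out x)) (outValue ρ s) (outValue ρ t)
    · exact map_smul (R.thetaHat C (g⁻¹ * Quotient.out x)) c (outValue ρ s)

/-- The coordinate change is the formula for left translations at the identity element. -/
theorem coordChangeL_triv {g g' : G} {b : G ⧸ H}
    (hb : b ∈ (C.chart g).source ∩ (C.chart g').source) :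
    haveI := isLinear_triv C R hR g
    haveI := isLinear_triv C R hR g'
    ((triv C R hR g).coordChangeL ℂ (triv C R hR g') b : W →L[ℂ] W) =
      R.thetaHat C (g'⁻¹ * g * C.sec (C.chart g b)) *
        Ring.inverse (R.thetaHat C (C.sec (C.chart g b))) := by
  haveI := isLinear_triv C R hR g
  haveI := isLinear_triv C R hR g'
  refine ContinuousLinearMap.ext fun w => ?_
  have h1 := (triv C R hR g).coordChangeL_apply (R := ℂ) (triv C R hR g') hb w
  refine h1.trans ?_
  have h2 := trivFun_translate hR 1 (g₀ := g) (g₁ := g')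
    (p := ⟨b, (triv C R hR g).symm b w⟩) hb.1 (by rw [one_smul]; exact hb.2)
  have h3 : HomBundle.translate ρ 1 ⟨b, (triv C R hR g).symm b w⟩ =
      ⟨b, (triv C R hR g).symm b w⟩ := by
    obtain ⟨⟨x, v⟩, hx⟩ := HomBundle.mk_surjective ρ ⟨b, (triv C R hR g).symm b w⟩
    rw [← hx, HomBundle.translate_mk, one_mul]
  rw [h3] at h2
  refine h2.trans ?_
  have h4 : trivFun C R ρ g ⟨b, (triv C R hR g).symm b w⟩ = (b, w) :=
    (triv C R hR g).apply_mk_symm hb.1 w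
  rw [h4, mul_one]

theorem contMDiffAt_chart {g : G} {b : G ⧸ H} (hb : b ∈ (C.chart g).source) :
    letI := C.chartedSpace
    ContMDiffAt 𝓘(ℂ, Model d) 𝓘(ℂ, Model d) ω (C.chart g) b := by
  letI := C.chartedSpace
  haveI := C.isManifold
  exact contMDiffAt_of_mem_maximalAtlas (IsManifold.subset_maximalAtlas ⟨g, rfl⟩) hb

theorem contMDiffAt_coordChange (g : G) {g₀ g₁ : G} {b : G ⧸ H} (hb : b ∈ (C.chart g₀).source)
    (hb' : g • b ∈ (C.chart g₁).source) :
    letI := C.chartedSpace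
    ContMDiffAt 𝓘(ℂ, Model d) 𝓘(ℂ, W →L[ℂ] W) ω (fun b =>
      R.thetaHat C (g₁⁻¹ * g * g₀ * C.sec (C.chart g₀ b)) *
        Ring.inverse (R.thetaHat C (C.sec (C.chart g₀ b)))) b := by
  letI := C.chartedSpace
  have h := R.contDiffAt_coordChange (g₁⁻¹ * g * g₀) ((C.chart g₀).map_source hb) (by
    rw [mul_smul, mul_smul, ← C.chart_symm_apply, (C.chart g₀).left_inv hb]
    exact hb')
  exact ContMDiffAt.comp b h.contMDiffAt (contMDiffAt_chart C hb)

theorem mem_atlas_fiberBundle {e : Trivialization W (TotalSpace.proj : HomBundle ρ → G ⧸ H)}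
    (he : letI := fiberBundle C R hR; MemTrivializationAtlas e) : ∃ g, triv C R hR g = e :=
  he.out

theorem contMDiffOn_coordChangeL_triv (g g' : G) :
    letI := C.chartedSpace
    haveI := isLinear_triv C R hR g
    haveI := isLinear_triv C R hR g'
    ContMDiffOn 𝓘(ℂ, Model d) 𝓘(ℂ, W →L[ℂ] W) ω
      (fun b => ((triv C R hR g).coordChangeL ℂ (triv C R hR g') b : W →L[ℂ] W))
      ((C.chart g).source ∩ (C.chart g').source) := by
  letI := C.chartedSpace
  haveI := isLinear_triv C R hR g
  haveI := isLinear_triv C R hR g'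
  intro b hb
  have h := contMDiffAt_coordChange C R 1 (g₁ := g') hb.1 (by rw [one_smul]; exact hb.2)
  rw [mul_one] at h
  exact h.contMDiffWithinAt.congr (fun b' hb' => coordChangeL_triv C R hR hb')
    (coordChangeL_triv C R hR hb)

theorem vectorBundle :
    letI := fiberBundle C R hR
    VectorBundle ℂ W (fun x : G ⧸ H => Fiber ρ x) := by
  letI := fiberBundle C R hR
  refine ⟨fun e he => ?_, fun e e' he he' => ?_⟩
  · obtain ⟨g, rfl⟩ := mem_atlas_fiberBundle C R hR he
    exact isLinear_triv C R hR g
  · obtain ⟨g, rfl⟩ := mem_atlas_fiberBundle C R hR he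
    obtain ⟨g', rfl⟩ := mem_atlas_fiberBundle C R hR he'
    letI := C.chartedSpace
    exact (contMDiffOn_coordChangeL_triv C R hR g g').continuousOn

theorem contMDiffVectorBundle :
    letI := C.chartedSpace
    letI := fiberBundle C R hR
    haveI := vectorBundle C R hR
    ContMDiffVectorBundle ω W (fun x : G ⧸ H => Fiber ρ x) 𝓘(ℂ, Model d) := by
  letI := C.chartedSpace
  letI := fiberBundle C R hR
  haveI := vectorBundle C R hR
  refine ⟨fun e e' he he' => ?_⟩
  obtain ⟨g, rfl⟩ := mem_atlas_fiberBundle C R hR he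
  obtain ⟨g', rfl⟩ := mem_atlas_fiberBundle C R hR he'
  exact contMDiffOn_coordChangeL_triv C R hR g g'

end Bundle

end HomogeneousComplex

namespace HomogeneousComplex

open NormedSpace Set Filter

/-! ### Smoothness of `G × W → O(W)` and holomorphy of the translations. -/

section Bundle

universe v

variable {n d : ℕ} {G : Subgroup (GL (Fin n) ℝ)} {H : Subgroup G} {𝔸 𝔹 : Type*}
  [NormedRing 𝔸] [NormedAlgebra ℝ 𝔸] [FiniteDimensional ℝ 𝔸] [CompleteSpace 𝔸]
  [NormedRing 𝔹] [NormedAlgebra ℂ 𝔹] [FiniteDimensional ℂ 𝔹] [CompleteSpace 𝔹]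
  {W : Type v} [NormedAddCommGroup W] [NormedSpace ℂ W] [FiniteDimensional ℂ W] [CompleteSpace W]
  {D : CosetData H (Model d) 𝔸 𝔹} (C : D.LocalChart) (R : D.RepData (W →L[ℂ] W))
  {ρ : Representation ℂ H W} (hR : ∀ (k : H) (w : W), R.rho k w = ρ k w)

theorem contMDiffAt_homBundle_mk (hR : ∀ (k : H) (w : W), R.rho k w = ρ k w)
    {X : Type*} [NormedAddCommGroup X] [NormedSpace ℝ X]
    {m : WithTop ℕ∞} {f : X → G} {v : X → W} {x₀ : X}
    (hf : ContDiffAt ℝ m (fun x => D.J (f x)) x₀) (hv : ContDiffAt ℝ m v x₀) :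
    letI := C.chartedSpace
    letI := fiberBundle C R hR
    ContMDiffAt 𝓘(ℝ, X) (𝓘(ℝ, Model d).prod 𝓘(ℝ, W)) m (fun x => HomBundle.mk ρ (f x, v x)) x₀ := by
  letI := C.chartedSpace
  letI := fiberBundle C R hR
  rw [Bundle.contMDiffAt_totalSpace]
  refine ⟨C.contMDiffAt_mk hf, ?_⟩
  set g : G := Quotient.out (f x₀ : G ⧸ H) with hg
  have hx₀ : (f x₀ : G ⧸ H) ∈ (C.chart g).source := C.mem_chart_out_source _
  have h1 : ContDiffAt ℝ m (fun x => R.thetaHat C (g⁻¹ * f x)) x₀ :=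
    R.contDiffAt_thetaHat_comp hf g⁻¹ hx₀
  have h2 : ContDiffAt ℝ m (fun x => R.thetaHat C (g⁻¹ * f x) (v x)) x₀ :=
    ((ContinuousLinearMap.restrictScalarsL ℂ W W ℝ ℝ).contDiff.contDiffAt.comp x₀ h1).clm_apply hv
  refine ContMDiffAt.congr_of_eventuallyEq h2.contMDiffAt ?_
  have hO : ∀ᶠ x in 𝓝 x₀, (f x : G ⧸ H) ∈ (C.chart g).source :=
    (continuous_quotient_mk'.continuousAt.comp
      (CosetData.LocalChart.continuousAt_of_contDiffAt hf)).eventually_mem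
      ((C.chart g).open_source.mem_nhds hx₀)
  filter_upwards [hO] with x hx
  exact congrArg Prod.snd (trivFun_mk hR hx (v x))

/-- In trivializations, translation by `g` acts on fibres through a matrix function of the base
point, holomorphic by `contMDiffAt_coordChange`. -/
theorem contMDiff_translate (hR : ∀ (k : H) (w : W), R.rho k w = ρ k w) (g : G) :
    letI := C.chartedSpace
    letI := fiberBundle C R hR
    ContMDiff (𝓘(ℂ, Model d).prod 𝓘(ℂ, W)) (𝓘(ℂ, Model d).prod 𝓘(ℂ, W)) ω
      (HomBundle.translate ρ g) := by
  letI := C.chartedSpace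
  letI := fiberBundle C R hR
  intro p
  have hproj := Bundle.contMDiff_proj (IB := 𝓘(ℂ, Model d)) (F := W) (n := ω)
    (fun x : G ⧸ H => Fiber ρ x)
  rw [Bundle.contMDiffAt_totalSpace]
  refine ⟨(C.contMDiff_smul g).contMDiffAt.comp p hproj.contMDiffAt, ?_⟩
  set g₀ : G := Quotient.out p.proj
  set g₁ : G := Quotient.out (g • p.proj)
  have hp : p.proj ∈ (C.chart g₀).source := C.mem_chart_out_source _
  have hp' : g • p.proj ∈ (C.chart g₁).source := C.mem_chart_out_source _
  have h1 := (Bundle.contMDiffAt_totalSpace.1 (contMDiffAt_id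
    (I := 𝓘(ℂ, Model d).prod 𝓘(ℂ, W)) (n := ω) (x := p))).2
  have h2 : ContMDiffAt (𝓘(ℂ, Model d).prod 𝓘(ℂ, W)) 𝓘(ℂ, W →L[ℂ] W) ω (fun p : HomBundle ρ =>
      R.thetaHat C (g₁⁻¹ * g * g₀ * C.sec (C.chart g₀ p.proj)) *
        Ring.inverse (R.thetaHat C (C.sec (C.chart g₀ p.proj)))) p :=
    ContMDiffAt.comp p (contMDiffAt_coordChange C R g hp hp') hproj.contMDiffAt
  refine (h2.clm_apply h1).congr_of_eventuallyEq ?_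
  have hO : ∀ᶠ p' : HomBundle ρ in 𝓝 p, p'.proj ∈ (C.chart g₀).source ∧
      g • p'.proj ∈ (C.chart g₁).source :=
    (((HomBundle.continuous_proj ρ).continuousAt).eventually_mem
      ((C.chart g₀).open_source.mem_nhds hp)).and
    (((continuous_const_smul g).comp (HomBundle.continuous_proj ρ)).continuousAt.eventually_mem
      ((C.chart g₁).open_source.mem_nhds hp'))
  filter_upwards [hO] with p' h
  exact trivFun_translate hR g h.1 h.2

theorem isHolomorphicHomBundle (hR : ∀ (k : H) (w : W), R.rho k w = ρ k w)
    (hJ : ∀ {k : ℕ} {f : EuclideanSpace ℝ (Fin k) → G} {s : Set (EuclideanSpace ℝ (Fin k))},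
      SmoothOn f s → ContDiffOn ℝ ∞ (fun x => D.J (f x)) s) :
    letI := C.chartedSpace
    IsHolomorphicHomBundle W ρ (d := d) := by
  letI := C.chartedSpace
  letI := fiberBundle C R hR
  refine ⟨fiberBundle C R hR, vectorBundle C R hR, contMDiffVectorBundle C R hR, ?_,
    contMDiff_translate C R hR⟩
  intro k s f v hs hf hv x hx
  exact (contMDiffAt_homBundle_mk C R hR ((hJ hf).contDiffAt (hs.mem_nhds hx))
    (hv.contDiffAt (hs.mem_nhds hx))).contMDiffWithinAt

end Bundle

/-! ### Assembly of the main theorem. -/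

section Main

variable {n : ℕ} {G : Subgroup (GL (Fin n) ℝ)} {𝔸 𝔹 : Type*} [NormedRing 𝔸] [NormedAlgebra ℝ 𝔸]
  [FiniteDimensional ℝ 𝔸] [CompleteSpace 𝔸] [NormedRing 𝔹] [NormedAlgebra ℂ 𝔹]
  [FiniteDimensional ℂ 𝔹] [CompleteSpace 𝔹]

theorem exists_complexStructure (Φ : Matrix (Fin n) (Fin n) ℝ ≃ₐ[ℝ] 𝔸)
    (Ψ : Matrix (Fin n) (Fin n) ℂ ≃ₐ[ℂ] 𝔹) (hG : IsClosed (G : Set (GL (Fin n) ℝ))) (q : lieAlg G)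
    (hq : IsGradingElement q) :
    ∃ (d : ℕ) (_ : ChartedSpace (Model d) (G ⧸ centralizer q)),
      IsHomogeneousComplexManifold (centralizer q) (d := d) ∧
      TangentDecomposition q (d := d) ∧
      ∀ (W : Type u) [NormedAddCommGroup W] [NormedSpace ℂ W] [FiniteDimensional ℂ W]
        (ρ : Representation ℂ (centralizer q) W), (∀ w : W, Continuous fun h => ρ h w) →
          IsHolomorphicHomBundle W ρ (d := d) := by
  obtain ⟨C⟩ := (gradedCosetData Φ Ψ q hG hq).exists_localChart
  refine ⟨cosetDim q, C.chartedSpace, isHomogeneousComplexManifold C, tangentDecomposition C, ?_⟩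
  intro W _ _ _ ρ hρ
  haveI : CompleteSpace W := FiniteDimensional.complete ℂ W
  let rho : centralizer q →* (W →L[ℂ] W) :=
    ((Module.End.toContinuousLinearMap W : (W →ₗ[ℂ] W) ≃ₐ[ℂ] (W →L[ℂ] W)) :
      (W →ₗ[ℂ] W) →* (W →L[ℂ] W)).comp ρ
  have hrho : Continuous rho := continuous_clm_apply.2 hρ
  obtain ⟨R, hR⟩ := exists_repData Φ Ψ q hG hq hrho
  exact isHolomorphicHomBundle C R (fun k w => by rw [hR]; rfl) fun hf => hf.contDiffOn Φ

end Main

end HomogeneousComplex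

end

theorem mainTheorem10 {n : ℕ} (G : Subgroup (GL (Fin n) ℝ))
    (hclosed : IsClosed (G : Set (GL (Fin n) ℝ))) (hconn : ConnectedSpace G)
    (hss : LieAlgebra.IsSemisimple ℝ (HomogeneousComplex.lieAlg G))
    (q : HomogeneousComplex.lieAlg G) (hq : HomogeneousComplex.IsGradingElement q) :
    ∃ (d : ℕ) (_ : ChartedSpace (HomogeneousComplex.Model d)
        (G ⧸ HomogeneousComplex.centralizer q)),
      HomogeneousComplex.IsHomogeneousComplexManifold (HomogeneousComplex.centralizer q) (d := d) ∧
      HomogeneousComplex.TangentDecomposition q (d := d) ∧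
      ∀ (W : Type u) [NormedAddCommGroup W] [NormedSpace ℂ W] [FiniteDimensional ℂ W]
        (ρ : Representation ℂ (HomogeneousComplex.centralizer q) W),
        (∀ w : W, Continuous fun h => ρ h w) →
          HomogeneousComplex.IsHolomorphicHomBundle W ρ (d := d) :=
  HomogeneousComplex.exists_complexStructure
    -- Matrices are replaced by continuous endomorphisms, whose operator norm makes them Banach
    -- algebras.
    (Matrix.toLinAlgEquiv'.trans (Module.End.toContinuousLinearMap (Fin n → ℝ)))
    (Matrix.toLinAlgEquiv'.trans (Module.End.toContinuousLinearMap (Fin n → ℂ))) hclosed q hq
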